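/- Work in dimension one and write $L^2=L^2(\mathbb R^2;\mathbb C)$ for functions of $(x,y)\in\mathbb R^2$. For every $\hbar>0$ let $V$ be a real-valued potential on $\mathbb R$ (it may depend on $\hbar$) of class $C^4$, and assume that there is a constant $C$ independent of $\hbar$ with $$\|V^{(n)}\|_{L^\infty(\mathbb R)}\le C,\qquad n=2,3,4 .$$ For every $\hbar>0$ let $R^{in}_\hbar,\hat R^{in}_\hbar\in L^2$, and assume that there is a constant $\mathcal C_0$ independent of $\hbar$ such that $$\|x^a\partial_x^b y^\alpha\partial_y^\beta \hat R^{in}_\hbar\|_{L^2}<\mathcal C_0\quad\text{for all integers } a,b,\alpha,\beta\ge 0 \text{ with } a+b+\alpha+\beta\le 3,\qquad \|R^{in}_\hbar\|_{L^2}<\mathcal C_0,$$ where derivatives are taken in the sense of distributions. Then for each $t\ge 0$ there is a constant $\mathcal C_t$, independent of $\hbar$, such that for every $\hbar>0$ the following holds. Let $R\in C([0,\infty);L^2)$ be the solution of the von Neumann equation in Weyl variables $$\partial_t R=i\,\partial_x\partial_y R-i\,\frac{V(x+\frac{\hbar}{2}y)-V(x-\frac{\hbar}{2}y)}{\hbar}\,R,\qquad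 R(0)=R^{in}_\hbar,$$ and let $\hat R\in C([0,\infty);L^2)$ be the solution of the semiclassical limit equation $$\partial_t\hat R=i\,\partial_x\partial_y\hat R-i\,V'(x)\,y\,\hat R,\qquad \hat R(0)=\hat R^{in}_\hbar,$$ both in the sense of distributions, that is, tested against $C_c^\infty(\mathbb R^2)$ functions of $(x,y)$. Then $$\|R(t)-\hat R(t)\|_{L^2}\le\|R^{in}_\hbar-\hat R^{in}_\hbar\|_{L^2}+\mathcal C_t\,\hbar^2,\qquad t\ge 0 .$$ -/

import Mathlib

open MeasureTheory Set

/-- The complex Hilbert space `L²(ℝ²)`, with Lebesgue measure on the plane of points `(x, y)`. -/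
abbrev PlaneL2 : Type := Lp ℂ 2 (volume : Measure (ℝ × ℝ))

/-- Test functions: smooth and compactly supported complex functions on the plane. -/
structure IsTestFun (φ : ℝ × ℝ → ℂ) : Prop where
  smooth : ContDiff ℝ (⊤ : ℕ∞) φ
  compact_support : HasCompactSupport φ

/-- The partial derivative in the first variable. -/
noncomputable def partialX (φ : ℝ × ℝ → ℂ) : ℝ × ℝ → ℂ :=
  fun p => deriv (fun s : ℝ => φ (s, p.2)) p.1

/-- The partial derivative in the second variable. -/
noncomputable def partialY (φ : ℝ × ℝ → ℂ) : ℝ × ℝ → ℂ :=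
  fun p => deriv (fun s : ℝ => φ (p.1, s)) p.2

/-- The identity `x^a ∂_x^b y^α ∂_y^β f = h` in the sense of distributions on the plane: the
transposed differential operator, with the sign of `b + β` integrations by parts, is moved onto the
test function. -/
def IsWeightedWeakDeriv (a b α β : ℕ) (f h : PlaneL2) : Prop :=
  ∀ φ : ℝ × ℝ → ℂ, IsTestFun φ →
    ∫ p, h p * φ p =
      (-1 : ℂ) ^ (b + β) * ∫ p, f p *
        (partialY^[β] (fun q : ℝ × ℝ => (q.2 : ℂ) ^ α *
          partialX^[b] (fun r : ℝ × ℝ => (r.1 : ℂ) ^ a * φ r) q)) p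

/-- The distribution `x^a ∂_x^b y^α ∂_y^β f` is a function in `L²(ℝ²)` with norm smaller
than `C`. -/
def WeightedDerivNormLT (a b α β : ℕ) (f : PlaneL2) (C : ℝ) : Prop :=
  ∃ h : PlaneL2, IsWeightedWeakDeriv a b α β f h ∧ ‖h‖ < C

/-- `u ∈ C([0, ∞); L²(ℝ²))` is the weak (distributional) solution of
`∂_t u = i ∂_x ∂_y u - i W u` with `u(0) = u₀`. -/
structure IsWeakSolution (W : ℝ × ℝ → ℝ) (u₀ : PlaneL2) (u : ℝ → PlaneL2) : Prop where
  continuous : ContinuousOn u (Ici 0)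
  initial : u 0 = u₀
  equation : ∀ φ : ℝ × ℝ → ℂ, IsTestFun φ → ∀ t : ℝ, 0 ≤ t →
    HasDerivWithinAt (fun s : ℝ => ∫ p, u s p * φ p)
      (∫ p, u t p * (Complex.I * partialX (partialY φ) p - Complex.I * (W p : ℂ) * φ p))
      (Ici 0) t

/-- The potential term `(V(x + ħy/2) - V(x - ħy/2)) / ħ` of the von Neumann equation in Weyl
variables. -/
noncomputable def weylPotential (ħ : ℝ) (V : ℝ → ℝ) : ℝ × ℝ → ℝ :=
  fun p => (V (p.1 + ħ / 2 * p.2) - V (p.1 - ħ / 2 * p.2)) / ħ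

/-- The potential term `V'(x) y` of the semiclassical limit equation. -/
noncomputable def limitPotential (V : ℝ → ℝ) : ℝ × ℝ → ℝ :=
  fun p => deriv V p.1 * p.2

/-- `R` solves the von Neumann equation in Weyl variables with initial data `R₀`. -/
def IsVonNeumannSolution (ħ : ℝ) (V : ℝ → ℝ) (R₀ : PlaneL2) (R : ℝ → PlaneL2) : Prop :=
  IsWeakSolution (weylPotential ħ V) R₀ R

/-- `R` solves the semiclassical limit equation with initial data `R₀`. -/
def IsLimitSolution (V : ℝ → ℝ) (R₀ : PlaneL2) (R : ℝ → PlaneL2) : Prop :=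
  IsWeakSolution (limitPotential V) R₀ R

/-! The difference w = R - R̂ solves the von Neumann equation with a source, ∂_t w = i ∂_x ∂_y w - i
W w + F, where W is the Weyl potential and F = -i (W - V'(x) y) R̂. The even terms of the Taylor
expansion of V cancel in the symmetric difference, so |W - V'(x) y| ≤ (C/4) ħ² |y|³
(`abs_weylPotential_sub_limitPotential_le`) and ‖F‖ ≤ (C/4) ħ² ‖y³ R̂‖. Since i ∂_x ∂_y - i W is
formally skew-adjoint, ‖w(T)‖ ≤ ‖w(0)‖ + T sup ‖F‖. Two points need proof: this energy inequality
for solutions that are only distributional, and a bound on ‖y³ R̂(t)‖ that does not depend on ħ.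

The energy inequality is `IsForcedWeakSolution.norm_le`. The solution is regularized by f ↦ χ(ε·)(f
⋆ ρ_ε), with cutoff radius 1/ε tied to the mollification scale ε. The skew-adjoint part drops out of
the derivative of the regularized energy, leaving F and a commutator. The mixed derivative puts at
least one derivative on the cutoff, whose factor ε pays for the derivative on ρ_ε. The potential
grows at most quadratically, so its increment over a distance ε is bounded on the ball of radius
2/ε. The commutator is thus bounded uniformly in ε, with a weight that tends to zero pointwise;
Young's inequality and dominated convergence make it vanish in the limit
(`exists_sqrt_integral_commKernel_le`, `tendsto_tailMass`).

The moment bound is `IsLimitSolution.exists_third_moment`. The limit equation is approximated by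
bounded skew-adjoint generators, with central differences for the derivatives and sin(δ V')/δ ·
sin(δ y)/δ for V' y. Commuting with y trades a factor y for a derivative in x, and commuting with
∂_x trades a derivative for a factor y. The families y^α ∂_x^b u with b + α ≤ 3 therefore form a
closed system, and Gronwall's lemma bounds them uniformly in δ (`DampedForce.exists_jet_evolution`).
The family is evolved as a whole inside the closed space of consistent families, so no regularity is
assumed a priori. A weak limit along an ultrafilter solves the limit equation and keeps the moments;
by uniqueness, which is the energy inequality with F = 0, it is R̂. -/

open Filter Topology

/-! ### Duality of L² with test functions -/

section Pairing

/-- The bilinear pairing `f ↦ ∫ f ψ` on `L²(ℝ²)`. -/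
noncomputable def pairL (ψ : PlaneL2) : PlaneL2 →L[ℂ] ℂ := innerSL ℂ (star ψ)

lemma pairL_apply (ψ f : PlaneL2) : pairL ψ f = ∫ p, f p * ψ p := by
  rw [pairL, innerSL_apply_apply, L2.inner_def]
  refine integral_congr_ae ?_
  filter_upwards [Lp.coeFn_star ψ] with p hp
  simp [hp, mul_comm]

lemma norm_star_planeL2 (ψ : PlaneL2) : ‖star ψ‖ = ‖ψ‖ := by
  rw [Lp.norm_def, Lp.norm_def]
  refine congrArg _ (eLpNorm_congr_norm_ae ?_)
  filter_upwards [Lp.coeFn_star ψ] with p hp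
  simp [hp]

lemma norm_pairL_le (ψ f : PlaneL2) : ‖pairL ψ f‖ ≤ ‖ψ‖ * ‖f‖ := by
  rw [pairL, innerSL_apply_apply]
  exact (norm_inner_le_norm _ _).trans_eq (by rw [norm_star_planeL2])

lemma pairL_star_self (f : PlaneL2) : pairL (star f) f = (‖f‖ : ℂ) ^ 2 := by
  rw [pairL, innerSL_apply_apply, star_star, inner_self_eq_norm_sq_to_K]; rfl

lemma pairL_comm (ψ f : PlaneL2) : pairL ψ f = pairL f ψ := by
  simp only [pairL_apply, mul_comm]

lemma pairL_sub_left (ψ ψ' f : PlaneL2) : pairL (ψ - ψ') f = pairL ψ f - pairL ψ' f := by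
  rw [pairL_comm, map_sub, pairL_comm f, pairL_comm f]

lemma integral_mul_eq_pairL {φ : ℝ × ℝ → ℂ} (hφ : MemLp φ 2 volume) (f : PlaneL2) :
    ∫ p, f p * φ p = pairL hφ.toLp f := by
  rw [pairL_apply]
  refine integral_congr_ae ?_
  filter_upwards [hφ.coeFn_toLp] with p hp
  rw [hp]

lemma integrable_mul_of_memLp {φ : ℝ × ℝ → ℂ} (hφ : MemLp φ 2 volume) (f : PlaneL2) :
    Integrable (fun p => f p * φ p) := by
  have := MemLp.integrable_mul (Lp.memLp f) hφ
  exact this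

lemma memLp_of_cc {φ : ℝ × ℝ → ℂ} (h : Continuous φ) (hc : HasCompactSupport φ) :
    MemLp φ 2 volume := h.memLp_of_hasCompactSupport hc

lemma integrable_mul_cc {φ : ℝ × ℝ → ℂ} (h : Continuous φ) (hc : HasCompactSupport φ)
    (f : PlaneL2) : Integrable (fun p => f p * φ p) :=
  integrable_mul_of_memLp (memLp_of_cc h hc) f

lemma IsTestFun.memLp {φ : ℝ × ℝ → ℂ} (h : IsTestFun φ) : MemLp φ 2 volume :=
  memLp_of_cc h.smooth.continuous h.compact_support

lemma exists_testFun_near (f : PlaneL2) {η : ℝ} (hη : 0 < η) :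
    ∃ φ : ℝ × ℝ → ℂ, ∃ h : IsTestFun φ, ‖f - h.memLp.toLp‖ ≤ η := by
  obtain ⟨g, ⟨φ, hgφ, hc, hs⟩, hg⟩ := (Lp.dense_hasCompactSupport_contDiff (E := ℝ × ℝ) (F := ℂ)
    (μ := volume) (p := 2) (by norm_num)).exists_dist_lt f hη
  refine ⟨φ, ⟨hs, hc⟩, ?_⟩
  have : g = (IsTestFun.memLp ⟨hs, hc⟩ : MemLp φ 2 volume).toLp := by
    refine Lp.ext ?_
    filter_upwards [hgφ, (IsTestFun.memLp ⟨hs, hc⟩ : MemLp φ 2 volume).coeFn_toLp] with p h1 h2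
    rw [h1, h2]
  rw [← this, ← dist_eq_norm]
  exact hg.le

/-- Test functions are dense, so the bound extends to all of L², and the dual norm is the norm. -/
lemma norm_le_of_pairing_le (f : PlaneL2) {c : ℝ} (hc : 0 ≤ c)
    (h : ∀ φ : ℝ × ℝ → ℂ, ∀ hφ : IsTestFun φ, ‖∫ p, f p * φ p‖ ≤ c * ‖hφ.memLp.toLp‖) :
    ‖f‖ ≤ c := by
  have key : ∀ ψ : PlaneL2, ‖pairL ψ f‖ ≤ c * ‖ψ‖ := by
    intro ψ
    refine le_of_forall_pos_le_add fun η hη => ?_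
    obtain ⟨φ, hφ, hd⟩ := exists_testFun_near ψ (η := η / (‖f‖ + c + 1)) (by positivity)
    have h1 := h φ hφ
    rw [integral_mul_eq_pairL hφ.memLp] at h1
    have h2 : pairL ψ f = pairL hφ.memLp.toLp f + pairL (ψ - hφ.memLp.toLp) f := by
      rw [pairL_sub_left]; ring
    have h3 : ‖hφ.memLp.toLp‖ ≤ ‖ψ‖ + ‖ψ - hφ.memLp.toLp‖ := by
      have := norm_sub_le ψ (ψ - hφ.memLp.toLp)
      simpa using this
    have h4 := norm_pairL_le (ψ - hφ.memLp.toLp) f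
    have h5 : η / (‖f‖ + c + 1) * (‖f‖ + c + 1) = η := by
      field_simp
    rw [h2]
    refine (norm_add_le _ _).trans ?_
    nlinarith [norm_nonneg f, norm_nonneg (ψ - hφ.memLp.toLp), mul_le_mul_of_nonneg_left h3 hc,
      mul_le_mul_of_nonneg_right hd (norm_nonneg f), mul_le_mul_of_nonneg_left hd hc,
      show 0 ≤ η / (‖f‖ + c + 1) by positivity]
  -- Pairing with the conjugate of f turns the bound into ‖f‖² ≤ c ‖f‖.
  have := key (star f)
  rw [pairL_star_self, norm_star_planeL2, norm_pow, Complex.norm_real, norm_norm] at this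
  by_contra hlt
  push Not at hlt
  nlinarith [norm_nonneg f]

lemma eq_of_pairing_eq {f g : PlaneL2}
    (h : ∀ φ : ℝ × ℝ → ℂ, IsTestFun φ → ∫ p, f p * φ p = ∫ p, g p * φ p) : f = g := by
  rw [← sub_eq_zero, ← norm_le_zero_iff]
  refine norm_le_of_pairing_le _ le_rfl fun φ hφ => ?_
  have := h φ hφ
  rw [integral_mul_eq_pairL hφ.memLp, integral_mul_eq_pairL hφ.memLp] at this
  rw [integral_mul_eq_pairL hφ.memLp, map_sub, this]
  simp

/-- Reduces L² convergence to uniform convergence when all supports lie in one compact set. -/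
lemma norm_toLp_le_of_bounded_on {φ : ℝ × ℝ → ℂ} (hφ : MemLp φ 2 volume) {K : Set (ℝ × ℝ)}
    (hK : IsCompact K) {c : ℝ} (hc : 0 ≤ c) (hb : ∀ p, ‖φ p‖ ≤ c) (h0 : ∀ p, p ∉ K → φ p = 0) :
    ‖hφ.toLp‖ ≤ c * (volume K).toReal ^ (1 / 2 : ℝ) := by
  rw [Lp.norm_toLp]
  have h1 : eLpNorm φ 2 volume ≤ eLpNorm (K.indicator fun _ => c) 2 volume := by
    refine eLpNorm_mono_real fun p => ?_
    by_cases hp : p ∈ K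
    · simpa [hp] using hb p
    · simp [hp, h0 p hp]
  rw [eLpNorm_indicator_const hK.measurableSet (by norm_num) (by norm_num)] at h1
  have h2 := ENNReal.toReal_mono ?_ h1
  · refine h2.trans_eq ?_
    rw [ENNReal.toReal_mul, ← ENNReal.toReal_rpow]
    simp [abs_of_nonneg hc]
  · exact ENNReal.mul_ne_top (by simp) (ENNReal.rpow_ne_top_of_nonneg (by norm_num) hK.measure_ne_top)

end Pairing

/-! ### Calculus of the two partial derivatives -/

section Partials

variable {φ ψ : ℝ × ℝ → ℂ}

lemma hasDerivAt_slice_fst {p : ℝ × ℝ} {x y : ℝ} (h : DifferentiableAt ℝ φ (x, y)) (hp : p = (x, y)) :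
    HasDerivAt (fun s : ℝ => φ (s, y)) (fderiv ℝ φ p (1, 0)) x := by
  subst hp
  have h1 : HasDerivAt (fun s : ℝ => (s, y)) ((1 : ℝ), (0 : ℝ)) x :=
    (hasDerivAt_id x).prodMk (hasDerivAt_const x y)
  exact h.hasFDerivAt.comp_hasDerivAt x h1

lemma hasDerivAt_slice_snd {p : ℝ × ℝ} {x y : ℝ} (h : DifferentiableAt ℝ φ (x, y)) (hp : p = (x, y)) :
    HasDerivAt (fun s : ℝ => φ (x, s)) (fderiv ℝ φ p (0, 1)) y := by
  subst hp
  have h1 : HasDerivAt (fun s : ℝ => (x, s)) ((0 : ℝ), (1 : ℝ)) y :=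
    (hasDerivAt_const y x).prodMk (hasDerivAt_id y)
  exact h.hasFDerivAt.comp_hasDerivAt y h1

lemma partialX_apply (h : Differentiable ℝ φ) (p : ℝ × ℝ) :
    partialX φ p = fderiv ℝ φ p (1, 0) :=
  (hasDerivAt_slice_fst (x := p.1) (y := p.2) (h _) rfl).deriv

lemma partialY_apply (h : Differentiable ℝ φ) (p : ℝ × ℝ) :
    partialY φ p = fderiv ℝ φ p (0, 1) :=
  (hasDerivAt_slice_snd (x := p.1) (y := p.2) (h _) rfl).deriv

lemma partialX_eq (h : Differentiable ℝ φ) : partialX φ = fun p => fderiv ℝ φ p (1, 0) :=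
  funext (partialX_apply h)

lemma partialY_eq (h : Differentiable ℝ φ) : partialY φ = fun p => fderiv ℝ φ p (0, 1) :=
  funext (partialY_apply h)

lemma hasDerivAt_partialX (h : Differentiable ℝ φ) (x y : ℝ) :
    HasDerivAt (fun s : ℝ => φ (s, y)) (partialX φ (x, y)) x := by
  rw [partialX_apply h]; exact hasDerivAt_slice_fst (h _) rfl

lemma hasDerivAt_partialY (h : Differentiable ℝ φ) (x y : ℝ) :
    HasDerivAt (fun s : ℝ => φ (x, s)) (partialY φ (x, y)) y := by
  rw [partialY_apply h]; exact hasDerivAt_slice_snd (h _) rfl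

lemma contDiff_partialX {m n : WithTop ℕ∞} (h : ContDiff ℝ n φ) (hmn : m + 1 ≤ n) :
    ContDiff ℝ m (partialX φ) := by
  rw [partialX_eq (h.differentiable (by rintro rfl; simp at hmn))]
  exact (h.fderiv_right hmn).clm_apply contDiff_const

lemma contDiff_partialY {m n : WithTop ℕ∞} (h : ContDiff ℝ n φ) (hmn : m + 1 ≤ n) :
    ContDiff ℝ m (partialY φ) := by
  rw [partialY_eq (h.differentiable (by rintro rfl; simp at hmn))]
  exact (h.fderiv_right hmn).clm_apply contDiff_const

lemma hasCompactSupport_partialX (h : Differentiable ℝ φ) (hc : HasCompactSupport φ) :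
    HasCompactSupport (partialX φ) := by
  rw [partialX_eq h]; exact hc.fderiv_apply (𝕜 := ℝ) _

lemma hasCompactSupport_partialY (h : Differentiable ℝ φ) (hc : HasCompactSupport φ) :
    HasCompactSupport (partialY φ) := by
  rw [partialY_eq h]; exact hc.fderiv_apply (𝕜 := ℝ) _

lemma IsTestFun.differentiable (h : IsTestFun φ) : Differentiable ℝ φ :=
  h.smooth.differentiable (by simp)

lemma IsTestFun.contDiff_nat (h : IsTestFun φ) (n : ℕ) : ContDiff ℝ n φ :=
  h.smooth.of_le (by exact_mod_cast le_top)

lemma IsTestFun.continuous (h : IsTestFun φ) : Continuous φ := h.smooth.continuous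

lemma IsTestFun.partialX (h : IsTestFun φ) : IsTestFun (partialX φ) :=
  ⟨contDiff_partialX h.smooth (by simp), hasCompactSupport_partialX h.differentiable h.2⟩

lemma IsTestFun.partialY (h : IsTestFun φ) : IsTestFun (partialY φ) :=
  ⟨contDiff_partialY h.smooth (by simp), hasCompactSupport_partialY h.differentiable h.2⟩

lemma IsTestFun.smooth_mul (h : IsTestFun φ) (hψ : ContDiff ℝ (⊤ : ℕ∞) ψ) :
    IsTestFun (fun p => ψ p * φ p) :=
  ⟨hψ.mul h.smooth, h.2.mul_left⟩

lemma IsTestFun.comp_add (h : IsTestFun φ) (a : ℝ × ℝ) : IsTestFun (fun p => φ (p + a)) :=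
  ⟨h.smooth.comp (contDiff_id.add contDiff_const),
    h.2.comp_homeomorph (Homeomorph.addRight a)⟩

lemma partialX_mul (h : Differentiable ℝ φ) (hψ : Differentiable ℝ ψ) (p : ℝ × ℝ) :
    partialX (fun q => φ q * ψ q) p = partialX φ p * ψ p + φ p * partialX ψ p :=
  ((hasDerivAt_partialX h p.1 p.2).mul (hasDerivAt_partialX hψ p.1 p.2)).deriv

lemma partialY_mul (h : Differentiable ℝ φ) (hψ : Differentiable ℝ ψ) (p : ℝ × ℝ) :
    partialY (fun q => φ q * ψ q) p = partialY φ p * ψ p + φ p * partialY ψ p :=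
  ((hasDerivAt_partialY h p.1 p.2).mul (hasDerivAt_partialY hψ p.1 p.2)).deriv

lemma partialX_comp_add (a p : ℝ × ℝ) :
    partialX (fun q => φ (q + a)) p = partialX φ (p + a) := by
  have := deriv_comp_add_const (fun s => φ (s, p.2 + a.2)) a.1 p.1
  exact this

end Partials

/-! ### Integral operators with continuous compactly supported kernels -/

section Kernel

/-- The integral operator with kernel `k`. -/
noncomputable def kernelOp (k : (ℝ × ℝ) × (ℝ × ℝ) → ℂ) (f : PlaneL2) (p : ℝ × ℝ) : ℂ :=
  ∫ q, f q * k (p, q)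

variable {k : (ℝ × ℝ) × (ℝ × ℝ) → ℂ}

lemma kernel_slice_continuous (hk : Continuous k) (p : ℝ × ℝ) : Continuous fun q => k (p, q) :=
  hk.comp (by fun_prop)

lemma kernel_slice_hasCompactSupport (hc : HasCompactSupport k) (p : ℝ × ℝ) :
    HasCompactSupport fun q => k (p, q) := by
  refine HasCompactSupport.intro (hc.isCompact.image continuous_snd) fun q hq => ?_
  by_contra h
  exact hq ⟨(p, q), subset_tsupport _ h, rfl⟩

lemma kernelOp_eq_zero {f : PlaneL2} {p : ℝ × ℝ} (hp : p ∉ Prod.fst '' tsupport k) :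
    kernelOp k f p = 0 := by
  have : ∀ q, k (p, q) = 0 := fun q => by
    by_contra h
    exact hp ⟨(p, q), subset_tsupport _ h, rfl⟩
  simp [kernelOp, this]

lemma kernelOp_hasCompactSupport (hc : HasCompactSupport k) (f : PlaneL2) :
    HasCompactSupport (kernelOp k f) :=
  HasCompactSupport.intro (hc.isCompact.image continuous_fst) fun _ hp => kernelOp_eq_zero hp

lemma kernelOp_continuous (hk : Continuous k) (hc : HasCompactSupport k) (f : PlaneL2) :
    Continuous (kernelOp k f) := by
  obtain ⟨C, hC⟩ := hk.bounded_above_of_compact_support hc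
  set K := Prod.snd '' tsupport k
  have hK : IsCompact K := hc.isCompact.image continuous_snd
  have hind : MemLp (K.indicator fun _ => (C : ℂ)) 2 volume :=
    memLp_indicator_const 2 hK.measurableSet _ (Or.inr hK.measure_ne_top)
  refine continuous_of_dominated (bound := fun q => ‖f q * K.indicator (fun _ => (C : ℂ)) q‖)
    (fun p => (Lp.aestronglyMeasurable f).mul
      (kernel_slice_continuous hk p).aestronglyMeasurable)
    (fun p => Eventually.of_forall fun q => ?_) (integrable_mul_of_memLp hind f).norm
    (Eventually.of_forall fun q => continuous_const.mul (hk.comp (by fun_prop)))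
  rw [norm_mul, norm_mul]
  refine mul_le_mul_of_nonneg_left ?_ (norm_nonneg _)
  by_cases hq : q ∈ K
  · simpa [hq] using (hC (p, q)).trans (le_abs_self C)
  · have : k (p, q) = 0 := by
      by_contra h
      exact hq ⟨(p, q), subset_tsupport _ h, rfl⟩
    simp [this]

/-- Cauchy–Schwarz on each slice; the slices are bounded and supported in one compact set, so the
constant is uniform in the point. It provides the domination needed to differentiate the energy
under the integral. -/
lemma exists_kernelOp_bound (hk : Continuous k) (hc : HasCompactSupport k) :
    ∃ C, 0 ≤ C ∧ ∀ (f : PlaneL2) p, ‖kernelOp k f p‖ ≤ C * ‖f‖ := by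
  obtain ⟨C, hC⟩ := hk.bounded_above_of_compact_support hc
  have hC0 : 0 ≤ C := (norm_nonneg _).trans (hC 0)
  set K := Prod.snd '' tsupport k
  have hK : IsCompact K := hc.isCompact.image continuous_snd
  refine ⟨C * (volume K).toReal ^ (1 / 2 : ℝ), by positivity, fun f p => ?_⟩
  have hm : MemLp (fun q => k (p, q)) 2 volume :=
    memLp_of_cc (kernel_slice_continuous hk p) (kernel_slice_hasCompactSupport hc p)
  rw [kernelOp, integral_mul_eq_pairL hm]
  refine (norm_pairL_le _ _).trans (mul_le_mul_of_nonneg_right ?_ (norm_nonneg _))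
  refine norm_toLp_le_of_bounded_on hm hK hC0 (fun q => hC _) fun q hq => ?_
  by_contra h
  exact hq ⟨(p, q), subset_tsupport _ h, rfl⟩

lemma kernelOp_memLp (hk : Continuous k) (hc : HasCompactSupport k) (f : PlaneL2) :
    MemLp (kernelOp k f) 2 volume :=
  memLp_of_cc (kernelOp_continuous hk hc f) (kernelOp_hasCompactSupport hc f)

/-- If the values of `t ↦ K u(t)` are differentiable at every point of the plane, with locally
bounded derivatives, then so is the square of its `L²` norm. -/
lemma hasDerivAt_integral_norm_sq {U D : ℝ → ℝ × ℝ → ℂ} {K : Set (ℝ × ℝ)} (hK : IsCompact K)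
    {C T t : ℝ} (ht : t ∈ Ioo 0 T)
    (hU : ∀ s, Continuous (U s)) (hD : Continuous (D t))
    (hUK : ∀ s p, p ∉ K → U s p = 0)
    (hUC : ∀ s ∈ Ioo 0 T, ∀ p, ‖U s p‖ ≤ C) (hDC : ∀ s ∈ Ioo 0 T, ∀ p, ‖D s p‖ ≤ C)
    (hder : ∀ s ∈ Ioo 0 T, ∀ p, HasDerivAt (fun r => U r p) (D s p) s) :
    HasDerivAt (fun s => ∫ p, ‖U s p‖ ^ 2)
      (∫ p, 2 * (starRingEnd ℂ (U t p) * D t p).re) t := by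
  have hDm : Continuous fun p => 2 * (starRingEnd ℂ (U t p) * D t p).re :=
    continuous_const.mul (Complex.continuous_re.comp
      ((Complex.continuous_conj.comp (hU t)).mul hD))
  refine (hasDerivAt_integral_of_dominated_loc_of_deriv_le (μ := volume)
    (x₀ := t) (s := Ioo 0 T) (F := fun s p => ‖U s p‖ ^ 2)
    (F' := fun s p => 2 * (starRingEnd ℂ (U s p) * D s p).re)
    (bound := K.indicator fun _ => 2 * (C * C)) (Ioo_mem_nhds ht.1 ht.2)
    (Eventually.of_forall fun s => ((hU s).norm.pow 2).aestronglyMeasurable) ?_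
    hDm.aestronglyMeasurable ?_ ?_ ?_).2
  · exact ((hU t).norm.pow 2).integrable_of_hasCompactSupport
      (HasCompactSupport.intro hK fun p hp => by simp [hUK t p hp])
  · refine Eventually.of_forall fun p s hs => ?_
    by_cases hp : p ∈ K
    · rw [indicator_of_mem hp, norm_mul, Real.norm_ofNat]
      refine mul_le_mul_of_nonneg_left ((Complex.abs_re_le_norm _).trans ?_) (by norm_num)
      rw [norm_mul, RCLike.norm_conj]
      exact mul_le_mul (hUC s hs p) (hDC s hs p) (norm_nonneg _)
        ((norm_nonneg _).trans (hUC s hs p))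
    · simp [hp, hUK s p hp]
  · exact (integrable_indicator_iff hK.measurableSet).2
      (integrableOn_const hK.measure_ne_top)
  · refine Eventually.of_forall fun p s hs => ?_
    have h := hder s hs p
    have hre : HasDerivAt (fun r => (U r p).re) (D s p).re s :=
      (Complex.reCLM.hasFDerivAt.comp_hasDerivAt s h)
    have him : HasDerivAt (fun r => (U r p).im) (D s p).im s :=
      (Complex.imCLM.hasFDerivAt.comp_hasDerivAt s h)
    have h2 := (hre.pow 2).add (him.pow 2)
    refine (h2.congr_deriv ?_).congr_of_eventuallyEq (Eventually.of_forall fun r => ?_)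
    · simp; ring
    · simp [← Complex.normSq_eq_norm_sq, Complex.normSq_apply]; ring

lemma continuousWithinAt_integral_norm_sq {U : ℝ → ℝ × ℝ → ℂ} {K : Set (ℝ × ℝ)} (hK : IsCompact K)
    {C t : ℝ} {s : Set ℝ} (hU : ∀ r, Continuous (U r))
    (hUK : ∀ r p, p ∉ K → U r p = 0) (hUC : ∀ r ∈ s, ∀ p, ‖U r p‖ ≤ C)
    (hcont : ∀ p, ContinuousWithinAt (fun r => U r p) s t) :
    ContinuousWithinAt (fun r => ∫ p, ‖U r p‖ ^ 2) s t := by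
  refine continuousWithinAt_of_dominated (bound := K.indicator fun _ => C ^ 2)
    (Eventually.of_forall fun r => ((hU r).norm.pow 2).aestronglyMeasurable) ?_
    ((integrable_indicator_iff hK.measurableSet).2 (integrableOn_const hK.measure_ne_top))
    (Eventually.of_forall fun p => (hcont p).norm.pow 2)
  filter_upwards [self_mem_nhdsWithin] with r hr
  refine Eventually.of_forall fun p => ?_
  by_cases hp : p ∈ K
  · rw [indicator_of_mem hp, norm_pow, norm_norm]
    exact pow_le_pow_left₀ (norm_nonneg _) (hUC r hr p) 2
  · simp [hp, hUK r p hp]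

end Kernel

/-! ### Integration by parts and formal skew-adjointness -/

section IntegrationByParts

lemma integral_mul_partialX {f g : ℝ × ℝ → ℂ} (hf : ContDiff ℝ 1 f) (hg : ContDiff ℝ 1 g)
    (hc : HasCompactSupport g) :
    ∫ p, f p * partialX g p = -∫ p, partialX f p * g p := by
  have hfd := hf.differentiable one_ne_zero
  have hgd := hg.differentiable one_ne_zero
  rw [partialX_eq hfd, partialX_eq hgd]
  have hf' : Continuous fun p => fderiv ℝ f p (1, 0) := (hf.continuous_fderiv one_ne_zero).clm_apply continuous_const
  have hg' : Continuous fun p => fderiv ℝ g p (1, 0) := (hg.continuous_fderiv one_ne_zero).clm_apply continuous_const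
  exact integral_mul_fderiv_eq_neg_fderiv_mul_of_integrable
    ((hf'.mul hg.continuous).integrable_of_hasCompactSupport hc.mul_left)
    ((hf.continuous.mul hg').integrable_of_hasCompactSupport (hc.fderiv_apply (𝕜 := ℝ) _).mul_left)
    ((hf.continuous.mul hg.continuous).integrable_of_hasCompactSupport hc.mul_left)
    (fun x _ => hfd x) (fun x _ => hgd x)

lemma integral_mul_partialY {f g : ℝ × ℝ → ℂ} (hf : ContDiff ℝ 1 f) (hg : ContDiff ℝ 1 g)
    (hc : HasCompactSupport g) :
    ∫ p, f p * partialY g p = -∫ p, partialY f p * g p := by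
  have hfd := hf.differentiable one_ne_zero
  have hgd := hg.differentiable one_ne_zero
  rw [partialY_eq hfd, partialY_eq hgd]
  have hf' : Continuous fun p => fderiv ℝ f p (0, 1) := (hf.continuous_fderiv one_ne_zero).clm_apply continuous_const
  have hg' : Continuous fun p => fderiv ℝ g p (0, 1) := (hg.continuous_fderiv one_ne_zero).clm_apply continuous_const
  exact integral_mul_fderiv_eq_neg_fderiv_mul_of_integrable
    ((hf'.mul hg.continuous).integrable_of_hasCompactSupport hc.mul_left)
    ((hf.continuous.mul hg').integrable_of_hasCompactSupport (hc.fderiv_apply (𝕜 := ℝ) _).mul_left)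
    ((hf.continuous.mul hg.continuous).integrable_of_hasCompactSupport hc.mul_left)
    (fun x _ => hfd x) (fun x _ => hgd x)

lemma partialX_conj {f : ℝ × ℝ → ℂ} (hf : Differentiable ℝ f) (p : ℝ × ℝ) :
    partialX (fun q => starRingEnd ℂ (f q)) p = starRingEnd ℂ (partialX f p) :=
  (hasDerivAt_partialX hf p.1 p.2).star_conj.deriv

lemma partialY_conj {f : ℝ × ℝ → ℂ} (hf : Differentiable ℝ f) (p : ℝ × ℝ) :
    partialY (fun q => starRingEnd ℂ (f q)) p = starRingEnd ℂ (partialY f p) :=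
  (hasDerivAt_partialY hf p.1 p.2).star_conj.deriv

lemma partialX_partialY_comm {f : ℝ × ℝ → ℂ} (hf : ContDiff ℝ 2 f) (p : ℝ × ℝ) :
    partialX (partialY f) p = partialY (partialX f) p := by
  have hd := hf.differentiable two_ne_zero
  have hY : ContDiff ℝ 1 (partialY f) := contDiff_partialY hf (by norm_num)
  have hX : ContDiff ℝ 1 (partialX f) := contDiff_partialX hf (by norm_num)
  rw [partialX_apply (hY.differentiable one_ne_zero), partialY_apply (hX.differentiable one_ne_zero),
    partialY_eq hd, partialX_eq hd]
  have hfd : DifferentiableAt ℝ (fderiv ℝ f) p :=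
    ((hf.fderiv_right (m := 1) (by norm_num)).differentiable one_ne_zero) p
  have hs : IsSymmSndFDerivAt ℝ f p := hf.contDiffAt.isSymmSndFDerivAt (by simp)
  rw [fderiv_clm_apply hfd (by fun_prop), fderiv_clm_apply hfd (by fun_prop)]
  simpa using hs (1, 0) (0, 1)

/-- Integrating the mixed derivative by parts once in x, and once in y after swapping the order,
gives two expressions conjugate to each other. Hence the integral of Ū ∂_x ∂_y U is real and its
multiple by i has no real part. -/
lemma re_integral_conj_mul_mixed {U : ℝ × ℝ → ℂ} (hU : ContDiff ℝ 2 U) (hc : HasCompactSupport U) :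
    (∫ p, starRingEnd ℂ (U p) * (Complex.I * partialX (partialY U) p)).re = 0 := by
  have hd := hU.differentiable two_ne_zero
  have hU1 : ContDiff ℝ 1 U := hU.of_le (by norm_num)
  have hY : ContDiff ℝ 1 (partialY U) := contDiff_partialY hU (by norm_num)
  have hX : ContDiff ℝ 1 (partialX U) := contDiff_partialX hU (by norm_num)
  have hconj : ContDiff ℝ 1 fun p => starRingEnd ℂ (U p) := Complex.conjCLE.contDiff.comp hU1
  set J := ∫ p, starRingEnd ℂ (U p) * partialX (partialY U) p with hJ
  have e1 : J = -∫ p, starRingEnd ℂ (partialX U p) * partialY U p := by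
    rw [hJ, integral_mul_partialX hconj hY (hasCompactSupport_partialY hd hc)]
    simp only [partialX_conj hd]
  have e2 : J = -∫ p, starRingEnd ℂ (partialY U p) * partialX U p := by
    simp only [hJ, partialX_partialY_comm hU]
    rw [integral_mul_partialY hconj hX (hasCompactSupport_partialX hd hc)]
    simp only [partialY_conj hd]
  have e3 : starRingEnd ℂ J = J := by
    conv_rhs => rw [e1]
    conv_lhs => rw [e2]
    rw [map_neg, ← integral_conj]
    simp only [map_mul, Complex.conj_conj, mul_comm]
  have e4 : ∫ p, starRingEnd ℂ (U p) * (Complex.I * partialX (partialY U) p) = Complex.I * J := by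
    rw [hJ, ← integral_const_mul]
    exact integral_congr_ae (Eventually.of_forall fun p => by ring)
  rw [e4, Complex.I_mul_re, Complex.conj_eq_iff_im.1 e3, neg_zero]

end IntegrationByParts

/-! ### Young's inequality L¹ ⋆ L² ⊂ L² -/

section Young

open ENNReal in
-- Split k as the product of two square roots, apply Cauchy–Schwarz for fixed p, then Tonelli and
-- translation invariance.
lemma lintegral_convolution_sq_le {k f : ℝ × ℝ → ℝ≥0∞} (hk : Measurable k) (hf : AEMeasurable f) :
    ∫⁻ p, (∫⁻ q, f q * k (p - q)) ^ 2 ≤ (∫⁻ z, k z) ^ 2 * ∫⁻ q, f q ^ 2 := by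
  have hkp : ∀ p : ℝ × ℝ, ∫⁻ q, k (p - q) = ∫⁻ z, k z := fun p =>
    lintegral_sub_left_eq_self k p
  have hkq : ∀ q : ℝ × ℝ, ∫⁻ p, k (p - q) = ∫⁻ z, k z := fun q =>
    lintegral_sub_right_eq_self k q
  have hCS : ∀ p, (∫⁻ q, f q * k (p - q)) ^ 2 ≤ (∫⁻ z, k z) * ∫⁻ q, f q ^ 2 * k (p - q) := by
    intro p
    have hm : AEMeasurable fun q => k (p - q) := (hk.comp (by fun_prop)).aemeasurable
    have h1 := ENNReal.lintegral_mul_norm_pow_le (μ := volume) (f := fun q => f q ^ 2 * k (p - q))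
      (g := fun q => k (p - q)) ((hf.pow_const 2).mul hm) hm
      (p := 1 / 2) (q := 1 / 2) (by norm_num) (by norm_num) (by norm_num)
    have h2 : ∀ q, f q * k (p - q) =
        (f q ^ 2 * k (p - q)) ^ (1 / 2 : ℝ) * k (p - q) ^ (1 / 2 : ℝ) := by
      intro q
      rw [← ENNReal.mul_rpow_of_nonneg _ _ (by norm_num), mul_assoc, ← sq, ← mul_pow,
        ← ENNReal.rpow_natCast, ← ENNReal.rpow_mul]
      norm_num
    simp only [← h2, hkp] at h1
    calc (∫⁻ q, f q * k (p - q)) ^ 2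
        ≤ ((∫⁻ q, f q ^ 2 * k (p - q)) ^ (1 / 2 : ℝ) * (∫⁻ z, k z) ^ (1 / 2 : ℝ)) ^ 2 :=
          pow_le_pow_left₀ (by positivity) h1 2
      _ = (∫⁻ z, k z) * ∫⁻ q, f q ^ 2 * k (p - q) := by
          rw [mul_pow, ← ENNReal.rpow_natCast, ← ENNReal.rpow_natCast, ← ENNReal.rpow_mul,
            ← ENNReal.rpow_mul]
          norm_num [mul_comm]
  have hmeas : AEMeasurable (Function.uncurry fun p q : ℝ × ℝ => f q ^ 2 * k (p - q))
      (volume.prod volume) :=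
    ((hf.pow_const 2).comp_snd).mul (hk.comp (by fun_prop)).aemeasurable
  calc ∫⁻ p, (∫⁻ q, f q * k (p - q)) ^ 2
      ≤ ∫⁻ p, (∫⁻ z, k z) * ∫⁻ q, f q ^ 2 * k (p - q) := lintegral_mono hCS
    _ = (∫⁻ z, k z) * ∫⁻ p, ∫⁻ q, f q ^ 2 * k (p - q) :=
        lintegral_const_mul'' _ hmeas.lintegral_prod_right'
    _ = (∫⁻ z, k z) * ∫⁻ q, ∫⁻ p, f q ^ 2 * k (p - q) := by
        rw [lintegral_lintegral_swap hmeas]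
    _ = (∫⁻ z, k z) * ∫⁻ q, f q ^ 2 * ∫⁻ z, k z := by
        congr 1
        refine lintegral_congr fun q => ?_
        have hm : Measurable fun p => k (p - q) := hk.comp (by fun_prop)
        rw [lintegral_const_mul _ hm, hkq]
    _ = (∫⁻ z, k z) ^ 2 * ∫⁻ q, f q ^ 2 := by
        rw [lintegral_mul_const'' _ (hf.pow_const 2)]
        ring

end Young

/-! ### Convolution with a smooth kernel -/

section Mollify

/-- The convolution `f ⋆ ρ`. -/
noncomputable def mollify (ρ f : ℝ × ℝ → ℂ) (p : ℝ × ℝ) : ℂ := ∫ q, f q * ρ (p - q)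

lemma mollify_eq_convolution (ρ f : ℝ × ℝ → ℂ) :
    mollify ρ f = convolution f ρ (ContinuousLinearMap.mul ℝ ℂ) volume := rfl

variable {ρ f : ℝ × ℝ → ℂ}

lemma contDiff_mollify {n : ℕ∞} (hρ : ContDiff ℝ n ρ) (hc : HasCompactSupport ρ)
    (hf : LocallyIntegrable f) : ContDiff ℝ n (mollify ρ f) :=
  hc.contDiff_convolution_right (ContinuousLinearMap.mul ℝ ℂ) hf hρ

lemma partialX_mollify (hρ : ContDiff ℝ 1 ρ) (hc : HasCompactSupport ρ)
    (hf : LocallyIntegrable f) : partialX (mollify ρ f) = mollify (partialX ρ) f := by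
  funext p
  rw [partialX_apply ((contDiff_mollify (n := 1) hρ hc hf).differentiable one_ne_zero),
    mollify_eq_convolution, (hc.hasFDerivAt_convolution_right _ hf hρ p).fderiv,
    convolution_precompR_apply _ hf (hc.fderiv (𝕜 := ℝ)) (hρ.continuous_fderiv one_ne_zero),
    mollify_eq_convolution, partialX_eq (hρ.differentiable one_ne_zero)]

lemma partialY_mollify (hρ : ContDiff ℝ 1 ρ) (hc : HasCompactSupport ρ)
    (hf : LocallyIntegrable f) : partialY (mollify ρ f) = mollify (partialY ρ) f := by
  funext p
  rw [partialY_apply ((contDiff_mollify (n := 1) hρ hc hf).differentiable one_ne_zero),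
    mollify_eq_convolution, (hc.hasFDerivAt_convolution_right _ hf hρ p).fderiv,
    convolution_precompR_apply _ hf (hc.fderiv (𝕜 := ℝ)) (hρ.continuous_fderiv one_ne_zero),
    mollify_eq_convolution, partialY_eq (hρ.differentiable one_ne_zero)]

lemma locallyIntegrable_planeL2 (f : PlaneL2) : LocallyIntegrable f :=
  (Lp.memLp f).locallyIntegrable (by norm_num)

lemma partialX_comp_sub (a p : ℝ × ℝ) :
    partialX (fun q => ρ (a - q)) p = -partialX ρ (a - p) :=
  deriv_comp_const_sub (fun s => ρ (s, a.2 - p.2)) a.1 p.1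

lemma partialY_comp_sub (a p : ℝ × ℝ) :
    partialY (fun q => ρ (a - q)) p = -partialY ρ (a - p) :=
  deriv_comp_const_sub (fun s => ρ (a.1 - p.1, s)) a.2 p.2

lemma partialX_const_mul (c : ℂ) (hφ : Differentiable ℝ ρ) (p : ℝ × ℝ) :
    partialX (fun q => c * ρ q) p = c * partialX ρ p :=
  ((hasDerivAt_partialX hφ p.1 p.2).const_mul c).deriv

lemma partialY_const_mul (c : ℂ) (hφ : Differentiable ℝ ρ) (p : ℝ × ℝ) :
    partialY (fun q => c * ρ q) p = c * partialY ρ p :=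
  ((hasDerivAt_partialY hφ p.1 p.2).const_mul c).deriv

lemma IsTestFun.comp_sub (h : IsTestFun ρ) (a : ℝ × ℝ) : IsTestFun (fun p => ρ (a - p)) :=
  ⟨h.smooth.comp (contDiff_const.sub contDiff_id),
    h.2.comp_homeomorph (Homeomorph.subLeft a)⟩

lemma IsTestFun.const_mul (h : IsTestFun ρ) (c : ℂ) : IsTestFun (fun p => c * ρ p) :=
  h.smooth_mul contDiff_const

end Mollify

/-! ### The commutator of the regularization with the generator -/

section Commutator

variable (χ ρ : ℝ × ℝ → ℂ) (W : ℝ × ℝ → ℝ)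

/-- The kernel of the regularization `f ↦ χ (f ⋆ ρ)`. -/
def regKernel (z : (ℝ × ℝ) × (ℝ × ℝ)) : ℂ := χ z.1 * ρ (z.1 - z.2)

/-- The kernel of the composition of the regularization with `i ∂_x ∂_y - i W`. -/
noncomputable def regGenKernel (z : (ℝ × ℝ) × (ℝ × ℝ)) : ℂ :=
  χ z.1 * (Complex.I * partialX (partialY ρ) (z.1 - z.2) - Complex.I * W z.2 * ρ (z.1 - z.2))

/-- The kernel of the commutator of the regularization with `i ∂_x ∂_y - i W`. -/
noncomputable def commKernel (z : (ℝ × ℝ) × (ℝ × ℝ)) : ℂ :=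
  -Complex.I * (partialX χ z.1 * partialY ρ (z.1 - z.2) + partialY χ z.1 * partialX ρ (z.1 - z.2)
    + partialX (partialY χ) z.1 * ρ (z.1 - z.2))
    + Complex.I * χ z.1 * (W z.1 - W z.2) * ρ (z.1 - z.2)

variable {χ ρ W}

/-- In the coordinates (p, p - q) the support lies in a product of compact sets. -/
lemma hasCompactSupport_of_fst_sub {k : (ℝ × ℝ) × (ℝ × ℝ) → ℂ} {K K' : Set (ℝ × ℝ)}
    (hK : IsCompact K) (hK' : IsCompact K') (h1 : ∀ p q, p ∉ K → k (p, q) = 0)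
    (h2 : ∀ p q, p - q ∉ K' → k (p, q) = 0) : HasCompactSupport k := by
  have hcomp : IsCompact ((fun z : (ℝ × ℝ) × (ℝ × ℝ) => (z.1, z.1 - z.2)) '' (K ×ˢ K')) :=
    (hK.prod hK').image (by fun_prop)
  refine HasCompactSupport.intro hcomp fun z hz => ?_
  obtain ⟨p, q⟩ := z
  by_contra h
  refine hz ⟨(p, p - q), ⟨?_, ?_⟩, by simp⟩
  · by_contra hp; exact h (h1 p q hp)
  · by_contra hp; exact h (h2 p q hp)

lemma regKernel_continuous (hχ : IsTestFun χ) (hρ : IsTestFun ρ) : Continuous (regKernel χ ρ) :=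
  (hχ.continuous.comp continuous_fst).mul (hρ.continuous.comp (by fun_prop))

lemma regGenKernel_continuous (hχ : IsTestFun χ) (hρ : IsTestFun ρ) (hW : Continuous W) :
    Continuous (regGenKernel χ ρ W) := by
  have h1 := hχ.continuous
  have h2 := hρ.continuous
  have h3 := hρ.partialY.partialX.continuous
  unfold regGenKernel
  fun_prop

lemma commKernel_continuous (hχ : IsTestFun χ) (hρ : IsTestFun ρ) (hW : Continuous W) :
    Continuous (commKernel χ ρ W) := by
  have h1 := hχ.continuous
  have h2 := hρ.continuous
  have h3 := hρ.partialY.continuous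
  have h4 := hρ.partialX.continuous
  have h5 := hχ.partialY.partialX.continuous
  have h6 := hχ.partialY.continuous
  have h7 := hχ.partialX.continuous
  unfold commKernel
  fun_prop

lemma partialX_eq_zero_of_notMem_tsupport {φ : ℝ × ℝ → ℂ} (h : Differentiable ℝ φ) {p : ℝ × ℝ}
    (hp : p ∉ tsupport φ) : partialX φ p = 0 := by
  rw [partialX_apply h, fderiv_of_notMem_tsupport ℝ hp]; rfl

lemma partialY_eq_zero_of_notMem_tsupport {φ : ℝ × ℝ → ℂ} (h : Differentiable ℝ φ) {p : ℝ × ℝ}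
    (hp : p ∉ tsupport φ) : partialY φ p = 0 := by
  rw [partialY_apply h, fderiv_of_notMem_tsupport ℝ hp]; rfl

lemma partialX_partialY_eq_zero_of_notMem_tsupport {φ : ℝ × ℝ → ℂ} (h : IsTestFun φ) {p : ℝ × ℝ}
    (hp : p ∉ tsupport φ) : partialX (partialY φ) p = 0 := by
  refine partialX_eq_zero_of_notMem_tsupport h.partialY.differentiable fun hp' => hp ?_
  rw [partialY_eq h.differentiable] at hp'
  exact tsupport_fderiv_apply_subset ℝ _ hp'

lemma regKernel_hasCompactSupport (hχ : IsTestFun χ) (hρ : IsTestFun ρ) :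
    HasCompactSupport (regKernel χ ρ) :=
  hasCompactSupport_of_fst_sub hχ.2.isCompact hρ.2.isCompact
    (fun p q hp => by simp [regKernel, image_eq_zero_of_notMem_tsupport hp])
    (fun p q hp => by simp [regKernel, image_eq_zero_of_notMem_tsupport hp])

lemma regGenKernel_hasCompactSupport (hχ : IsTestFun χ) (hρ : IsTestFun ρ) :
    HasCompactSupport (regGenKernel χ ρ W) :=
  hasCompactSupport_of_fst_sub hχ.2.isCompact hρ.2.isCompact
    (fun p q hp => by simp [regGenKernel, image_eq_zero_of_notMem_tsupport hp])
    (fun p q hp => by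
      simp [regGenKernel, image_eq_zero_of_notMem_tsupport hp,
        partialX_partialY_eq_zero_of_notMem_tsupport hρ hp])

lemma commKernel_hasCompactSupport (hχ : IsTestFun χ) (hρ : IsTestFun ρ) :
    HasCompactSupport (commKernel χ ρ W) :=
  hasCompactSupport_of_fst_sub hχ.2.isCompact hρ.2.isCompact
    (fun p q hp => by
      simp [commKernel, image_eq_zero_of_notMem_tsupport hp,
        partialX_eq_zero_of_notMem_tsupport hχ.differentiable hp,
        partialY_eq_zero_of_notMem_tsupport hχ.differentiable hp,
        partialX_partialY_eq_zero_of_notMem_tsupport hχ hp])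
    (fun p q hp => by
      simp [commKernel, image_eq_zero_of_notMem_tsupport hp,
        partialX_eq_zero_of_notMem_tsupport hρ.differentiable hp,
        partialY_eq_zero_of_notMem_tsupport hρ.differentiable hp])

lemma kernelOp_regKernel (f : PlaneL2) (p : ℝ × ℝ) :
    kernelOp (regKernel χ ρ) f p = χ p * mollify ρ f p := by
  rw [kernelOp, mollify, ← integral_const_mul]
  exact integral_congr_ae (Eventually.of_forall fun q => by simp only [regKernel]; ring)

lemma contDiff_kernelOp_regKernel (hχ : IsTestFun χ) (hρ : IsTestFun ρ) (f : PlaneL2) :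
    ContDiff ℝ 2 (kernelOp (regKernel χ ρ) f) := by
  rw [funext (kernelOp_regKernel f)]
  exact (hχ.contDiff_nat 2).mul
    (contDiff_mollify (n := 2) (hρ.contDiff_nat 2) hρ.2 (locallyIntegrable_planeL2 f))

lemma partialX_partialY_mul {a b : ℝ × ℝ → ℂ} (ha : ContDiff ℝ 2 a) (hb : ContDiff ℝ 2 b)
    (p : ℝ × ℝ) :
    partialX (partialY fun q => a q * b q) p = partialX (partialY a) p * b p
      + partialY a p * partialX b p + partialX a p * partialY b p
      + a p * partialX (partialY b) p := by
  have had := ha.differentiable two_ne_zero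
  have hbd := hb.differentiable two_ne_zero
  have haY := (contDiff_partialY (m := 1) ha (by norm_num)).differentiable one_ne_zero
  have hbY := (contDiff_partialY (m := 1) hb (by norm_num)).differentiable one_ne_zero
  rw [funext (partialY_mul had hbd)]
  have h1 := ((hasDerivAt_partialX haY p.1 p.2).mul (hasDerivAt_partialX hbd p.1 p.2)).add
    ((hasDerivAt_partialX had p.1 p.2).mul (hasDerivAt_partialX hbY p.1 p.2))
  refine h1.deriv.trans ?_
  simp only [Prod.mk.eta]
  ring

/-- Convolution commutes with ∂_x ∂_y, so the commutator consists of the Leibniz terms in which at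
least one derivative falls on χ, together with the difference of W at the two points. Every term
makes sense for f merely in L², because the derivatives stay on χ and ρ. -/
lemma kernelOp_regGenKernel (hχ : IsTestFun χ) (hρ : IsTestFun ρ) (hW : Continuous W) (f : PlaneL2)
    (p : ℝ × ℝ) :
    kernelOp (regGenKernel χ ρ W) f p =
      Complex.I * partialX (partialY (kernelOp (regKernel χ ρ) f)) p
        - Complex.I * W p * kernelOp (regKernel χ ρ) f p + kernelOp (commKernel χ ρ W) f p := by
  have hf := locallyIntegrable_planeL2 f
  have int : ∀ {φ : ℝ × ℝ → ℂ}, IsTestFun φ → Integrable fun q => f q * φ (p - q) := fun hφ =>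
    integrable_mul_of_memLp (hφ.comp_sub p).memLp f
  have intW : Integrable fun q => f q * (W q * ρ (p - q)) :=
    integrable_mul_cc (φ := fun q => (W q : ℂ) * ρ (p - q))
      (by have := hρ.continuous; fun_prop) (hρ.comp_sub p).2.mul_left f
  have hmix : partialX (partialY (kernelOp (regKernel χ ρ) f)) p =
      partialX (partialY χ) p * mollify ρ f p + partialY χ p * mollify (partialX ρ) f p
        + partialX χ p * mollify (partialY ρ) f p
        + χ p * mollify (partialX (partialY ρ)) f p := by
    rw [funext (kernelOp_regKernel f), partialX_partialY_mul (hχ.contDiff_nat 2)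
      (contDiff_mollify (n := 2) (hρ.contDiff_nat 2) hρ.2 hf),
      partialX_mollify (hρ.contDiff_nat 1) hρ.2 hf, partialY_mollify (hρ.contDiff_nat 1) hρ.2 hf,
      partialX_mollify (hρ.partialY.contDiff_nat 1) hρ.partialY.2 hf]
  have hcomm : kernelOp (commKernel χ ρ W) f p =
      -Complex.I * (partialX χ p * mollify (partialY ρ) f p
        + partialY χ p * mollify (partialX ρ) f p + partialX (partialY χ) p * mollify ρ f p)
      + Complex.I * χ p * (W p * mollify ρ f p - ∫ q, f q * (W q * ρ (p - q))) := by
    simp only [mollify, ← integral_const_mul]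
    have i12 : Integrable fun q => partialX χ p * (f q * partialY ρ (p - q))
        + partialY χ p * (f q * partialX ρ (p - q)) :=
      ((int hρ.partialY).const_mul _).add ((int hρ.partialX).const_mul _)
    have i123 : Integrable fun q => partialX χ p * (f q * partialY ρ (p - q))
        + partialY χ p * (f q * partialX ρ (p - q))
        + partialX (partialY χ) p * (f q * ρ (p - q)) := i12.add ((int hρ).const_mul _)
    have i4 : Integrable fun q => W p * (f q * ρ (p - q)) - f q * (W q * ρ (p - q)) :=
      ((int hρ).const_mul _).sub intW
    rw [← integral_add ((int hρ.partialY).const_mul _) ((int hρ.partialX).const_mul _),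
      ← integral_add i12 ((int hρ).const_mul _), ← integral_const_mul,
      ← integral_sub ((int hρ).const_mul _) intW, ← integral_const_mul,
      ← integral_add (i123.const_mul _) (i4.const_mul _)]
    refine integral_congr_ae (Eventually.of_forall fun q => ?_)
    simp only [commKernel]
    ring
  have hgen : kernelOp (regGenKernel χ ρ W) f p =
      χ p * (Complex.I * mollify (partialX (partialY ρ)) f p
        - Complex.I * ∫ q, f q * (W q * ρ (p - q))) := by
    simp only [mollify, ← integral_const_mul]
    rw [← integral_sub ((int hρ.partialY.partialX).const_mul _) (intW.const_mul _),
      ← integral_const_mul]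
    refine integral_congr_ae (Eventually.of_forall fun q => ?_)
    simp only [regGenKernel]
    ring
  rw [hgen, hcomm, hmix, kernelOp_regKernel]
  ring

/-- The generator acts on the regularized function, which is C² with compact support. There the
mixed derivative and the real potential contribute only imaginary quantities, and the commutator
alone survives. -/
lemma re_integral_conj_mul_regGenKernel (hχ : IsTestFun χ) (hρ : IsTestFun ρ) (hW : Continuous W)
    (f : PlaneL2) :
    (∫ p, starRingEnd ℂ (kernelOp (regKernel χ ρ) f p) * kernelOp (regGenKernel χ ρ W) f p).re =
      (∫ p, starRingEnd ℂ (kernelOp (regKernel χ ρ) f p) *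
        kernelOp (commKernel χ ρ W) f p).re := by
  set U := kernelOp (regKernel χ ρ) f with hU
  have hUc2 : ContDiff ℝ 2 U := contDiff_kernelOp_regKernel hχ hρ f
  have hUc : HasCompactSupport U :=
    kernelOp_hasCompactSupport (regKernel_hasCompactSupport hχ hρ) f
  have hconj : Continuous fun p => starRingEnd ℂ (U p) :=
    Complex.continuous_conj.comp hUc2.continuous
  have hconjc : HasCompactSupport fun p => starRingEnd ℂ (U p) :=
    hUc.comp_left (map_zero _)
  have hmixc : Continuous (partialX (partialY U)) :=
    (contDiff_partialX (m := 0) (contDiff_partialY (m := 1) hUc2 (by norm_num))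
      (by norm_num)).continuous
  have hCc : Continuous (kernelOp (commKernel χ ρ W) f) :=
    kernelOp_continuous (commKernel_continuous hχ hρ hW) (commKernel_hasCompactSupport hχ hρ) f
  have i1 : Integrable fun p => starRingEnd ℂ (U p) * (Complex.I * partialX (partialY U) p) :=
    (hconj.mul (continuous_const.mul hmixc)).integrable_of_hasCompactSupport hconjc.mul_right
  have i2 : Integrable fun p => starRingEnd ℂ (U p) * (Complex.I * W p * U p) :=
    (hconj.mul ((continuous_const.mul (Complex.continuous_ofReal.comp hW)).mul
      hUc2.continuous)).integrable_of_hasCompactSupport hconjc.mul_right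
  have i3 : Integrable fun p => starRingEnd ℂ (U p) * kernelOp (commKernel χ ρ W) f p :=
    (hconj.mul hCc).integrable_of_hasCompactSupport hconjc.mul_right
  have e : ∫ p, starRingEnd ℂ (U p) * kernelOp (regGenKernel χ ρ W) f p =
      (∫ p, starRingEnd ℂ (U p) * (Complex.I * partialX (partialY U) p))
        - (∫ p, starRingEnd ℂ (U p) * (Complex.I * W p * U p))
        + ∫ p, starRingEnd ℂ (U p) * kernelOp (commKernel χ ρ W) f p := by
    have i12 : Integrable fun p => starRingEnd ℂ (U p) * (Complex.I * partialX (partialY U) p)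
        - starRingEnd ℂ (U p) * (Complex.I * W p * U p) := i1.sub i2
    rw [← integral_sub i1 i2, ← integral_add i12 i3]
    refine integral_congr_ae (Eventually.of_forall fun p => ?_)
    simp only [kernelOp_regGenKernel hχ hρ hW f p, ← hU]
    ring
  have e2 : (∫ p, starRingEnd ℂ (U p) * (Complex.I * W p * U p)).re = 0 := by
    have : ∀ p, starRingEnd ℂ (U p) * (Complex.I * W p * U p) =
        Complex.I * ((W p * ‖U p‖ ^ 2 : ℝ) : ℂ) := fun p => by
      push_cast
      rw [← Complex.conj_mul']
      ring
    simp only [this]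
    rw [integral_const_mul, integral_complex_ofReal, Complex.I_mul_re, Complex.ofReal_im, neg_zero]
  rw [e, Complex.add_re, Complex.sub_re, e2, re_integral_conj_mul_mixed hUc2 hUc]
  ring

end Commutator

/-! ### A growth lemma with a vanishing error in the rate -/

section Growth

/-- If the nonnegative functions `N n` satisfy `|(N n)'| ≤ 2 √(N n) (c n + B)` with `c n → 0`
boundedly, then `√(N n)` grows at most at rate `B` in the limit. -/
lemma eventually_sqrt_le_of_deriv_le {N N' c : ℕ → ℝ → ℝ} {a B cb T : ℝ} (hT : 0 ≤ T)
    (ha : 0 ≤ a) (hN : ∀ n t, 0 ≤ N n t) (hcont : ∀ n, ContinuousOn (N n) (Icc 0 T))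
    (hder : ∀ n, ∀ t ∈ Ioo 0 T, HasDerivAt (N n) (N' n t) t)
    (hN' : ∀ n, ∀ t ∈ Ioo 0 T, |N' n t| ≤ 2 * √(N n t) * (c n t + B))
    (hc0 : ∀ n, ∀ t ∈ Ioo 0 T, 0 ≤ c n t) (hB : 0 ≤ B)
    (hcb : ∀ n, ∀ t ∈ Ioo 0 T, c n t ≤ cb)
    (hclim : ∀ t ∈ Ioo 0 T, Tendsto (fun n => c n t) atTop (𝓝 0))
    (h0 : ∀ n, N n 0 ≤ a ^ 2) {η : ℝ} (hη : 0 < η) :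
    ∀ᶠ n in atTop, √(N n T) ≤ a + B * T + η := by
  -- The square root is smoothed by θ², since the energy may vanish. Half of η pays for the
  -- smoothing at time zero, half for the integral of the error.
  set θ := η / 2 with hθ
  have hθ0 : 0 < θ := by positivity
  set m : ℕ → ℝ → ℝ := fun n t => √(N n t + θ ^ 2) with hm
  have hpos : ∀ n t, 0 < N n t + θ ^ 2 := fun n t => by have := hN n t; positivity
  have hmder : ∀ n, ∀ t ∈ Ioo 0 T, HasDerivAt (m n) (N' n t / (2 * m n t)) t := fun n t ht =>
    ((hder n t ht).add_const _).sqrt (hpos n t).ne'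
  have hmbd : ∀ n, ∀ t ∈ Ioo 0 T, |N' n t / (2 * m n t)| ≤ c n t + B := by
    intro n t ht
    have hmp : 0 < m n t := Real.sqrt_pos.2 (hpos n t)
    have hle : √(N n t) ≤ m n t := Real.sqrt_le_sqrt (by nlinarith [sq_nonneg θ])
    rw [abs_div, abs_of_pos (by positivity : 0 < 2 * m n t), div_le_iff₀ (by positivity)]
    refine (hN' n t ht).trans ?_
    have := mul_le_mul_of_nonneg_right hle (add_nonneg (hc0 n t ht) hB)
    linarith
  have hmcont : ∀ n, ContinuousOn (m n) (Icc 0 T) := fun n =>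
    Real.continuous_sqrt.comp_continuousOn ((hcont n).add continuousOn_const)
  -- No measurability of `c n` in time is assumed. The positive part of (m n)' - B is measurable and
  -- at most `c n`, so dominated convergence is applied to it instead.
  set e : ℕ → ℝ → ℝ := fun n t => max (deriv (m n) t - B) 0 with he
  have hem : ∀ n, Measurable (e n) := fun n =>
    ((measurable_deriv (m n)).sub_const B).max measurable_const
  have hec : ∀ n, ∀ t ∈ Ioo 0 T, |e n t| ≤ c n t := by
    intro n t ht
    rw [abs_of_nonneg (le_max_right _ _), he]
    simp only [(hmder n t ht).deriv]
    refine max_le ?_ (hc0 n t ht)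
    linarith [le_abs_self (N' n t / (2 * m n t)), hmbd n t ht]
  have hIoo : ∀ᵐ t : ℝ, t ∈ uIoc 0 T → t ∈ Ioo 0 T := by
    have : ∀ᵐ t : ℝ, t ≠ T := compl_mem_ae_iff.2 (measure_singleton T)
    filter_upwards [this] with t ht h
    rw [uIoc_of_le hT] at h
    exact ⟨h.1, lt_of_le_of_ne h.2 ht⟩
  have hlim : Tendsto (fun n => ∫ t in (0 : ℝ)..T, e n t) atTop (𝓝 (∫ _ in (0 : ℝ)..T, (0 : ℝ))) := by
    refine intervalIntegral.tendsto_integral_filter_of_dominated_convergence (fun _ => cb)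
      (Eventually.of_forall fun n => (hem n).aestronglyMeasurable)
      (Eventually.of_forall fun n => ?_) (by simp) ?_
    · filter_upwards [hIoo] with t ht h
      exact (hec n t (ht h)).trans (hcb n t (ht h))
    · filter_upwards [hIoo] with t ht h
      exact squeeze_zero_norm (fun n => hec n t (ht h)) (hclim t (ht h))
  rw [intervalIntegral.integral_zero] at hlim
  have heint : ∀ n, IntervalIntegrable (e n) volume 0 T := by
    intro n
    refine (intervalIntegrable_const (c := cb)).mono_fun (hem n).aestronglyMeasurable ?_
    filter_upwards [(ae_restrict_iff' measurableSet_uIoc).2 hIoo] with t ht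
    exact (hec n t ht).trans ((hcb n t ht).trans (le_abs_self _))
  have hdint : ∀ n, IntervalIntegrable (deriv (m n)) volume 0 T := by
    intro n
    refine (intervalIntegrable_const (c := cb + B)).mono_fun
      (measurable_deriv (m n)).aestronglyMeasurable ?_
    filter_upwards [(ae_restrict_iff' measurableSet_uIoc).2 hIoo] with t ht
    rw [(hmder n t ht).deriv]
    exact (hmbd n t ht).trans ((add_le_add_left (hcb n t ht) B).trans (le_abs_self _))
  filter_upwards [hlim.eventually (eventually_le_nhds hθ0)] with n hn
  have hftc : ∫ t in (0 : ℝ)..T, deriv (m n) t = m n T - m n 0 :=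
    intervalIntegral.integral_eq_sub_of_hasDerivAt_of_le hT (hmcont n)
      (fun t ht => (hmder n t ht).differentiableAt.hasDerivAt) (hdint n)
  have hmono : ∫ t in (0 : ℝ)..T, deriv (m n) t ≤ ∫ t in (0 : ℝ)..T, (B + e n t) := by
    refine intervalIntegral.integral_mono_on hT (hdint n) (intervalIntegrable_const.add (heint n))
      fun t _ => ?_
    have := le_max_left (deriv (m n) t - B) 0
    simp only [he]
    linarith
  rw [intervalIntegral.integral_add intervalIntegrable_const (heint n),
    intervalIntegral.integral_const, hftc] at hmono
  have h1 : √(N n T) ≤ m n T := Real.sqrt_le_sqrt (by nlinarith [sq_nonneg θ])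
  have h2 : m n 0 ≤ a + θ := by
    rw [hm]
    refine Real.sqrt_le_iff.2 ⟨by positivity, ?_⟩
    nlinarith [h0 n, mul_nonneg ha hθ0.le]
  simp only [smul_eq_mul, sub_zero] at hmono
  have : η = θ + θ := by rw [hθ]; ring
  linarith [mul_comm T B]

end Growth

/-- On `[0, T]`, the `L²`-valued function `w` is bounded by `M` and solves
`∂_t w = i ∂_x ∂_y w - i W w + F` in the sense of distributions, with `F` bounded by `B`. -/
structure IsForcedWeakSolution (W : ℝ × ℝ → ℝ) (T M B : ℝ) (F w : ℝ → PlaneL2) : Prop where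
  bound : ∀ t ∈ Icc 0 T, ‖w t‖ ≤ M
  force : ∀ t ∈ Icc 0 T, ‖F t‖ ≤ B
  equation : ∀ φ : ℝ × ℝ → ℂ, IsTestFun φ → ∀ t ∈ Icc 0 T,
    HasDerivWithinAt (fun s : ℝ => ∫ p, w s p * φ p)
      ((∫ p, w t p * (Complex.I * partialX (partialY φ) p - Complex.I * (W p : ℂ) * φ p))
        + ∫ p, F t p * φ p) (Ici 0) t

/-! ### Time derivative of the regularized energy -/

section EnergyDerivative

variable {χ ρ : ℝ × ℝ → ℂ} {W : ℝ × ℝ → ℝ} {T M B : ℝ} {F w : ℝ → PlaneL2}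

lemma isTestFun_regKernel_slice (hρ : IsTestFun ρ) (p : ℝ × ℝ) :
    IsTestFun fun q => regKernel χ ρ (p, q) := (hρ.comp_sub p).const_mul (χ p)

/-- For fixed p the function q ↦ χ(p) ρ(p - q) is itself a test function, so the weak equation gives
the time derivative pointwise. The two signs from differentiating in q cancel. -/
lemma IsForcedWeakSolution.hasDerivWithinAt_kernelOp (h : IsForcedWeakSolution W T M B F w)
    (hρ : IsTestFun ρ) {t : ℝ} (ht : t ∈ Icc 0 T) (p : ℝ × ℝ) :
    HasDerivWithinAt (fun s => kernelOp (regKernel χ ρ) (w s) p)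
      (kernelOp (regGenKernel χ ρ W) (w t) p + kernelOp (regKernel χ ρ) (F t) p) (Ici 0) t := by
  refine (h.equation _ (isTestFun_regKernel_slice hρ p) t ht).congr_deriv ?_
  congr 1
  refine integral_congr_ae (Eventually.of_forall fun q => ?_)
  simp only [regKernel, regGenKernel]
  have hd := (hρ.comp_sub p).differentiable
  have e1 : partialY (fun q => χ p * ρ (p - q)) = fun q => -χ p * partialY ρ (p - q) := by
    funext q
    rw [partialY_const_mul _ hd, partialY_comp_sub]
    ring
  rw [e1, partialX_const_mul _ (hρ.partialY.comp_sub p).differentiable, partialX_comp_sub]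
  ring

lemma IsForcedWeakSolution.continuousOn_energy (h : IsForcedWeakSolution W T M B F w)
    (hχ : IsTestFun χ) (hρ : IsTestFun ρ) :
    ContinuousOn (fun s => ∫ p, ‖kernelOp (regKernel χ ρ) (w s) p‖ ^ 2) (Icc 0 T) := by
  obtain ⟨C, hC0, hC⟩ := exists_kernelOp_bound (regKernel_continuous hχ hρ)
    (regKernel_hasCompactSupport hχ hρ)
  intro t ht
  refine continuousWithinAt_integral_norm_sq (C := C * M)
    ((regKernel_hasCompactSupport hχ hρ).isCompact.image continuous_fst)
    (fun r => kernelOp_continuous (regKernel_continuous hχ hρ)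
      (regKernel_hasCompactSupport hχ hρ) _)
    (fun r p hp => kernelOp_eq_zero hp)
    (fun r hr p => (hC _ p).trans (mul_le_mul_of_nonneg_left (h.bound r hr) hC0)) fun p => ?_
  exact (h.hasDerivWithinAt_kernelOp hρ ht p).continuousWithinAt.mono Icc_subset_Ici_self

lemma abs_integral_re_le {g₁ g₂ : ℝ × ℝ → ℂ} (h₁ : MemLp g₁ 2 volume) (h₂ : MemLp g₂ 2 volume) :
    |(∫ p, starRingEnd ℂ (g₁ p) * g₂ p).re| ≤ ‖h₁.toLp‖ * ‖h₂.toLp‖ := by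
  have : ∫ p, starRingEnd ℂ (g₁ p) * g₂ p = inner ℂ h₁.toLp h₂.toLp := by
    rw [L2.inner_def]
    refine integral_congr_ae ?_
    filter_upwards [h₁.coeFn_toLp, h₂.coeFn_toLp] with p e1 e2
    rw [e1, e2, RCLike.inner_apply, mul_comm]
  rw [this]
  exact (Complex.abs_re_le_norm _).trans (norm_inner_le_norm _ _)

lemma norm_toLp_sq {g : ℝ × ℝ → ℂ} (h : MemLp g 2 volume) : ‖h.toLp‖ ^ 2 = ∫ p, ‖g p‖ ^ 2 := by
  rw [← Complex.ofReal_inj, Complex.ofReal_pow]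
  have := inner_self_eq_norm_sq_to_K (𝕜 := ℂ) h.toLp
  rw [L2.inner_def] at this
  refine this.symm.trans ?_
  rw [← integral_complex_ofReal]
  refine integral_congr_ae ?_
  filter_upwards [h.coeFn_toLp] with p e
  rw [e, inner_self_eq_norm_sq_to_K]
  simp

/-- Differentiation under the integral, followed by Cauchy–Schwarz on the only two terms with a real
part: the commutator and the regularized source. -/
lemma IsForcedWeakSolution.exists_hasDerivAt_energy (h : IsForcedWeakSolution W T M B F w)
    (hχ : IsTestFun χ) (hρ : IsTestFun ρ) (hW : Continuous W) :
    ∃ N' : ℝ → ℝ, ∀ t ∈ Ioo 0 T,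
      HasDerivAt (fun s => ∫ p, ‖kernelOp (regKernel χ ρ) (w s) p‖ ^ 2) (N' t) t ∧
      |N' t| ≤ 2 * √(∫ p, ‖kernelOp (regKernel χ ρ) (w t) p‖ ^ 2) *
        (√(∫ p, ‖kernelOp (commKernel χ ρ W) (w t) p‖ ^ 2)
          + √(∫ p, ‖kernelOp (regKernel χ ρ) (F t) p‖ ^ 2)) := by
  have hk0 := regKernel_continuous hχ hρ
  have hc0 := regKernel_hasCompactSupport hχ hρ
  have hk1 := regGenKernel_continuous hχ hρ hW
  have hc1 := regGenKernel_hasCompactSupport (W := W) hχ hρ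
  have hk2 := commKernel_continuous hχ hρ hW
  have hc2 := commKernel_hasCompactSupport (W := W) hχ hρ
  set D : ℝ → ℝ × ℝ → ℂ := fun t p =>
    kernelOp (regGenKernel χ ρ W) (w t) p + kernelOp (regKernel χ ρ) (F t) p with hD
  obtain ⟨C, hC0, hC⟩ := exists_kernelOp_bound hk0 hc0
  obtain ⟨C1, hC10, hC1⟩ := exists_kernelOp_bound hk1 hc1
  have hIcc : ∀ s ∈ Ioo 0 T, s ∈ Icc 0 T := fun s hs => Ioo_subset_Icc_self hs
  refine ⟨fun t => ∫ p, 2 * (starRingEnd ℂ (kernelOp (regKernel χ ρ) (w t) p) * D t p).re,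
    fun t ht => ⟨?_, ?_⟩⟩
  · have hM := (norm_nonneg _).trans (h.bound t (hIcc t ht))
    have hB := (norm_nonneg _).trans (h.force t (hIcc t ht))
    refine hasDerivAt_integral_norm_sq (K := Prod.fst '' tsupport (regKernel χ ρ))
      (C := C * M + C1 * M + C * B) (hc0.isCompact.image continuous_fst) ht
      (fun s => kernelOp_continuous hk0 hc0 _)
      ((kernelOp_continuous hk1 hc1 _).add (kernelOp_continuous hk0 hc0 _))
      (fun s p hp => kernelOp_eq_zero hp) (fun s hs p => ?_) (fun s hs p => ?_)
      (fun s hs p => ?_)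
    · refine ((hC _ p).trans (mul_le_mul_of_nonneg_left (h.bound s (hIcc s hs)) hC0)).trans ?_
      have := mul_nonneg hC10 hM
      have := mul_nonneg hC0 hB
      linarith
    · refine (norm_add_le _ _).trans ?_
      have h1 := (hC1 (w s) p).trans (mul_le_mul_of_nonneg_left (h.bound s (hIcc s hs)) hC10)
      have h2 := (hC (F s) p).trans (mul_le_mul_of_nonneg_left (h.force s (hIcc s hs)) hC0)
      have := mul_nonneg hC0 hM
      linarith
    · exact (h.hasDerivWithinAt_kernelOp hρ (hIcc s hs) p).hasDerivAt (Ici_mem_nhds hs.1)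
  · have m0 := kernelOp_memLp hk0 hc0 (w t)
    have m2 := kernelOp_memLp hk2 hc2 (w t)
    have mF := kernelOp_memLp hk0 hc0 (F t)
    have m1 := kernelOp_memLp hk1 hc1 (w t)
    have hint : ∀ {g : ℝ × ℝ → ℂ}, MemLp g 2 volume →
        Integrable fun p => starRingEnd ℂ (kernelOp (regKernel χ ρ) (w t) p) * g p := fun hg =>
      MemLp.integrable_mul m0.star hg
    have e : ∫ p, 2 * (starRingEnd ℂ (kernelOp (regKernel χ ρ) (w t) p) * D t p).re =
        2 * ((∫ p, starRingEnd ℂ (kernelOp (regKernel χ ρ) (w t) p) *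
          kernelOp (commKernel χ ρ W) (w t) p).re +
        (∫ p, starRingEnd ℂ (kernelOp (regKernel χ ρ) (w t) p) *
          kernelOp (regKernel χ ρ) (F t) p).re) := by
      rw [integral_const_mul, ← re_integral_conj_mul_regGenKernel hχ hρ hW, ← Complex.add_re,
        ← integral_add (hint m1) (hint mF)]
      have hi : Integrable fun p =>
          starRingEnd ℂ (kernelOp (regKernel χ ρ) (w t) p) * D t p := hint (m1.add mF)
      have := integral_re hi
      simp only [RCLike.re_to_complex] at this
      rw [this]
      simp only [hD, mul_add]
    beta_reduce
    rw [e, abs_mul, abs_two, mul_assoc]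
    refine mul_le_mul_of_nonneg_left ((abs_add_le _ _).trans ?_) (by norm_num)
    rw [← norm_toLp_sq m0, ← norm_toLp_sq m2, ← norm_toLp_sq mF]
    simp only [Real.sqrt_sq (norm_nonneg _), mul_add]
    exact add_le_add (abs_integral_re_le m0 m2) (abs_integral_re_le m0 mF)

end EnergyDerivative

/-! ### Cutoffs and mollifiers at coupled scales, and the size of the commutator kernel -/

section Scaling

/-- The bump function equal to one on the ball of radius `ε` and supported in that of radius
`2 ε`. -/
noncomputable def planeBump (ε : ℝ) (hε : 0 < ε) : ContDiffBump (0 : ℝ × ℝ) :=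
  ⟨ε, 2 * ε, hε, by linarith⟩

lemma planeBump_apply (ε : ℝ) (hε : 0 < ε) (z : ℝ × ℝ) :
    planeBump ε hε z = planeBump 1 one_pos (ε⁻¹ • z) := by
  rw [ContDiffBump.apply, ContDiffBump.apply]
  simp only [planeBump, sub_zero, inv_one, one_smul, mul_one, div_one]
  rw [mul_div_cancel_right₀ _ hε.ne']

/-- The unit cutoff. -/
noncomputable def unitCutoff (p : ℝ × ℝ) : ℂ := (planeBump 1 one_pos p : ℝ)

/-- The unit mollifier. -/
noncomputable def unitMollifier (p : ℝ × ℝ) : ℂ := ((planeBump 1 one_pos).normed volume p : ℝ)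

/-- The cutoff at scale `1 / ε`. -/
noncomputable def cutoff (ε : ℝ) (p : ℝ × ℝ) : ℂ := unitCutoff (ε • p)

/-- The mollifier at scale `ε`. -/
noncomputable def mollifier (ε : ℝ) (p : ℝ × ℝ) : ℂ := (ε⁻¹ : ℝ) ^ 2 * unitMollifier (ε⁻¹ • p)

lemma integral_planeBump (ε : ℝ) (hε : 0 < ε) :
    ∫ z, planeBump ε hε z = ε ^ 2 * ∫ z, planeBump 1 one_pos z := by
  simp_rw [planeBump_apply ε hε]
  rw [Measure.integral_comp_inv_smul_of_nonneg _ _ hε.le]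
  simp

lemma mollifier_eq_normed (ε : ℝ) (hε : 0 < ε) (z : ℝ × ℝ) :
    mollifier ε z = (((planeBump ε hε).normed volume z : ℝ) : ℂ) := by
  rw [mollifier, unitMollifier, ContDiffBump.normed_def, ContDiffBump.normed_def,
    integral_planeBump ε hε, planeBump_apply ε hε]
  push_cast
  field_simp

lemma isTestFun_unitCutoff : IsTestFun unitCutoff :=
  ⟨Complex.ofRealCLM.contDiff.comp (ContDiffBump.contDiff _),
    (ContDiffBump.hasCompactSupport _).comp_left (g := Complex.ofReal) Complex.ofReal_zero⟩

lemma isTestFun_unitMollifier : IsTestFun unitMollifier :=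
  ⟨Complex.ofRealCLM.contDiff.comp (ContDiffBump.contDiff_normed _),
    (ContDiffBump.hasCompactSupport_normed _).comp_left (g := Complex.ofReal) Complex.ofReal_zero⟩

variable {φ : ℝ × ℝ → ℂ}

lemma IsTestFun.comp_smul (h : IsTestFun φ) {a : ℝ} (ha : a ≠ 0) :
    IsTestFun fun p => φ (a • p) :=
  ⟨h.smooth.comp (contDiff_id.const_smul a), h.2.comp_homeomorph (Homeomorph.smulOfNeZero a ha)⟩

lemma isTestFun_cutoff {ε : ℝ} (hε : 0 < ε) : IsTestFun (cutoff ε) :=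
  isTestFun_unitCutoff.comp_smul hε.ne'

lemma isTestFun_mollifier {ε : ℝ} (hε : 0 < ε) : IsTestFun (mollifier ε) :=
  (isTestFun_unitMollifier.comp_smul (inv_ne_zero hε.ne')).const_mul _

lemma partialX_comp_smul (h : Differentiable ℝ φ) (a : ℝ) :
    partialX (fun p => φ (a • p)) = fun p => (a : ℂ) * partialX φ (a • p) := by
  funext p
  have h1 := hasDerivAt_partialX h (a * p.1) (a * p.2)
  have h2 := h1.scomp (p.1) ((hasDerivAt_id p.1).const_mul a)
  refine h2.deriv.trans ?_
  simp [Prod.smul_def]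

lemma partialY_comp_smul (h : Differentiable ℝ φ) (a : ℝ) :
    partialY (fun p => φ (a • p)) = fun p => (a : ℂ) * partialY φ (a • p) := by
  funext p
  have h1 := hasDerivAt_partialY h (a * p.1) (a * p.2)
  have h2 := h1.scomp (p.2) ((hasDerivAt_id p.2).const_mul a)
  refine h2.deriv.trans ?_
  simp [Prod.smul_def]

lemma exists_norm_le_of_isTestFun (h : IsTestFun φ) : ∃ A, ∀ p, ‖φ p‖ ≤ A :=
  h.continuous.bounded_above_of_compact_support h.2

lemma notMem_tsupport_unitCutoff {p : ℝ × ℝ} (hp : 2 < ‖p‖) : p ∉ tsupport unitCutoff := by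
  intro h
  have h1 : p ∈ tsupport (planeBump 1 one_pos) :=
    closure_mono (s := Function.support unitCutoff)
      (t := Function.support (planeBump 1 one_pos)) (fun q hq hq' => hq (by simp [unitCutoff, hq'])) h
  rw [ContDiffBump.tsupport_eq] at h1
  simp [planeBump] at h1
  exact not_lt.2 h1 (by simpa using hp)

lemma notMem_tsupport_unitMollifier {p : ℝ × ℝ} (hp : 2 < ‖p‖) :
    p ∉ tsupport unitMollifier := by
  intro h
  have h1 : p ∈ tsupport ((planeBump 1 one_pos).normed volume) :=
    closure_mono (s := Function.support unitMollifier)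
      (t := Function.support ((planeBump 1 one_pos).normed volume))
      (fun q hq hq' => hq (by simp [unitMollifier, hq'])) h
  rw [ContDiffBump.tsupport_normed_eq] at h1
  simp [planeBump] at h1
  exact not_lt.2 h1 (by simpa using hp)

lemma unitCutoff_eventuallyEq_one {p : ℝ × ℝ} (hp : ‖p‖ < 1) : unitCutoff =ᶠ[𝓝 p] fun _ => 1 := by
  have : p ∈ Metric.ball (0 : ℝ × ℝ) 1 := by simpa using hp
  filter_upwards [Metric.isOpen_ball.mem_nhds this] with q hq
  rw [unitCutoff, ContDiffBump.one_of_mem_closedBall]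
  · simp
  · exact Metric.ball_subset_closedBall hq

lemma partials_unitCutoff_eq_zero {p : ℝ × ℝ} (hp : ‖p‖ < 1) :
    partialX unitCutoff p = 0 ∧ partialY unitCutoff p = 0 ∧
      partialX (partialY unitCutoff) p = 0 := by
  have hd := isTestFun_unitCutoff.differentiable
  have key : ∀ q : ℝ × ℝ, ‖q‖ < 1 → fderiv ℝ unitCutoff q = 0 := fun q hq => by
    rw [(unitCutoff_eventuallyEq_one hq).fderiv_eq, fderiv_const_apply]
  refine ⟨by rw [partialX_apply hd, key p hp]; rfl, by rw [partialY_apply hd, key p hp]; rfl, ?_⟩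
  rw [partialX_apply isTestFun_unitCutoff.partialY.differentiable]
  have : partialY unitCutoff =ᶠ[𝓝 p] fun _ => 0 := by
    have : p ∈ Metric.ball (0 : ℝ × ℝ) 1 := by simpa using hp
    filter_upwards [Metric.isOpen_ball.mem_nhds this] with q hq
    rw [partialY_apply hd, key q (by simpa using hq)]; rfl
  rw [this.fderiv_eq, fderiv_const_apply]; rfl

lemma norm_unitCutoff_le (p : ℝ × ℝ) : ‖unitCutoff p‖ ≤ 1 := by
  rw [unitCutoff, Complex.norm_real, Real.norm_eq_abs, abs_of_nonneg (ContDiffBump.nonneg _)]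
  exact ContDiffBump.le_one _

/-- The weight `min 1 (ε (1 + |q|))`. -/
noncomputable def tailWeight (ε : ℝ) (q : ℝ × ℝ) : ℝ := min 1 (ε * (1 + ‖q‖))

/-- The terms with one derivative on each factor have size ε · ε⁻³ = ε⁻², the size of a mollifier,
and live where |p| ≥ 1/ε. In the potential term the increment is of order ε (1 + |q|) and p stays
within 2/ε. In both cases the excess over a mollifier is controlled by `tailWeight`. -/
lemma commKernel_le_aux {ε K A : ℝ} (hε : 0 < ε) (hε' : ε ≤ 1 / 2) (hK : 0 ≤ K)
    {p q : ℝ × ℝ} (hpq : ‖p - q‖ ≤ 2 * ε) (hA : 0 ≤ A) {cx cy cxy c rx ry r : ℂ} {v : ℝ}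
    (hcx : ‖cx‖ ≤ ε * A) (hcy : ‖cy‖ ≤ ε * A) (hcxy : ‖cxy‖ ≤ ε ^ 2 * A) (hc : ‖c‖ ≤ 1)
    (hrx : ‖rx‖ ≤ ε⁻¹ ^ 3 * A) (hry : ‖ry‖ ≤ ε⁻¹ ^ 3 * A) (hr : ‖r‖ ≤ ε⁻¹ ^ 2 * A)
    (h0 : ε * ‖p‖ < 1 → cx = 0 ∧ cy = 0 ∧ cxy = 0) (h2 : 2 < ε * ‖p‖ → c = 0)
    (hv : |v| ≤ K * (1 + ‖p‖ + ‖q‖) * ‖p - q‖) :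
    ‖-Complex.I * (cx * ry + cy * rx + cxy * r) + Complex.I * c * v * r‖ ≤
      (6 * A ^ 2 + 12 * K * A) * ε⁻¹ ^ 2 * tailWeight ε q := by
  have hp := norm_le_norm_add_norm_sub' p q
  have hq : ‖q‖ ≤ ‖p‖ + ‖p - q‖ := by
    have := norm_le_norm_add_norm_sub' q p
    rwa [norm_sub_rev] at this
  have hθ0 : 0 ≤ tailWeight ε q := le_min zero_le_one (by positivity)
  have hei : ε * ε⁻¹ = 1 := mul_inv_cancel₀ hε.ne'
  have hinv : 0 < ε⁻¹ := inv_pos.2 hε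
  have hinv1 : 1 ≤ ε⁻¹ ^ 2 := by
    have : 1 ≤ ε⁻¹ := by nlinarith
    nlinarith
  have first : ‖-Complex.I * (cx * ry + cy * rx + cxy * r)‖ ≤
      6 * A ^ 2 * ε⁻¹ ^ 2 * tailWeight ε q := by
    by_cases hlt : ε * ‖p‖ < 1
    · obtain ⟨rfl, rfl, rfl⟩ := h0 hlt
      simp only [zero_mul, add_zero, mul_zero, norm_zero]
      positivity
    · push Not at hlt
      -- Here ε|p| ≥ 1 and |p - q| ≤ 2ε, so ε|q| ≥ 1 - 2ε² ≥ 1/2.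
      have hθ : 1 / 2 ≤ tailWeight ε q := le_min (by norm_num) (by nlinarith)
      have e1 : ‖cx * ry‖ ≤ ε⁻¹ ^ 2 * A ^ 2 := by
        rw [norm_mul]
        refine (mul_le_mul hcx hry (norm_nonneg _) (by positivity)).trans_eq ?_
        field_simp
      have e2 : ‖cy * rx‖ ≤ ε⁻¹ ^ 2 * A ^ 2 := by
        rw [norm_mul]
        refine (mul_le_mul hcy hrx (norm_nonneg _) (by positivity)).trans_eq ?_
        field_simp
      have e3 : ‖cxy * r‖ ≤ ε⁻¹ ^ 2 * A ^ 2 := by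
        rw [norm_mul]
        refine (mul_le_mul hcxy hr (norm_nonneg _) (by positivity)).trans ?_
        have : ε ^ 2 * A * (ε⁻¹ ^ 2 * A) = A ^ 2 := by field_simp
        rw [this]
        nlinarith [sq_nonneg A]
      rw [norm_mul, norm_neg, Complex.norm_I, one_mul]
      have e4 : 3 * (ε⁻¹ ^ 2 * A ^ 2) ≤ 6 * A ^ 2 * ε⁻¹ ^ 2 * tailWeight ε q := by
        have : 0 ≤ 6 * A ^ 2 * ε⁻¹ ^ 2 := by positivity
        nlinarith
      linarith [norm_add₃_le (a := cx * ry) (b := cy * rx) (c := cxy * r)]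
  have second : ‖Complex.I * c * v * r‖ ≤ 12 * K * A * ε⁻¹ ^ 2 * tailWeight ε q := by
    by_cases hgt : 2 < ε * ‖p‖
    · rw [h2 hgt]
      simp only [mul_zero, zero_mul, norm_zero]
      positivity
    · push Not at hgt
      -- On the support of the cutoff, ε (1 + |q|) ≤ ε + 2 + 2ε² ≤ 3, so truncating the weight at 1
      -- costs a factor 3.
      have hs : ε * (1 + ‖q‖) ≤ 3 * tailWeight ε q := by
        have h3 : ε * (1 + ‖q‖) ≤ 3 := by nlinarith
        have h4 : 0 ≤ ε * (1 + ‖q‖) := by positivity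
        rw [tailWeight]
        rcases min_cases 1 (ε * (1 + ‖q‖)) with h | h <;> linarith [h.1]
      have hv' : |v| ≤ 12 * K * tailWeight ε q := by
        have h5 : (1 + ‖p‖ + ‖q‖) * ‖p - q‖ ≤ 4 * (ε * (1 + ‖q‖)) := by
          have : 1 + ‖p‖ + ‖q‖ ≤ 2 * (1 + ‖q‖) := by linarith
          nlinarith [norm_nonneg q, norm_nonneg (p - q)]
        calc |v| ≤ K * ((1 + ‖p‖ + ‖q‖) * ‖p - q‖) := by rw [← mul_assoc]; exact hv
          _ ≤ K * (4 * (ε * (1 + ‖q‖))) := mul_le_mul_of_nonneg_left h5 hK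
          _ ≤ K * (4 * (3 * tailWeight ε q)) := by gcongr
          _ = _ := by ring
      rw [norm_mul, norm_mul, norm_mul, Complex.norm_I, one_mul, Complex.norm_real,
        Real.norm_eq_abs]
      calc ‖c‖ * |v| * ‖r‖ ≤ 1 * (12 * K * tailWeight ε q) * (ε⁻¹ ^ 2 * A) := by gcongr
        _ = _ := by ring
  refine (norm_add_le _ _).trans ((add_le_add first second).trans_eq ?_)
  ring

lemma exists_commKernel_le {W : ℝ × ℝ → ℝ} {K : ℝ} (hK : 0 ≤ K)
    (hW : ∀ p q, |W p - W q| ≤ K * (1 + ‖p‖ + ‖q‖) * ‖p - q‖) :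
    ∃ A, 0 ≤ A ∧ ∀ ε, 0 < ε → ε ≤ 1 / 2 → ∀ p q,
      ‖commKernel (cutoff ε) (mollifier ε) W (p, q)‖ ≤
        A * ε⁻¹ ^ 2 * (Metric.closedBall (0 : ℝ × ℝ) (2 * ε)).indicator 1 (p - q)
          * tailWeight ε q := by
  have hχ := isTestFun_unitCutoff
  have hρ := isTestFun_unitMollifier
  obtain ⟨a1, h1⟩ := exists_norm_le_of_isTestFun hχ.partialX
  obtain ⟨a2, h2⟩ := exists_norm_le_of_isTestFun hχ.partialY
  obtain ⟨a3, h3⟩ := exists_norm_le_of_isTestFun hχ.partialY.partialX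
  obtain ⟨a4, h4⟩ := exists_norm_le_of_isTestFun hρ.partialX
  obtain ⟨a5, h5⟩ := exists_norm_le_of_isTestFun hρ.partialY
  obtain ⟨a6, h6⟩ := exists_norm_le_of_isTestFun hρ
  have n1 := (norm_nonneg _).trans (h1 0)
  have n2 := (norm_nonneg _).trans (h2 0)
  have n3 := (norm_nonneg _).trans (h3 0)
  have n4 := (norm_nonneg _).trans (h4 0)
  have n5 := (norm_nonneg _).trans (h5 0)
  have n6 := (norm_nonneg _).trans (h6 0)
  set A := a1 + a2 + a3 + a4 + a5 + a6 with hA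
  have hA0 : 0 ≤ A := by positivity
  refine ⟨6 * A ^ 2 + 12 * K * A, by positivity, fun ε hε hε' p q => ?_⟩
  have hρs := (hρ.comp_smul (inv_ne_zero hε.ne')).differentiable
  have eχX : partialX (cutoff ε) = fun p => (ε : ℂ) * partialX unitCutoff (ε • p) :=
    partialX_comp_smul hχ.differentiable ε
  have eχY : partialY (cutoff ε) = fun p => (ε : ℂ) * partialY unitCutoff (ε • p) :=
    partialY_comp_smul hχ.differentiable ε
  have eχXY : partialX (partialY (cutoff ε)) =
      fun p => (ε : ℂ) * (ε * partialX (partialY unitCutoff) (ε • p)) := by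
    funext p
    rw [eχY, partialX_const_mul _ (hχ.partialY.comp_smul hε.ne').differentiable,
      partialX_comp_smul hχ.partialY.differentiable]
  have eρX : ∀ z, partialX (mollifier ε) z =
      (ε⁻¹ : ℝ) ^ 2 * ((ε⁻¹ : ℝ) * partialX unitMollifier (ε⁻¹ • z)) := fun z => by
    have := partialX_const_mul (((ε⁻¹ : ℝ) : ℂ) ^ 2) hρs z
    rw [partialX_comp_smul hρ.differentiable] at this
    exact this
  have eρY : ∀ z, partialY (mollifier ε) z =
      (ε⁻¹ : ℝ) ^ 2 * ((ε⁻¹ : ℝ) * partialY unitMollifier (ε⁻¹ • z)) := fun z => by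
    have := partialY_const_mul (((ε⁻¹ : ℝ) : ℂ) ^ 2) hρs z
    rw [partialY_comp_smul hρ.differentiable] at this
    exact this
  have hinv : 0 < ε⁻¹ := inv_pos.2 hε
  by_cases hpq : p - q ∈ Metric.closedBall (0 : ℝ × ℝ) (2 * ε)
  · rw [indicator_of_mem hpq, Pi.one_apply, mul_one]
    simp only [commKernel]
    rw [← Complex.ofReal_sub]
    refine commKernel_le_aux hε hε' hK (by simpa using hpq) hA0 ?_ ?_ ?_ ?_ ?_ ?_ ?_ ?_ ?_ (hW p q)
    · rw [eχX, norm_mul, Complex.norm_real, Real.norm_of_nonneg hε.le]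
      gcongr; linarith [h1 (ε • p)]
    · rw [eχY, norm_mul, Complex.norm_real, Real.norm_of_nonneg hε.le]
      gcongr; linarith [h2 (ε • p)]
    · rw [eχXY, norm_mul, norm_mul, Complex.norm_real, Real.norm_of_nonneg hε.le, ← mul_assoc, ← sq]
      gcongr; linarith [h3 (ε • p)]
    · exact norm_unitCutoff_le _
    · rw [eρX, norm_mul, norm_mul, norm_pow, Complex.norm_real, Real.norm_of_nonneg hinv.le,
        ← mul_assoc, ← pow_succ]
      gcongr; linarith [h4 (ε⁻¹ • (p - q))]
    · rw [eρY, norm_mul, norm_mul, norm_pow, Complex.norm_real, Real.norm_of_nonneg hinv.le,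
        ← mul_assoc, ← pow_succ]
      gcongr; linarith [h5 (ε⁻¹ • (p - q))]
    · rw [mollifier, norm_mul, norm_pow, Complex.norm_real, Real.norm_of_nonneg hinv.le]
      gcongr; linarith [h6 (ε⁻¹ • (p - q))]
    · intro hlt
      obtain ⟨z1, z2, z3⟩ := partials_unitCutoff_eq_zero (p := ε • p)
        (by rwa [norm_smul, Real.norm_of_nonneg hε.le])
      rw [eχX, eχXY, eχY]
      simp [z1, z2, z3]
    · intro hgt
      exact image_eq_zero_of_notMem_tsupport (f := unitCutoff) (notMem_tsupport_unitCutoff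
        (p := ε • p) (by rwa [norm_smul, Real.norm_of_nonneg hε.le]))
  · rw [indicator_of_notMem hpq]
    have hz : ε⁻¹ • (p - q) ∉ tsupport unitMollifier := by
      refine notMem_tsupport_unitMollifier ?_
      rw [norm_smul, Real.norm_of_nonneg hinv.le, lt_inv_mul_iff₀ hε]
      simpa [mul_comm] using hpq
    have z1 := image_eq_zero_of_notMem_tsupport hz
    have z2 := partialX_eq_zero_of_notMem_tsupport hρ.differentiable hz
    have z3 := partialY_eq_zero_of_notMem_tsupport hρ.differentiable hz
    simp only [commKernel, eρX, eρY, mollifier, z1, z2, z3]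
    simp

end Scaling

/-! ### L² bounds for the regularization and its commutator -/

section KernelBounds

open ENNReal

lemma lintegral_kernelOp_sq_le {k : (ℝ × ℝ) × (ℝ × ℝ) → ℂ} {κ Θ : ℝ × ℝ → ℝ≥0∞}
    (hκ : Measurable κ) (hΘ : Measurable Θ) (h : ∀ p q, ‖k (p, q)‖ₑ ≤ κ (p - q) * Θ q)
    (f : PlaneL2) :
    ∫⁻ p, ‖kernelOp k f p‖ₑ ^ 2 ≤ (∫⁻ z, κ z) ^ 2 * ∫⁻ q, (Θ q * ‖f q‖ₑ) ^ 2 := by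
  refine le_trans (lintegral_mono fun p => ?_) (lintegral_convolution_sq_le hκ
    (hΘ.aemeasurable.mul (Lp.aestronglyMeasurable f).enorm))
  refine pow_le_pow_left₀ zero_le ?_ 2
  refine (enorm_integral_le_lintegral_enorm _).trans (lintegral_mono fun q => ?_)
  rw [enorm_mul]
  calc ‖f q‖ₑ * ‖k (p, q)‖ₑ ≤ ‖f q‖ₑ * (κ (p - q) * Θ q) := by gcongr; exact h p q
    _ = _ := by ring

lemma sqrt_integral_norm_sq {g : ℝ × ℝ → ℂ} (hg : AEStronglyMeasurable g) :
    √(∫ p, ‖g p‖ ^ 2) = (∫⁻ p, ‖g p‖ₑ ^ 2).toReal ^ (1 / 2 : ℝ) := by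
  rw [integral_eq_lintegral_of_nonneg_ae (f := fun p => ‖g p‖ ^ 2) (Eventually.of_forall fun p => by positivity)
    (hg.norm.pow 2), ← Real.sqrt_eq_rpow]
  congr 3
  funext p
  rw [ENNReal.ofReal_pow (norm_nonneg _), ofReal_norm]

lemma lintegral_enorm_sq_eq (f : PlaneL2) : ∫⁻ p, ‖f p‖ₑ ^ 2 = ENNReal.ofReal (‖f‖ ^ 2) := by
  have h := norm_toLp_sq (Lp.memLp f)
  rw [Lp.toLp_coeFn] at h
  rw [h, ofReal_integral_eq_lintegral_ofReal]
  · refine lintegral_congr fun p => ?_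
    rw [ENNReal.ofReal_pow (norm_nonneg _), ofReal_norm]
  · exact (Lp.memLp f).integrable_norm_pow (by norm_num)
  · exact Eventually.of_forall fun p => by positivity

lemma lintegral_enorm_mollifier {ε : ℝ} (hε : 0 < ε) : ∫⁻ z, ‖mollifier ε z‖ₑ = 1 := by
  have : ∀ z, ‖mollifier ε z‖ₑ = ENNReal.ofReal ((planeBump ε hε).normed volume z) := fun z => by
    rw [mollifier_eq_normed ε hε, ← ofReal_norm, Complex.norm_real,
      Real.norm_of_nonneg (ContDiffBump.nonneg_normed _ _)]
  simp only [this]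
  rw [← ofReal_integral_eq_lintegral_ofReal (ContDiffBump.integrable_normed _)
    (Eventually.of_forall fun z => ContDiffBump.nonneg_normed _ _), ContDiffBump.integral_normed,
    ENNReal.ofReal_one]

/-- The mollifier has mass one and the cutoff is at most one, so the regularization is a
contraction; the final estimate therefore has constant one in front of the initial error and the
source. -/
lemma sqrt_integral_regKernel_le {ε : ℝ} (hε : 0 < ε) (f : PlaneL2) :
    √(∫ p, ‖kernelOp (regKernel (cutoff ε) (mollifier ε)) f p‖ ^ 2) ≤ ‖f‖ := by
  have hχ := isTestFun_cutoff hε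
  have hρ := isTestFun_mollifier hε
  rw [sqrt_integral_norm_sq (kernelOp_continuous (regKernel_continuous hχ hρ)
    (regKernel_hasCompactSupport hχ hρ) f).aestronglyMeasurable]
  have h := lintegral_kernelOp_sq_le (k := regKernel (cutoff ε) (mollifier ε))
    (κ := fun z => ‖mollifier ε z‖ₑ) (Θ := fun _ => 1) hρ.continuous.measurable.enorm
    measurable_const (fun p q => ?_) f
  · simp only [one_mul, lintegral_enorm_mollifier hε, one_pow, lintegral_enorm_sq_eq] at h
    have h2 := ENNReal.toReal_mono ENNReal.ofReal_ne_top h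
    rw [ENNReal.toReal_ofReal (by positivity)] at h2
    rw [← Real.sqrt_eq_rpow]
    exact Real.sqrt_le_iff.2 ⟨norm_nonneg _, h2⟩
  · rw [regKernel, enorm_mul, mul_one]
    refine (mul_le_mul_left (show ‖cutoff ε p‖ₑ ≤ 1 from ?_) _).trans_eq (one_mul _)
    rw [← ofReal_norm]
    exact ENNReal.ofReal_le_one.2 (norm_unitCutoff_le _)

lemma continuous_tailWeight (ε : ℝ) : Continuous (tailWeight ε) := by
  unfold tailWeight; fun_prop

/-- The squared norm of `f` with the weight `tailWeight ε`. -/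
noncomputable def tailMass (ε : ℝ) (f : PlaneL2) : ℝ≥0∞ :=
  ∫⁻ q, (ENNReal.ofReal (tailWeight ε q) * ‖f q‖ₑ) ^ 2

lemma tailMass_le (ε : ℝ) (f : PlaneL2) : tailMass ε f ≤ ENNReal.ofReal (‖f‖ ^ 2) := by
  rw [← lintegral_enorm_sq_eq]
  refine lintegral_mono fun q => ?_
  refine pow_le_pow_left₀ zero_le ?_ 2
  refine (mul_le_mul_left (ENNReal.ofReal_le_one.2 (min_le_left _ _)) _).trans_eq (one_mul _)

/-- The weight is at most one and tends to zero at every point, so dominated convergence applies to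
each f in L², without any decay assumption. -/
lemma tendsto_tailMass {ε : ℕ → ℝ} (hε : Tendsto ε atTop (𝓝 0)) (f : PlaneL2) :
    Tendsto (fun n => tailMass (ε n) f) atTop (𝓝 0) := by
  have h0 : (0 : ℝ≥0∞) = ∫⁻ _ : ℝ × ℝ, 0 := by simp
  rw [h0]
  refine tendsto_lintegral_of_dominated_convergence' (fun q => ‖f q‖ₑ ^ 2) (fun n => ?_)
    (fun n => Eventually.of_forall fun q => ?_) ?_ (Eventually.of_forall fun q => ?_)
  · exact (((continuous_tailWeight _).measurable.ennreal_ofReal.aemeasurable.mul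
      (Lp.aestronglyMeasurable f).enorm)).pow_const 2
  · refine pow_le_pow_left₀ zero_le ?_ 2
    exact (mul_le_mul_left (ENNReal.ofReal_le_one.2 (min_le_left _ _)) _).trans_eq (one_mul _)
  · rw [lintegral_enorm_sq_eq]; exact ENNReal.ofReal_ne_top
  · have h1 : Tendsto (fun n => tailWeight (ε n) q) atTop (𝓝 (min 1 (0 * (1 + ‖q‖)))) :=
      tendsto_const_nhds.min (hε.mul_const _)
    have h2 : min 1 (0 * (1 + ‖q‖)) = 0 := by simp
    rw [h2] at h1
    have h3 := ENNReal.tendsto_ofReal h1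
    rw [ENNReal.ofReal_zero] at h3
    have h4 := ENNReal.Tendsto.pow (n := 2)
      (ENNReal.Tendsto.mul_const h3 (Or.inr (enorm_ne_top (x := f q))))
    simpa using h4

/-- Young's inequality with the weight moved onto f. The constant depends neither on ε nor on f, so
smallness comes from `tailMass` alone. -/
lemma exists_sqrt_integral_commKernel_le {W : ℝ × ℝ → ℝ} {K : ℝ} (hWc : Continuous W) (hK : 0 ≤ K)
    (hW : ∀ p q, |W p - W q| ≤ K * (1 + ‖p‖ + ‖q‖) * ‖p - q‖) :
    ∃ Λ, 0 ≤ Λ ∧ ∀ ε, 0 < ε → ε ≤ 1 / 2 → ∀ f : PlaneL2,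
      √(∫ p, ‖kernelOp (commKernel (cutoff ε) (mollifier ε) W) f p‖ ^ 2) ≤
        Λ * √(tailMass ε f).toReal := by
  obtain ⟨A, hA, h⟩ := exists_commKernel_le hK hW
  set v := (volume (Metric.ball (0 : ℝ × ℝ) 1)).toReal with hv
  refine ⟨A * 4 * v, by positivity, fun ε hε hε' f => ?_⟩
  have hχ := isTestFun_cutoff hε
  have hρ := isTestFun_mollifier hε
  -- The height A ε⁻² and the volume (2ε)² v of the ball compensate exactly.
  have hκi : ∫⁻ z, (Metric.closedBall (0 : ℝ × ℝ) (2 * ε)).indicator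
      (fun _ => ENNReal.ofReal (A * ε⁻¹ ^ 2)) z = ENNReal.ofReal (A * 4 * v) := by
    rw [lintegral_indicator Metric.isClosed_closedBall.measurableSet, setLIntegral_const,
      Measure.addHaar_closedBall _ _ (by positivity), hv,
      ← ENNReal.ofReal_toReal (measure_ball_lt_top (μ := volume) (x := (0 : ℝ × ℝ)) (r := 1)).ne,
      ← ENNReal.ofReal_mul (by positivity), ← ENNReal.ofReal_mul (by positivity)]
    congr 1
    simp only [Module.finrank_prod, Module.finrank_self]
    rw [ENNReal.toReal_ofReal (by positivity)]
    field_simp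
    norm_num
    ring
  have h1 := lintegral_kernelOp_sq_le (k := commKernel (cutoff ε) (mollifier ε) W)
    (κ := (Metric.closedBall (0 : ℝ × ℝ) (2 * ε)).indicator
      (fun _ => ENNReal.ofReal (A * ε⁻¹ ^ 2))) (Θ := fun q => ENNReal.ofReal (tailWeight ε q))
    (measurable_const.indicator Metric.isClosed_closedBall.measurableSet)
    (continuous_tailWeight ε).measurable.ennreal_ofReal (fun p q => ?_) f
  · rw [sqrt_integral_norm_sq (kernelOp_continuous (commKernel_continuous hχ hρ hWc)
      (commKernel_hasCompactSupport hχ hρ) f).aestronglyMeasurable, ← Real.sqrt_eq_rpow]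
    rw [hκi] at h1
    change _ ≤ _ * tailMass ε f at h1
    have h2 := ENNReal.toReal_mono (ENNReal.mul_ne_top (ENNReal.pow_ne_top ENNReal.ofReal_ne_top)
      ((tailMass_le ε f).trans_lt ENNReal.ofReal_lt_top).ne) h1
    rw [ENNReal.toReal_mul, ENNReal.toReal_pow, ENNReal.toReal_ofReal (by positivity)] at h2
    refine (Real.sqrt_le_sqrt h2).trans_eq ?_
    rw [Real.sqrt_mul (by positivity), Real.sqrt_sq (by positivity)]
  · have h2 := h ε hε hε' p q
    rw [← ofReal_norm]
    refine (ENNReal.ofReal_le_ofReal h2).trans ?_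
    by_cases hpq : p - q ∈ Metric.closedBall (0 : ℝ × ℝ) (2 * ε)
    · rw [indicator_of_mem hpq, indicator_of_mem hpq, Pi.one_apply, mul_one,
        ENNReal.ofReal_mul (by positivity)]
    · rw [indicator_of_notMem hpq]
      simp

/-- At a fixed point the cutoff is eventually one, and the mollification converges almost everywhere
by Lebesgue differentiation. -/
lemma ae_tendsto_kernelOp_regKernel {ε : ℕ → ℝ} (hε0 : ∀ n, 0 < ε n)
    (hε : Tendsto ε atTop (𝓝 0)) (f : PlaneL2) :
    ∀ᵐ p, Tendsto (fun n => kernelOp (regKernel (cutoff (ε n)) (mollifier (ε n))) f p) atTop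
      (𝓝 (f p)) := by
  have h := ContDiffBump.ae_convolution_tendsto_right_of_locallyIntegrable (μ := volume)
    (φ := fun n => planeBump (ε n) (hε0 n)) (l := atTop) (K := 2) ?_ ?_
    (locallyIntegrable_planeL2 f)
  · filter_upwards [h] with p hp
    have h1 : ∀ᶠ n in atTop, cutoff (ε n) p = 1 := by
      have h2 : Tendsto (fun n => ε n • p) atTop (𝓝 0) := by simpa using hε.smul_const p
      have h3 := (unitCutoff_eventuallyEq_one (p := 0) (by simp))
      exact h2.eventually h3
    refine hp.congr' ?_
    filter_upwards [h1] with n hn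
    rw [kernelOp_regKernel, hn, one_mul, convolution_lsmul_swap, mollify]
    refine integral_congr_ae (Eventually.of_forall fun q => ?_)
    simp [mollifier_eq_normed _ (hε0 n), mul_comm]
  · simpa [planeBump] using hε.const_mul 2
  · exact Eventually.of_forall fun n => le_rfl

/-- Fatou's lemma along the almost everywhere convergence of the regularizations. -/
lemma norm_le_of_eventually_regKernel_le {ε : ℕ → ℝ} (hε0 : ∀ n, 0 < ε n)
    (hε : Tendsto ε atTop (𝓝 0)) (f : PlaneL2) {c : ℝ} (hc : 0 ≤ c)
    (h : ∀ᶠ n in atTop,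
      √(∫ p, ‖kernelOp (regKernel (cutoff (ε n)) (mollifier (ε n))) f p‖ ^ 2) ≤ c) :
    ‖f‖ ≤ c := by
  have hcont : ∀ n, Continuous (kernelOp (regKernel (cutoff (ε n)) (mollifier (ε n))) f) := fun n =>
    kernelOp_continuous (regKernel_continuous (isTestFun_cutoff (hε0 n))
      (isTestFun_mollifier (hε0 n))) (regKernel_hasCompactSupport (isTestFun_cutoff (hε0 n))
      (isTestFun_mollifier (hε0 n))) f
  have h1 : ∫⁻ p, ‖f p‖ₑ ^ 2 ≤ ENNReal.ofReal (c ^ 2) := by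
    calc ∫⁻ p, ‖f p‖ₑ ^ 2
        = ∫⁻ p, liminf (fun n =>
            ‖kernelOp (regKernel (cutoff (ε n)) (mollifier (ε n))) f p‖ₑ ^ 2) atTop := by
          refine lintegral_congr_ae ?_
          filter_upwards [ae_tendsto_kernelOp_regKernel hε0 hε f] with p hp
          exact ((ENNReal.Tendsto.pow (n := 2) hp.enorm).liminf_eq).symm
      _ ≤ liminf (fun n => ∫⁻ p,
            ‖kernelOp (regKernel (cutoff (ε n)) (mollifier (ε n))) f p‖ₑ ^ 2) atTop :=
          lintegral_liminf_le fun n => (hcont n).measurable.enorm.pow_const 2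
      _ ≤ ENNReal.ofReal (c ^ 2) := by
          refine liminf_le_of_frequently_le' (Eventually.frequently ?_)
          filter_upwards [h] with n hn
          rw [sqrt_integral_norm_sq (hcont n).aestronglyMeasurable, ← Real.sqrt_eq_rpow] at hn
          have h2 := (Real.sqrt_le_left hc).1 hn
          have hlt := (lintegral_kernelOp_sq_le (k := regKernel (cutoff (ε n)) (mollifier (ε n)))
            (κ := fun z => ‖mollifier (ε n) z‖ₑ) (Θ := fun _ => 1)
            (isTestFun_mollifier (hε0 n)).continuous.measurable.enorm measurable_const
            (fun p q => ?_) f)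
          · simp only [one_mul, lintegral_enorm_mollifier (hε0 n), one_pow,
              lintegral_enorm_sq_eq] at hlt
            exact ENNReal.le_ofReal_iff_toReal_le (hlt.trans_lt ENNReal.ofReal_lt_top).ne
              (by positivity) |>.2 h2
          · rw [regKernel, enorm_mul, mul_one]
            refine (mul_le_mul_left (show ‖cutoff (ε n) p‖ₑ ≤ 1 from ?_) _).trans_eq (one_mul _)
            rw [← ofReal_norm]
            exact ENNReal.ofReal_le_one.2 (norm_unitCutoff_le _)
  rw [lintegral_enorm_sq_eq, ENNReal.ofReal_le_ofReal_iff (by positivity)] at h1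
  exact (pow_le_pow_iff_left₀ (norm_nonneg _) hc two_ne_zero).1 h1

end KernelBounds

/-! ### The energy inequality -/

section EnergyInequality

/-- The energy inequality for bounded distributional solutions of
`∂_t w = i ∂_x ∂_y w - i W w + F`, for a real potential of at most quadratic growth. -/
theorem IsForcedWeakSolution.norm_le {W : ℝ × ℝ → ℝ} {T M B K : ℝ} {F w : ℝ → PlaneL2}
    (h : IsForcedWeakSolution W T M B F w) (hT : 0 ≤ T) (hWc : Continuous W) (hK : 0 ≤ K)
    (hW : ∀ p q, |W p - W q| ≤ K * (1 + ‖p‖ + ‖q‖) * ‖p - q‖) :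
    ‖w T‖ ≤ ‖w 0‖ + B * T := by
  have hB : 0 ≤ B := (norm_nonneg _).trans (h.force 0 ⟨le_rfl, hT⟩)
  obtain ⟨Λ, hΛ, hcomm⟩ := exists_sqrt_integral_commKernel_le hWc hK hW
  -- The shift by 2 gives ε ≤ 1/2, as the commutator bound requires.
  set ε : ℕ → ℝ := fun n => 1 / ((n : ℝ) + 2) with hε
  have hε0 : ∀ n, 0 < ε n := fun n => by positivity
  have hε2 : ∀ n, ε n ≤ 1 / 2 := fun n =>
    one_div_le_one_div_of_le two_pos (by linarith [(Nat.cast_nonneg n : (0 : ℝ) ≤ n)])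
  have hεt : Tendsto ε atTop (𝓝 0) := by
    have := (tendsto_one_div_add_atTop_nhds_zero_nat (𝕜 := ℝ)).comp (tendsto_add_atTop_nat 1)
    refine this.congr fun n => ?_
    simp only [hε, Function.comp]
    push_cast
    ring
  have hχ : ∀ n, IsTestFun (cutoff (ε n)) := fun n => isTestFun_cutoff (hε0 n)
  have hρ : ∀ n, IsTestFun (mollifier (ε n)) := fun n => isTestFun_mollifier (hε0 n)
  choose N' hN' using fun n => h.exists_hasDerivAt_energy (hχ n) (hρ n) hWc
  have htail : ∀ t ∈ Ioo 0 T, ∀ n, √(tailMass (ε n) (w t)).toReal ≤ M := fun t ht n => by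
    have hM := h.bound t (Ioo_subset_Icc_self ht)
    refine Real.sqrt_le_iff.2 ⟨(norm_nonneg _).trans hM, ?_⟩
    have h1 := ENNReal.toReal_mono ENNReal.ofReal_ne_top (tailMass_le (ε n) (w t))
    rw [ENNReal.toReal_ofReal (by positivity)] at h1
    exact h1.trans (pow_le_pow_left₀ (norm_nonneg _) hM 2)
  refine le_of_forall_pos_le_add fun η hη => ?_
  refine norm_le_of_eventually_regKernel_le hε0 hεt (w T) (by positivity) ?_
  refine eventually_sqrt_le_of_deriv_le
    (N := fun n t => ∫ p, ‖kernelOp (regKernel (cutoff (ε n)) (mollifier (ε n))) (w t) p‖ ^ 2)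
    (N' := N') (c := fun n t => Λ * √(tailMass (ε n) (w t)).toReal) (cb := Λ * M)
    hT (norm_nonneg _) (fun n t => integral_nonneg fun p => by positivity)
    (fun n => h.continuousOn_energy (hχ n) (hρ n)) (fun n t ht => (hN' n t ht).1)
    (fun n t ht => (hN' n t ht).2.trans ?_) (fun n t ht => by positivity) hB
    (fun n t ht => mul_le_mul_of_nonneg_left (htail t ht n) hΛ) (fun t ht => ?_) (fun n => ?_) hη
  · refine mul_le_mul_of_nonneg_left (add_le_add (hcomm _ (hε0 n) (hε2 n) _) ?_) (by positivity)
    exact (sqrt_integral_regKernel_le (hε0 n) _).trans (h.force t (Ioo_subset_Icc_self ht))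
  · have h1 := (ENNReal.tendsto_toReal ENNReal.zero_ne_top).comp (tendsto_tailMass hεt (w t))
    have h2 := ((Real.continuous_sqrt.tendsto _).comp h1).const_mul Λ
    simpa using h2
  · exact (Real.sqrt_le_left (norm_nonneg _)).1 (sqrt_integral_regKernel_le (hε0 n) _)

end EnergyInequality

/-! ### Translations on L² -/

section Translation

/-- Translation `f ↦ f(· + a)` on `L²(ℝ²)`. -/
noncomputable def shiftOp (a : ℝ × ℝ) : PlaneL2 →L[ℂ] PlaneL2 :=
  (Lp.compMeasurePreservingₗᵢ ℂ (fun p => p + a)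
    (measurePreserving_add_right volume a)).toContinuousLinearMap

lemma coeFn_shiftOp (a : ℝ × ℝ) (f : PlaneL2) : shiftOp a f =ᵐ[volume] fun p => f (p + a) :=
  Lp.coeFn_compMeasurePreserving f (measurePreserving_add_right volume a)

lemma norm_shiftOp (a : ℝ × ℝ) (f : PlaneL2) : ‖shiftOp a f‖ = ‖f‖ :=
  LinearIsometry.norm_map _ f

lemma ae_comp_add {P : ℝ × ℝ → Prop} (h : ∀ᵐ p, P p) (a : ℝ × ℝ) : ∀ᵐ p, P (p + a) :=
  (measurePreserving_add_right volume a).quasiMeasurePreserving.ae h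

lemma shiftOp_shiftOp (a b : ℝ × ℝ) (f : PlaneL2) :
    shiftOp a (shiftOp b f) = shiftOp (a + b) f := by
  refine Lp.ext ?_
  filter_upwards [coeFn_shiftOp a (shiftOp b f), coeFn_shiftOp (a + b) f,
    ae_comp_add (coeFn_shiftOp b f) a] with p h1 h2 h3
  rw [h1, h2, h3, add_assoc]

lemma shiftOp_zero (f : PlaneL2) : shiftOp 0 f = f := by
  refine Lp.ext ?_
  filter_upwards [coeFn_shiftOp 0 f] with p h1
  rw [h1, add_zero]

lemma inner_shiftOp (a : ℝ × ℝ) (f g : PlaneL2) :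
    inner ℂ (shiftOp a f) g = inner ℂ f (shiftOp (-a) g) := by
  have h : g = shiftOp a (shiftOp (-a) g) := by
    rw [shiftOp_shiftOp, add_neg_cancel, shiftOp_zero]
  conv_lhs => rw [h]
  exact LinearIsometry.inner_map_map _ f _

lemma integral_shiftOp_mul (a : ℝ × ℝ) (f : PlaneL2) (φ : ℝ × ℝ → ℂ) :
    ∫ p, shiftOp a f p * φ p = ∫ p, f p * φ (p + -a) := by
  rw [← integral_add_right_eq_self (fun p => f p * φ (p + -a)) a]
  refine integral_congr_ae ?_
  filter_upwards [coeFn_shiftOp a f] with p h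
  rw [h, add_neg_cancel_right]

end Translation

/-! ### Multiplication by bounded real functions -/

section Multiplication

open BoundedContinuousFunction

lemma memLp_bounded_mul (m : (ℝ × ℝ) →ᵇ ℝ) (f : PlaneL2) :
    MemLp (fun p => (m p : ℂ) * f p) 2 volume := by
  refine (Lp.memLp f).of_le_mul (c := ‖m‖) ?_ (Eventually.of_forall fun p => ?_)
  · exact (Complex.continuous_ofReal.comp m.continuous).aestronglyMeasurable.mul
      (Lp.aestronglyMeasurable f)
  · rw [norm_mul, Complex.norm_real]
    exact mul_le_mul_of_nonneg_right (m.norm_coe_le_norm p) (norm_nonneg _)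

/-- Multiplication by a bounded continuous real function on `L²(ℝ²)`. -/
noncomputable def mulOp (m : (ℝ × ℝ) →ᵇ ℝ) : PlaneL2 →L[ℂ] PlaneL2 :=
  LinearMap.mkContinuous
    { toFun := fun f => (memLp_bounded_mul m f).toLp
      map_add' := fun f g => by
        refine Lp.ext ?_
        filter_upwards [(memLp_bounded_mul m (f + g)).coeFn_toLp, Lp.coeFn_add f g,
          Lp.coeFn_add (memLp_bounded_mul m f).toLp (memLp_bounded_mul m g).toLp,
          (memLp_bounded_mul m f).coeFn_toLp, (memLp_bounded_mul m g).coeFn_toLp]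
          with p h1 h2 h3 h4 h5
        rw [h1, h3, Pi.add_apply, h4, h5, h2, Pi.add_apply, mul_add]
      map_smul' := fun c f => by
        refine Lp.ext ?_
        filter_upwards [(memLp_bounded_mul m (c • f)).coeFn_toLp, Lp.coeFn_smul c f,
          Lp.coeFn_smul c (memLp_bounded_mul m f).toLp, (memLp_bounded_mul m f).coeFn_toLp]
          with p h1 h2 h3 h4
        rw [h1, RingHom.id_apply, h3, Pi.smul_apply, h4, h2, Pi.smul_apply, smul_eq_mul,
          smul_eq_mul]
        ring }
    ‖m‖ fun f => by
      refine Lp.norm_le_mul_norm_of_ae_le_mul ?_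
      filter_upwards [(memLp_bounded_mul m f).coeFn_toLp] with p h1
      simp only [LinearMap.coe_mk, AddHom.coe_mk]
      rw [h1, norm_mul, Complex.norm_real]
      exact mul_le_mul_of_nonneg_right (m.norm_coe_le_norm p) (norm_nonneg _)

lemma coeFn_mulOp (m : (ℝ × ℝ) →ᵇ ℝ) (f : PlaneL2) :
    mulOp m f =ᵐ[volume] fun p => (m p : ℂ) * f p :=
  (memLp_bounded_mul m f).coeFn_toLp

lemma inner_mulOp (m : (ℝ × ℝ) →ᵇ ℝ) (f g : PlaneL2) :
    inner ℂ (mulOp m f) g = inner ℂ f (mulOp m g) := by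
  rw [L2.inner_def, L2.inner_def]
  refine integral_congr_ae ?_
  filter_upwards [coeFn_mulOp m f, coeFn_mulOp m g] with p h1 h2
  rw [h1, h2]
  simp only [RCLike.inner_apply, map_mul, Complex.conj_ofReal]
  ring

lemma integral_mulOp_mul (m : (ℝ × ℝ) →ᵇ ℝ) (f : PlaneL2) (φ : ℝ × ℝ → ℂ) :
    ∫ p, mulOp m f p * φ p = ∫ p, f p * (m p * φ p) := by
  refine integral_congr_ae ?_
  filter_upwards [coeFn_mulOp m f] with p h
  rw [h]; ring

end Multiplication

/-! ### Multiplication by y and weak differentiation in x as closed relations -/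

section WeakRelations

/-- The relation `v = y u`. -/
def IsMulY (u v : PlaneL2) : Prop := v =ᵐ[volume] fun p => (p.2 : ℂ) * u p

/-- The relation `v = ∂_x u` in the sense of distributions, tested against `C¹` functions with
compact support. -/
def IsWeakPartialX (u v : PlaneL2) : Prop :=
  ∀ φ : ℝ × ℝ → ℂ, ContDiff ℝ 1 φ → HasCompactSupport φ →
    ∫ p, v p * φ p = -∫ p, u p * partialX φ p

variable {u v u' v' : PlaneL2}

/-- Both sides are locally integrable, so equality as distributions is equality almost everywhere.
The weak form is the one stable under weak limits. -/
lemma isMulY_of_pairing (h : ∀ φ : ℝ × ℝ → ℂ, IsTestFun φ →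
    ∫ p, v p * φ p = ∫ p, u p * (p.2 * φ p)) : IsMulY u v := by
  have hl : LocallyIntegrable fun p : ℝ × ℝ => (p.2 : ℂ) * u p :=
    (locallyIntegrable_planeL2 u).continuous_smul
      (g := fun p : ℝ × ℝ => (p.2 : ℂ)) (Complex.continuous_ofReal.comp continuous_snd)
  refine ae_eq_of_integral_contDiff_smul_eq (locallyIntegrable_planeL2 v) hl fun g hg hc => ?_
  have hφ : IsTestFun fun p => (g p : ℂ) :=
    ⟨Complex.ofRealCLM.contDiff.comp hg, hc.comp_left (g := Complex.ofReal) Complex.ofReal_zero⟩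
  have := h _ hφ
  simp only [Complex.real_smul]
  calc ∫ p, (g p : ℂ) * v p = ∫ p, v p * g p := by simp only [mul_comm]
    _ = ∫ p, u p * (p.2 * g p) := this
    _ = ∫ p, (g p : ℂ) * (p.2 * u p) := by congr 1; funext p; ring

lemma IsMulY.integral_eq (h : IsMulY u v) (φ : ℝ × ℝ → ℂ) :
    ∫ p, v p * φ p = ∫ p, u p * (p.2 * φ p) := by
  refine integral_congr_ae ?_
  filter_upwards [h] with p hp
  rw [hp]; ring

lemma isMulY_iff : IsMulY u v ↔ ∀ φ : ℝ × ℝ → ℂ, IsTestFun φ →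
    ∫ p, v p * φ p = ∫ p, u p * (p.2 * φ p) :=
  ⟨fun h φ _ => h.integral_eq φ, isMulY_of_pairing⟩

lemma IsMulY.zero : IsMulY 0 0 := by
  filter_upwards [Lp.coeFn_zero ℂ 2 (volume : Measure (ℝ × ℝ))] with p h
  rw [h]; simp

lemma IsMulY.add (h : IsMulY u v) (h' : IsMulY u' v') : IsMulY (u + u') (v + v') := by
  filter_upwards [h, h', Lp.coeFn_add u u', Lp.coeFn_add v v'] with p h1 h2 h3 h4
  rw [h3, h4, Pi.add_apply, Pi.add_apply, h1, h2, mul_add]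

lemma IsMulY.smul (h : IsMulY u v) (c : ℂ) : IsMulY (c • u) (c • v) := by
  filter_upwards [h, Lp.coeFn_smul c u, Lp.coeFn_smul c v] with p h1 h2 h3
  rw [h2, h3, Pi.smul_apply, Pi.smul_apply, h1, smul_eq_mul, smul_eq_mul]
  ring

lemma IsMulY.nsmul (h : IsMulY u v) (n : ℕ) : IsMulY (n • u) (n • v) := by
  rw [← Nat.cast_smul_eq_nsmul ℂ, ← Nat.cast_smul_eq_nsmul ℂ]
  exact h.smul _

lemma IsMulY.sub (h : IsMulY u v) (h' : IsMulY u' v') : IsMulY (u - u') (v - v') := by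
  have := h.add (h'.smul (-1))
  simpa [← sub_eq_add_neg] using this

lemma IsMulY.sum {ι : Type*} (s : Finset ι) {U V : ι → PlaneL2} (h : ∀ i ∈ s, IsMulY (U i) (V i)) :
    IsMulY (∑ i ∈ s, U i) (∑ i ∈ s, V i) := by
  classical
  induction s using Finset.induction_on with
  | empty => simpa using IsMulY.zero
  | insert i s hi ih =>
    rw [Finset.sum_insert hi, Finset.sum_insert hi]
    exact (h i (Finset.mem_insert_self i s)).add
      (ih fun j hj => h j (Finset.mem_insert_of_mem hj))

lemma IsMulY.shiftOp (h : IsMulY u v) (a : ℝ × ℝ) :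
    IsMulY (shiftOp a u) (shiftOp a v - (a.2 : ℂ) • shiftOp a u) := by
  filter_upwards [ae_comp_add h a, coeFn_shiftOp a u, coeFn_shiftOp a v,
    Lp.coeFn_sub (_root_.shiftOp a v) ((a.2 : ℂ) • _root_.shiftOp a u),
    Lp.coeFn_smul (a.2 : ℂ) (_root_.shiftOp a u)] with p h1 h2 h3 h4 h5
  rw [h4, Pi.sub_apply, h5, Pi.smul_apply, h2, h3, h1, smul_eq_mul, Prod.snd_add]
  push_cast
  ring

lemma IsMulY.mulOp (h : IsMulY u v) (m : BoundedContinuousFunction (ℝ × ℝ) ℝ) :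
    IsMulY (mulOp m u) (mulOp m v) := by
  filter_upwards [h, coeFn_mulOp m u, coeFn_mulOp m v] with p h1 h2 h3
  rw [h2, h3, h1]; ring

lemma IsMulY.norm_mulOp_le (h : IsMulY u v) {m : BoundedContinuousFunction (ℝ × ℝ) ℝ} {A : ℝ}
    (hm : ∀ p, |m p| ≤ A * |p.2|) : ‖_root_.mulOp m u‖ ≤ A * ‖v‖ := by
  refine Lp.norm_le_mul_norm_of_ae_le_mul ?_
  filter_upwards [h, coeFn_mulOp m u] with p h1 h2
  rw [h1, h2, norm_mul, norm_mul, Complex.norm_real, Complex.norm_real, ← mul_assoc]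
  exact mul_le_mul_of_nonneg_right (hm p) (norm_nonneg _)

lemma memLp_partialX {φ : ℝ × ℝ → ℂ} (hφ : ContDiff ℝ 1 φ) (hc : HasCompactSupport φ) :
    MemLp (partialX φ) 2 volume :=
  memLp_of_cc (contDiff_partialX (m := 0) hφ (by norm_num)).continuous
    (hasCompactSupport_partialX (hφ.differentiable one_ne_zero) hc)

lemma isWeakPartialX_iff_pairL : IsWeakPartialX u v ↔ ∀ φ : ℝ × ℝ → ℂ, ∀ (hφ : ContDiff ℝ 1 φ)
    (hc : HasCompactSupport φ), pairL (memLp_of_cc hφ.continuous hc).toLp v =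
      -pairL (memLp_partialX hφ hc).toLp u := by
  refine forall_congr' fun φ => forall_congr' fun hφ => forall_congr' fun hc => ?_
  rw [integral_mul_eq_pairL (memLp_of_cc hφ.continuous hc),
    integral_mul_eq_pairL (memLp_partialX hφ hc)]

lemma IsWeakPartialX.zero : IsWeakPartialX 0 0 := by
  rw [isWeakPartialX_iff_pairL]; intros; simp

lemma IsWeakPartialX.add (h : IsWeakPartialX u v) (h' : IsWeakPartialX u' v') :
    IsWeakPartialX (u + u') (v + v') := by
  rw [isWeakPartialX_iff_pairL] at *
  intro φ hφ hc
  rw [map_add, map_add, h φ hφ hc, h' φ hφ hc]; ring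

lemma IsWeakPartialX.smul (h : IsWeakPartialX u v) (c : ℂ) : IsWeakPartialX (c • u) (c • v) := by
  rw [isWeakPartialX_iff_pairL] at *
  intro φ hφ hc
  rw [map_smul, map_smul, h φ hφ hc, smul_neg]

lemma IsWeakPartialX.nsmul (h : IsWeakPartialX u v) (n : ℕ) : IsWeakPartialX (n • u) (n • v) := by
  rw [← Nat.cast_smul_eq_nsmul ℂ, ← Nat.cast_smul_eq_nsmul ℂ]
  exact h.smul _

lemma IsWeakPartialX.sub (h : IsWeakPartialX u v) (h' : IsWeakPartialX u' v') :
    IsWeakPartialX (u - u') (v - v') := by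
  have := h.add (h'.smul (-1))
  simpa [← sub_eq_add_neg] using this

lemma IsWeakPartialX.sum {ι : Type*} (s : Finset ι) {U V : ι → PlaneL2}
    (h : ∀ i ∈ s, IsWeakPartialX (U i) (V i)) :
    IsWeakPartialX (∑ i ∈ s, U i) (∑ i ∈ s, V i) := by
  classical
  induction s using Finset.induction_on with
  | empty => simpa using IsWeakPartialX.zero
  | insert i s hi ih =>
    rw [Finset.sum_insert hi, Finset.sum_insert hi]
    exact (h i (Finset.mem_insert_self i s)).add
      (ih fun j hj => h j (Finset.mem_insert_of_mem hj))

lemma IsWeakPartialX.shiftOp (h : IsWeakPartialX u v) (a : ℝ × ℝ) :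
    IsWeakPartialX (shiftOp a u) (shiftOp a v) := by
  intro φ hφ hc
  rw [integral_shiftOp_mul, integral_shiftOp_mul,
    h (fun p => φ (p + -a)) (hφ.comp (contDiff_id.add contDiff_const))
      (hc.comp_homeomorph (Homeomorph.addRight (-a)))]
  simp only [partialX_comp_add]

/-- The product rule, obtained by testing against m φ. As m is only C¹, so is this product, hence
the use of C¹ test functions in `IsWeakPartialX`. -/
lemma IsWeakPartialX.mulOp (h : IsWeakPartialX u v) {m m' : BoundedContinuousFunction (ℝ × ℝ) ℝ}
    (hm : ContDiff ℝ 1 m) (hm' : ∀ x y, HasDerivAt (fun s => m (s, y)) (m' (x, y)) x) :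
    IsWeakPartialX (mulOp m u) (mulOp m v + _root_.mulOp m' u) := by
  intro φ hφ hc
  have hmC : ContDiff ℝ 1 fun p => (m p : ℂ) := Complex.ofRealCLM.contDiff.comp hm
  have hd : partialX (fun p => (m p : ℂ)) = fun p => (m' p : ℂ) := by
    funext p
    exact (hm' p.1 p.2).ofReal_comp.deriv
  have hmφ : HasCompactSupport fun p => (m p : ℂ) * φ p := hc.mul_left
  have hm'c : Continuous fun p => (m' p : ℂ) := Complex.continuous_ofReal.comp m'.continuous
  have hφ' : Continuous (partialX φ) := (contDiff_partialX (m := 0) hφ (by norm_num)).continuous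
  have hcφ' := hasCompactSupport_partialX (hφ.differentiable one_ne_zero) hc
  have h1 := h _ (hmC.mul hφ) hmφ
  rw [funext (partialX_mul (hmC.differentiable one_ne_zero) (hφ.differentiable one_ne_zero)),
    hd] at h1
  have i1 : Integrable fun p => u p * ((m' p : ℂ) * φ p) :=
    integrable_mul_cc (hm'c.mul hφ.continuous) hc.mul_left u
  have i2 : Integrable fun p => u p * ((m p : ℂ) * partialX φ p) :=
    integrable_mul_cc (hmC.continuous.mul hφ') hcφ'.mul_left u
  have e1 : ∫ p, u p * ((m' p : ℂ) * φ p + m p * partialX φ p) =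
      (∫ p, u p * ((m' p : ℂ) * φ p)) + ∫ p, u p * ((m p : ℂ) * partialX φ p) := by
    rw [← integral_add i1 i2]
    simp only [mul_add]
  rw [integral_mul_eq_pairL (memLp_of_cc hφ.continuous hc), map_add,
    ← integral_mul_eq_pairL, ← integral_mul_eq_pairL, integral_mulOp_mul, integral_mulOp_mul,
    integral_mulOp_mul, h1, e1]
  ring

/-- Against a fixed test function, the translate of u by s has derivative given by the translate of
v, whose norm is that of v. The mean value inequality over [-δ, δ] and duality conclude. -/
lemma IsWeakPartialX.norm_shiftOp_sub_le (h : IsWeakPartialX u v) {δ : ℝ} (hδ : 0 ≤ δ) :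
    ‖_root_.shiftOp (δ, 0) u - _root_.shiftOp (-δ, 0) u‖ ≤ 2 * δ * ‖v‖ := by
  refine norm_le_of_pairing_le _ (by positivity) fun φ hφ => ?_
  have hcont : Continuous (partialX φ) := hφ.partialX.continuous
  have hder : ∀ s : ℝ, HasDerivAt (fun r : ℝ => ∫ p, u p * φ (p + -(r, 0)))
      (∫ p, _root_.shiftOp (s, 0) v p * φ p) s := by
    intro s
    obtain ⟨A, hA⟩ := exists_norm_le_of_isTestFun hφ.partialX
    -- A compact set containing the supports of all translates by amounts within 1 of s; it carries
    -- the dominating function.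
    set K : Set (ℝ × ℝ) := (fun z : (ℝ × ℝ) × ℝ => z.1 + (z.2, 0)) ''
      (tsupport φ ×ˢ Icc (s - 1) (s + 1)) with hKdef
    have hK : IsCompact K := (hφ.2.isCompact.prod isCompact_Icc).image (by fun_prop)
    have hind : MemLp (K.indicator fun _ => (A : ℂ)) 2 volume :=
      memLp_indicator_const 2 hK.measurableSet _ (Or.inr hK.measure_ne_top)
    have hshift : ∀ r : ℝ, Continuous fun p : ℝ × ℝ => φ (p + -(r, 0)) := fun r =>
      hφ.continuous.comp (by fun_prop)
    have key := (hasDerivAt_integral_of_dominated_loc_of_deriv_le (μ := volume) (x₀ := s)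
      (s := Ioo (s - 1) (s + 1)) (F := fun r p => u p * φ (p + -(r, 0)))
      (F' := fun r p => u p * -partialX φ (p + -(r, 0)))
      (bound := fun p => ‖u p * K.indicator (fun _ => (A : ℂ)) p‖)
      (Ioo_mem_nhds (by linarith) (by linarith))
      (Eventually.of_forall fun r => (Lp.aestronglyMeasurable u).mul
        (hshift r).aestronglyMeasurable)
      (integrable_mul_of_memLp (hφ.comp_add (-(s, 0))).memLp u)
      ((Lp.aestronglyMeasurable u).mul
        (hcont.comp (by fun_prop : Continuous fun p : ℝ × ℝ => p + -(s, 0))).neg.aestronglyMeasurable)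
      (Eventually.of_forall fun p r hr => ?_) (integrable_mul_of_memLp hind u).norm
      (Eventually.of_forall fun p r hr => ?_)).2
    · refine key.congr_deriv ?_
      rw [integral_shiftOp_mul, h (fun p => φ (p + -(s, 0))) ((hφ.comp_add _).contDiff_nat 1)
        (hφ.comp_add _).2, ← integral_neg]
      refine integral_congr_ae (Eventually.of_forall fun p => ?_)
      simp only [partialX_comp_add]
      ring
    · rw [norm_mul, norm_mul, norm_neg]
      refine mul_le_mul_of_nonneg_left ?_ (norm_nonneg _)
      by_cases hp : p ∈ K
      · rw [indicator_of_mem hp, Complex.norm_real]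
        exact (hA _).trans (le_abs_self A)
      · have : p + -(r, 0) ∉ tsupport φ := fun hmem => hp
          ⟨(p + -(r, 0), r), ⟨hmem, Ioo_subset_Icc_self hr⟩, by ext <;> simp⟩
        rw [partialX_eq_zero_of_notMem_tsupport hφ.differentiable this]
        simp
    · refine HasDerivAt.const_mul (u p) ?_
      have h1 := hasDerivAt_partialX hφ.differentiable (p.1 - r) p.2
      have h2 := h1.scomp r ((hasDerivAt_id r).const_sub p.1)
      refine (h2.congr_deriv ?_).congr_of_eventuallyEq (Eventually.of_forall fun r' => ?_)
      · simp only [neg_smul, one_smul]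
        congr 2
        ext <;> simp; ring
      · simp only [Function.comp]
        congr 1
        ext <;> simp; ring
  have hbd : ∀ s ∈ (univ : Set ℝ), ‖∫ p, _root_.shiftOp (s, 0) v p * φ p‖ ≤
      ‖v‖ * ‖hφ.memLp.toLp‖ := by
    intro s _
    rw [integral_mul_eq_pairL hφ.memLp]
    refine (norm_pairL_le _ _).trans_eq ?_
    rw [norm_shiftOp, mul_comm]
  have hmv := convex_univ.norm_image_sub_le_of_norm_hasDerivWithin_le
    (fun s _ => (hder s).hasDerivWithinAt) hbd (mem_univ (-δ)) (mem_univ δ)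
  rw [integral_mul_eq_pairL hφ.memLp, map_sub, ← integral_mul_eq_pairL, ← integral_mul_eq_pairL,
    integral_shiftOp_mul, integral_shiftOp_mul]
  refine hmv.trans_eq ?_
  rw [sub_neg_eq_add, Real.norm_of_nonneg (by positivity)]
  ring

end WeakRelations

/-! ### Bounded approximate generators and their action on y^α ∂_x^b u -/

section Generator

/-- A force `a 0` with its derivatives `a 1`, `a 2`, `a 3`, cut off at size `1 / δ`, with
derivatives bounded by `A`. -/
structure DampedForce (δ A : ℝ) where
  a : ℕ → ℝ → ℝ
  pos : 0 < δ
  le_one : δ ≤ 1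
  nonneg : 0 ≤ A
  cont : ∀ j, Continuous (a j)
  deriv : ∀ j < 3, ∀ x, HasDerivAt (a j) (a (j + 1) x) x
  bound_zero : ∀ x, |a 0 x| ≤ 1 / δ
  bound : ∀ j, 1 ≤ j → ∀ x, |a j x| ≤ A

variable {δ A : ℝ}

lemma abs_sin_div_le (hδ : 0 < δ) (y : ℝ) : |Real.sin (δ * y) / δ| ≤ |y| := by
  rw [abs_div, abs_of_pos hδ, div_le_iff₀ hδ]
  refine Real.abs_sin_le_abs.trans_eq ?_
  rw [abs_mul, abs_of_pos hδ, mul_comm]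

/-- The bounded symbol `a_j(x) sin(δ y) / δ`. -/
noncomputable def DampedForce.symbol (D : DampedForce δ A) (j : ℕ) :
    BoundedContinuousFunction (ℝ × ℝ) ℝ :=
  BoundedContinuousFunction.ofNormedAddCommGroup
    (fun p => D.a j p.1 * (Real.sin (δ * p.2) / δ))
    (((D.cont j).comp continuous_fst).mul (by fun_prop)) ((1 / δ + A) * (1 / δ)) fun p => by
      have hδ := D.pos
      have hA := D.nonneg
      rw [Real.norm_eq_abs, abs_mul]
      refine mul_le_mul ?_ ?_ (abs_nonneg _) (by positivity)
      · rcases Nat.eq_zero_or_pos j with rfl | hj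
        · linarith [D.bound_zero p.1]
        · have := D.bound j hj p.1
          have : 0 < 1 / δ := by positivity
          linarith
      · rw [abs_div, abs_of_pos hδ]
        exact div_le_div_of_nonneg_right (Real.abs_sin_le_one _) hδ.le

lemma DampedForce.symbol_apply (D : DampedForce δ A) (j : ℕ) (p : ℝ × ℝ) :
    D.symbol j p = D.a j p.1 * (Real.sin (δ * p.2) / δ) := rfl

lemma DampedForce.abs_symbol_le (D : DampedForce δ A) {j : ℕ} (hj : 1 ≤ j) (p : ℝ × ℝ) :
    |D.symbol j p| ≤ A * |p.2| := by
  rw [D.symbol_apply, abs_mul]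
  exact mul_le_mul (D.bound j hj _) (abs_sin_div_le D.pos _) (abs_nonneg _) D.nonneg

lemma DampedForce.hasDerivAt_symbol (D : DampedForce δ A) {j : ℕ} (hj : j < 3) (x y : ℝ) :
    HasDerivAt (fun s => D.symbol j (s, y)) (D.symbol (j + 1) (x, y)) x :=
  (D.deriv j hj x).mul_const (Real.sin (δ * y) / δ)

lemma DampedForce.contDiff_symbol (D : DampedForce δ A) {j : ℕ} (hj : j < 3) :
    ContDiff ℝ 1 (D.symbol j) := by
  have h1 : ContDiff ℝ 1 (D.a j) := by
    rw [contDiff_one_iff_deriv]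
    refine ⟨fun x => (D.deriv j hj x).differentiableAt, ?_⟩
    rw [funext fun x => (D.deriv j hj x).deriv]
    exact D.cont _
  have h2 : ContDiff ℝ 1 fun p : ℝ × ℝ => D.a j p.1 * (Real.sin (δ * p.2) / δ) :=
    (h1.comp contDiff_fst).mul
      ((Real.contDiff_sin.comp (contDiff_const.mul contDiff_snd)).div_const _)
  exact h2

/-- The central difference quotient in the first variable. -/
noncomputable def diffX (δ : ℝ) : PlaneL2 →L[ℂ] PlaneL2 :=
  (1 / (2 * δ) : ℂ) • (shiftOp (δ, 0) - shiftOp (-δ, 0))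

/-- The iterated commutators with `y` of the central difference quotient in the second
variable. -/
noncomputable def diffY (δ : ℝ) (j : ℕ) : PlaneL2 →L[ℂ] PlaneL2 :=
  (1 / (2 * δ) : ℂ) • ((-δ : ℂ) ^ j • shiftOp (0, δ) - (δ : ℂ) ^ j • shiftOp (0, -δ))

lemma diffX_apply (u : PlaneL2) :
    diffX δ u = (1 / (2 * δ) : ℂ) • (shiftOp (δ, 0) u - shiftOp (-δ, 0) u) := rfl

lemma diffY_apply (j : ℕ) (u : PlaneL2) :
    diffY δ j u = (1 / (2 * δ) : ℂ) •
      ((-δ : ℂ) ^ j • shiftOp (0, δ) u - (δ : ℂ) ^ j • shiftOp (0, -δ) u) := rfl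

variable {u v : PlaneL2}

lemma IsMulY.diffX (h : IsMulY u v) : IsMulY (diffX δ u) (diffX δ v) := by
  have h1 := h.shiftOp (δ, 0)
  have h2 := h.shiftOp (-δ, 0)
  simp only [Complex.ofReal_zero, zero_smul, sub_zero] at h1 h2
  exact (h1.sub h2).smul _

/-- A shift by ±δ in y fails to commute with y by ∓δ times the shift, which is the passage from j to
j + 1. -/
lemma IsMulY.diffY (h : IsMulY u v) (j : ℕ) :
    IsMulY (diffY δ j u) (diffY δ j v + _root_.diffY δ (j + 1) u) := by
  have h1 := (h.shiftOp (0, δ)).smul ((-δ : ℂ) ^ j)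
  have h2 := (h.shiftOp (0, -δ)).smul ((δ : ℂ) ^ j)
  have h3 := (h1.sub h2).smul (1 / (2 * δ) : ℂ)
  refine (congrArg (IsMulY (_root_.diffY δ j u)) ?_).mpr h3
  rw [diffY_apply, diffY_apply, ← smul_add]
  congr 1
  push_cast
  simp only [smul_sub, smul_smul, neg_smul, pow_succ, smul_neg, mul_neg]
  abel

lemma IsWeakPartialX.diffX (h : IsWeakPartialX u v) : IsWeakPartialX (diffX δ u) (diffX δ v) :=
  ((h.shiftOp _).sub (h.shiftOp _)).smul _

lemma IsWeakPartialX.diffY (h : IsWeakPartialX u v) (j : ℕ) :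
    IsWeakPartialX (diffY δ j u) (diffY δ j v) :=
  (((h.shiftOp _).smul _).sub ((h.shiftOp _).smul _)).smul _

lemma IsWeakPartialX.norm_diffX_le (h : IsWeakPartialX u v) (hδ : 0 < δ) :
    ‖_root_.diffX δ u‖ ≤ ‖v‖ := by
  rw [diffX_apply, norm_smul]
  have h1 := h.norm_shiftOp_sub_le hδ.le
  have h2 : ‖(1 / (2 * δ) : ℂ)‖ = 1 / (2 * δ) := by
    rw [norm_div, norm_mul, Complex.norm_real, Real.norm_of_nonneg hδ.le]; simp
  rw [h2, one_div, inv_mul_le_iff₀ (by positivity)]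
  exact h1

/-- From the first commutator on, the factor δ^j absorbs the 1/(2δ) of the difference quotient; this
makes the commutators bounded uniformly in δ. -/
lemma norm_diffY_le (hδ : 0 < δ) (hδ1 : δ ≤ 1) {j : ℕ} (hj : 1 ≤ j) (u : PlaneL2) :
    ‖diffY δ j u‖ ≤ ‖u‖ := by
  have h2 : ‖(1 / (2 * δ) : ℂ)‖ = 1 / (2 * δ) := by
    rw [norm_div, norm_mul, Complex.norm_real, Real.norm_of_nonneg hδ.le]; simp
  rw [diffY_apply, norm_smul, h2, one_div, inv_mul_le_iff₀ (by positivity)]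
  refine (norm_sub_le _ _).trans ?_
  rw [norm_smul, norm_smul, norm_shiftOp, norm_shiftOp, norm_pow, norm_pow, norm_neg,
    Complex.norm_real, Real.norm_of_nonneg hδ.le]
  have h3 : δ ^ j ≤ δ := by
    obtain ⟨k, rfl⟩ := Nat.exists_eq_add_of_le' hj
    rw [pow_succ]
    exact mul_le_of_le_one_left hδ.le (pow_le_one₀ hδ.le hδ1)
  nlinarith [norm_nonneg u]

/-- The generator `i P Q - i a_0(x) sin(δ y) / δ` with central differences `P`, `Q`. -/
noncomputable def DampedForce.gen (D : DampedForce δ A) : PlaneL2 →L[ℂ] PlaneL2 :=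
  Complex.I • ((diffY δ 0).comp (diffX δ) - mulOp (D.symbol 0))

lemma DampedForce.gen_apply (D : DampedForce δ A) (u : PlaneL2) :
    D.gen u = Complex.I • (diffY δ 0 (diffX δ u) - mulOp (D.symbol 0) u) := rfl

lemma inner_diffX (u v : PlaneL2) : inner ℂ (diffX δ u) v = -inner ℂ u (diffX δ v) := by
  rw [diffX_apply, diffX_apply, inner_smul_left, inner_smul_right, inner_sub_left, inner_sub_right,
    inner_shiftOp, inner_shiftOp]
  have h : (starRingEnd ℂ) (1 / (2 * δ) : ℂ) = 1 / (2 * δ) := by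
    rw [← Complex.ofReal_ofNat, ← Complex.ofReal_mul, ← Complex.ofReal_one, ← Complex.ofReal_div,
      Complex.conj_ofReal]
  simp only [Prod.neg_mk, neg_neg, neg_zero, h]
  ring

lemma inner_diffY (u v : PlaneL2) : inner ℂ (diffY δ 0 u) v = -inner ℂ u (diffY δ 0 v) := by
  rw [diffY_apply, diffY_apply, inner_smul_left, inner_smul_right, inner_sub_left, inner_sub_right]
  have h : (starRingEnd ℂ) (1 / (2 * δ) : ℂ) = 1 / (2 * δ) := by
    rw [← Complex.ofReal_ofNat, ← Complex.ofReal_mul, ← Complex.ofReal_one, ← Complex.ofReal_div,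
      Complex.conj_ofReal]
  simp only [pow_zero, one_smul, inner_shiftOp, Prod.neg_mk, neg_neg, neg_zero, h]
  ring

lemma diffX_diffY (u : PlaneL2) : diffX δ (diffY δ 0 u) = diffY δ 0 (diffX δ u) := by
  simp only [diffX_apply, diffY_apply, pow_zero, one_smul, map_smul, map_sub, shiftOp_shiftOp,
    add_comm, smul_smul, smul_sub]
  abel

/-- The two central differences are skew-adjoint and commute, so their product is self-adjoint, as
is the real multiplication operator; the factor i makes the generator skew-adjoint. -/
lemma DampedForce.re_inner_gen (D : DampedForce δ A) (u : PlaneL2) :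
    (inner ℂ u (D.gen u)).re = 0 := by
  rw [D.gen_apply, inner_smul_right, Complex.I_mul_re, inner_sub_right, Complex.sub_im]
  have h1 : (inner ℂ u (diffY δ 0 (diffX δ u))).im = 0 := by
    rw [← Complex.conj_eq_iff_im, inner_conj_symm, inner_diffY, inner_diffX, neg_neg, diffX_diffY]
  have h2 : (inner ℂ u (mulOp (D.symbol 0) u)).im = 0 := by
    rw [← Complex.conj_eq_iff_im, inner_conj_symm, inner_mulOp]
  rw [h1, h2]; simp

/-- The lift of the generator to the families `y^α ∂_x^b u`. -/
noncomputable def DampedForce.entry (D : DampedForce δ A) (h : ℕ → ℕ → PlaneL2) (b α : ℕ) :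
    PlaneL2 :=
  Complex.I • ((∑ ij ∈ Finset.HasAntidiagonal.antidiagonal α, α.choose ij.1 • diffY δ ij.1 (diffX δ (h b ij.2)))
    - ∑ ij ∈ Finset.HasAntidiagonal.antidiagonal b, b.choose ij.1 • mulOp (D.symbol ij.1) (h ij.2 α))

/-- The family `h` consists of the functions `h b α = y^α ∂_x^b (h 0 0)`, for `b + α ≤ 3`. -/
structure IsJet (h : ℕ → ℕ → PlaneL2) : Prop where
  mulY : ∀ b α, b + α < 3 → IsMulY (h b α) (h b (α + 1))
  partialX : ∀ b α, b + α < 3 → IsWeakPartialX (h b α) (h (b + 1) α)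

lemma IsJet.congr {h h' : ℕ → ℕ → PlaneL2} (H : IsJet h) (e : ∀ b α, b + α ≤ 3 → h b α = h' b α) :
    IsJet h' where
  mulY b α hb := by
    rw [← e b α (by omega), ← e b (α + 1) (by omega)]; exact H.mulY b α hb
  partialX b α hb := by
    rw [← e b α (by omega), ← e (b + 1) α (by omega)]; exact H.partialX b α hb

/-- Pascal's rule in Leibniz form: one more factor y, or one more ∂_x, either reaches the function
or raises the order of the commutator. -/
lemma sum_choose_succ_nsmul {M : Type*} [AddCommMonoid M] (f : ℕ → ℕ → M) (n : ℕ) :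
    ∑ ij ∈ Finset.HasAntidiagonal.antidiagonal (n + 1), (n + 1).choose ij.1 • f ij.1 ij.2 =
      ∑ ij ∈ Finset.HasAntidiagonal.antidiagonal n, n.choose ij.1 • (f ij.1 (ij.2 + 1) + f (ij.1 + 1) ij.2) := by
  rw [Finset.sum_antidiagonal_choose_succ_nsmul, ← Finset.sum_add_distrib]
  refine Finset.sum_congr rfl fun ij hij => ?_
  rw [Finset.HasAntidiagonal.mem_antidiagonal] at hij
  rw [smul_add, Nat.choose_symm_of_eq_add hij.symm]

/-- Each sum in `DampedForce.entry` is the Leibniz expansion of y^α ∂_x^b applied to the generator,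
so the lift respects both relations. The y-expansion involves only the differences and the
x-expansion only the symbols, since y commutes with the symbols and ∂_x with the shifts. -/
lemma IsJet.entry {h : ℕ → ℕ → PlaneL2} (H : IsJet h) (D : DampedForce δ A) :
    IsJet (D.entry h) where
  mulY b α hb := by
    unfold DampedForce.entry
    rw [sum_choose_succ_nsmul fun i j => _root_.diffY δ i (_root_.diffX δ (h b j))]
    refine IsMulY.smul (IsMulY.sub (IsMulY.sum _ fun ij hij => IsMulY.nsmul ?_ _)
      (IsMulY.sum _ fun ij hij => IsMulY.nsmul ?_ _)) _
    · rw [Finset.HasAntidiagonal.mem_antidiagonal] at hij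
      exact ((H.mulY b ij.2 (by omega)).diffX).diffY _
    · rw [Finset.HasAntidiagonal.mem_antidiagonal] at hij
      exact (H.mulY ij.2 α (by omega)).mulOp _
  partialX b α hb := by
    unfold DampedForce.entry
    rw [sum_choose_succ_nsmul fun i j => _root_.mulOp (D.symbol i) (h j α)]
    refine IsWeakPartialX.smul (IsWeakPartialX.sub
      (IsWeakPartialX.sum _ fun ij hij => IsWeakPartialX.nsmul ?_ _)
      (IsWeakPartialX.sum _ fun ij hij => IsWeakPartialX.nsmul ?_ _)) _
    · rw [Finset.HasAntidiagonal.mem_antidiagonal] at hij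
      exact ((H.partialX b ij.2 (by omega)).diffX).diffY _
    · rw [Finset.HasAntidiagonal.mem_antidiagonal] at hij
      exact (H.partialX ij.2 α (by omega)).mulOp (D.contDiff_symbol (by omega))
        fun x y => D.hasDerivAt_symbol (by omega) x y

/-- Isolates the commutator terms of a Leibniz sum, whose binomial coefficients add up to at most
2^n. -/
lemma norm_sum_choose_le {n : ℕ} {f : ℕ × ℕ → PlaneL2} {c : ℝ} (hc : 0 ≤ c)
    (hf : ∀ ij ∈ Finset.HasAntidiagonal.antidiagonal n, 1 ≤ ij.1 → ‖f ij‖ ≤ c) :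
    ‖(∑ ij ∈ Finset.HasAntidiagonal.antidiagonal n, n.choose ij.1 • f ij) - f (0, n)‖ ≤ 2 ^ n * c := by
  have hmem : (0, n) ∈ Finset.HasAntidiagonal.antidiagonal n := by simp
  rw [← Finset.add_sum_erase _ _ hmem]
  simp only [Nat.choose_zero_right, one_smul, add_sub_cancel_left]
  refine (norm_sum_le _ _).trans ?_
  have h1 : ∀ ij ∈ (Finset.HasAntidiagonal.antidiagonal n).erase (0, n), ‖n.choose ij.1 • f ij‖ ≤
      n.choose ij.1 * c := by
    intro ij hij
    rw [Finset.mem_erase] at hij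
    refine (norm_nsmul_le).trans ?_
    refine mul_le_mul_of_nonneg_left (hf ij hij.2 ?_) (Nat.cast_nonneg _)
    rw [Finset.HasAntidiagonal.mem_antidiagonal] at hij
    by_contra h0
    refine hij.1 (Prod.ext (by omega) ?_)
    simp only
    omega
  refine (Finset.sum_le_sum h1).trans ?_
  rw [← Finset.sum_mul]
  refine mul_le_mul_of_nonneg_right ?_ hc
  refine (Finset.sum_le_sum_of_subset_of_nonneg (Finset.erase_subset _ _)
    fun _ _ _ => by positivity).trans_eq ?_
  rw [Finset.Nat.sum_antidiagonal_eq_sum_range_succ_mk]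
  exact_mod_cast Nat.sum_range_choose n

/-- The system closes here. A commutator with y loses at least one factor y, which leaves room for
the derivative bounding the x-difference. A commutator with ∂_x loses at least one derivative, which
leaves room for the factor y bounding the symbol. Every function used stays within b + α ≤ 3, and 8
= 2³. -/
lemma IsJet.norm_entry_sub_gen_le {h : ℕ → ℕ → PlaneL2} (H : IsJet h) (D : DampedForce δ A)
    {c : ℝ} (hc : ∀ b α, b + α ≤ 3 → ‖h b α‖ ≤ c) {b α : ℕ} (hb : b + α ≤ 3) :
    ‖D.entry h b α - D.gen (h b α)‖ ≤ 8 * (1 + A) * c := by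
  have hc0 : 0 ≤ c := (norm_nonneg _).trans (hc b α hb)
  have hA := D.nonneg
  have e : D.entry h b α - D.gen (h b α) = Complex.I •
      (((∑ ij ∈ Finset.HasAntidiagonal.antidiagonal α,
          α.choose ij.1 • _root_.diffY δ ij.1 (_root_.diffX δ (h b ij.2)))
        - _root_.diffY δ 0 (_root_.diffX δ (h b α)))
      - ((∑ ij ∈ Finset.HasAntidiagonal.antidiagonal b, b.choose ij.1 • _root_.mulOp (D.symbol ij.1) (h ij.2 α))
        - _root_.mulOp (D.symbol 0) (h b α))) := by
    rw [DampedForce.entry, D.gen_apply, ← smul_sub]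
    congr 1
    abel
  rw [e, norm_smul, Complex.norm_I, one_mul]
  have h1 := norm_sum_choose_le (n := α)
    (f := fun ij => _root_.diffY δ ij.1 (_root_.diffX δ (h b ij.2))) hc0 fun ij hij hi => by
      rw [Finset.HasAntidiagonal.mem_antidiagonal] at hij
      refine (norm_diffY_le D.pos D.le_one hi _).trans ?_
      exact ((H.partialX b ij.2 (by omega)).norm_diffX_le D.pos).trans (hc _ _ (by omega))
  have h2 := norm_sum_choose_le (n := b) (c := A * c)
    (f := fun ij => _root_.mulOp (D.symbol ij.1) (h ij.2 α)) (by positivity) fun ij hij hi => by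
      rw [Finset.HasAntidiagonal.mem_antidiagonal] at hij
      refine ((H.mulY ij.2 α (by omega)).norm_mulOp_le (D.abs_symbol_le hi)).trans ?_
      exact mul_le_mul_of_nonneg_left (hc _ _ (by omega)) hA
  refine (norm_sub_le _ _).trans ((add_le_add h1 h2).trans ?_)
  have p1 : (2 : ℝ) ^ α ≤ 2 ^ 3 := pow_le_pow_right₀ one_le_two (by omega)
  have p2 : (2 : ℝ) ^ b ≤ 2 ^ 3 := pow_le_pow_right₀ one_le_two (by omega)
  have p3 : 0 ≤ A * c := by positivity
  nlinarith

end Generator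

/-! ### Evolution of consistent families and the uniform Gronwall bound -/

section Evolution

/-- The pairs `(b, α)` with `b + α ≤ 3`. -/
def jetIndex : Finset (ℕ × ℕ) := (Finset.range 4 ×ˢ Finset.range 4).filter fun i => i.1 + i.2 ≤ 3

lemma mem_jetIndex {b α : ℕ} : (b, α) ∈ jetIndex ↔ b + α ≤ 3 := by
  simp only [jetIndex, Finset.mem_filter, Finset.mem_product, Finset.mem_range]
  omega

/-- Families of functions indexed by `jetIndex`. -/
abbrev JetSpace : Type := jetIndex → PlaneL2

open Classical in
/-- The entries of a family, extended by zero. -/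
noncomputable def jetEntry (b α : ℕ) : JetSpace →L[ℂ] PlaneL2 :=
  if h : (b, α) ∈ jetIndex then ContinuousLinearMap.proj ⟨(b, α), h⟩ else 0

lemma jetEntry_apply (h : JetSpace) (i : jetIndex) : jetEntry i.1.1 i.1.2 h = h i := by
  rw [jetEntry, dif_pos i.2]; rfl

variable {δ A : ℝ}

/-- The lift of the generator to `JetSpace`. -/
noncomputable def DampedForce.jetGen (D : DampedForce δ A) : JetSpace →L[ℂ] JetSpace :=
  ContinuousLinearMap.pi fun i => Complex.I •
    ((∑ ij ∈ Finset.HasAntidiagonal.antidiagonal i.1.2,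
        i.1.2.choose ij.1 • (diffY δ ij.1).comp ((diffX δ).comp (jetEntry i.1.1 ij.2)))
      - ∑ ij ∈ Finset.HasAntidiagonal.antidiagonal i.1.1,
        i.1.1.choose ij.1 • (mulOp (D.symbol ij.1)).comp (jetEntry ij.2 i.1.2))

lemma DampedForce.jetGen_apply (D : DampedForce δ A) (h : JetSpace) (i : jetIndex) :
    D.jetGen h i = D.entry (fun b α => jetEntry b α h) i.1.1 i.1.2 := by
  simp [DampedForce.jetGen, DampedForce.entry]

lemma DampedForce.jetEntry_jetGen (D : DampedForce δ A) (h : JetSpace) {b α : ℕ}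
    (hb : b + α ≤ 3) :
    jetEntry b α (D.jetGen h) = D.entry (fun b α => jetEntry b α h) b α := by
  rw [← D.jetGen_apply h ⟨(b, α), mem_jetIndex.2 hb⟩]
  exact jetEntry_apply _ ⟨(b, α), mem_jetIndex.2 hb⟩

/-- The closed subspace of consistent families. -/
def jetSubmodule : Submodule ℂ JetSpace where
  carrier := {h | IsJet fun b α => jetEntry b α h}
  add_mem' {h h'} H H' :=
    ⟨fun b α hb => by simpa only [map_add] using (H.mulY b α hb).add (H'.mulY b α hb),
      fun b α hb => by simpa only [map_add] using (H.partialX b α hb).add (H'.partialX b α hb)⟩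
  zero_mem' := ⟨fun b α _ => by simpa only [map_zero] using IsMulY.zero,
    fun b α _ => by simpa only [map_zero] using IsWeakPartialX.zero⟩
  smul_mem' c h H :=
    ⟨fun b α hb => by simpa only [map_smul] using (H.mulY b α hb).smul c,
      fun b α hb => by simpa only [map_smul] using (H.partialX b α hb).smul c⟩

lemma mem_jetSubmodule {h : JetSpace} :
    h ∈ jetSubmodule ↔ IsJet fun b α => jetEntry b α h := Iff.rfl

lemma isClosed_setOf_isMulY {X : Type*} [TopologicalSpace X] {f g : X → PlaneL2}
    (hf : Continuous f) (hg : Continuous g) : IsClosed {x | IsMulY (f x) (g x)} := by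
  simp only [isMulY_iff, ofPred_forall]
  refine isClosed_iInter fun φ => isClosed_iInter fun hφ => ?_
  have hψ : IsTestFun fun p : ℝ × ℝ => (p.2 : ℂ) * φ p :=
    hφ.smooth_mul (Complex.ofRealCLM.contDiff.comp contDiff_snd)
  simp only [integral_mul_eq_pairL hφ.memLp, integral_mul_eq_pairL hψ.memLp]
  exact isClosed_eq ((pairL _).continuous.comp hg) ((pairL _).continuous.comp hf)

lemma isClosed_setOf_isWeakPartialX {X : Type*} [TopologicalSpace X] {f g : X → PlaneL2}
    (hf : Continuous f) (hg : Continuous g) : IsClosed {x | IsWeakPartialX (f x) (g x)} := by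
  simp only [isWeakPartialX_iff_pairL, ofPred_forall]
  refine isClosed_iInter fun φ => isClosed_iInter fun hφ => isClosed_iInter fun hc => ?_
  exact isClosed_eq ((pairL _).continuous.comp hg) ((pairL _).continuous.comp hf).neg

/-- Multiplication by y and ∂_x are unbounded, but their graphs are closed because they are
described by pairings with fixed L² functions. -/
lemma isClosed_jetSubmodule : IsClosed (jetSubmodule : Set JetSpace) := by
  have : (jetSubmodule : Set JetSpace) =
      (⋂ b, ⋂ α, ⋂ _ : b + α < 3, {h | IsMulY (jetEntry b α h) (jetEntry b (α + 1) h)}) ∩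
      ⋂ b, ⋂ α, ⋂ _ : b + α < 3, {h | IsWeakPartialX (jetEntry b α h) (jetEntry (b + 1) α h)} := by
    ext h
    simp only [SetLike.mem_coe, mem_jetSubmodule, mem_inter_iff, mem_iInter, mem_ofPred_eq]
    exact ⟨fun H => ⟨H.1, H.2⟩, fun H => ⟨H.1, H.2⟩⟩
  rw [this]
  refine IsClosed.inter ?_ ?_
  · exact isClosed_iInter fun b => isClosed_iInter fun α => isClosed_iInter fun _ =>
      isClosed_setOf_isMulY (jetEntry b α).continuous (jetEntry b (α + 1)).continuous
  · exact isClosed_iInter fun b => isClosed_iInter fun α => isClosed_iInter fun _ =>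
      isClosed_setOf_isWeakPartialX (jetEntry b α).continuous (jetEntry (b + 1) α).continuous

lemma DampedForce.jetGen_mem (D : DampedForce δ A) {h : JetSpace} (H : h ∈ jetSubmodule) :
    D.jetGen h ∈ jetSubmodule := by
  rw [mem_jetSubmodule] at *
  exact (H.entry D).congr fun b α hb => (D.jetEntry_jetGen h hb).symm

lemma exists_hasDerivAt_clm {F : Type*} [NormedAddCommGroup F] [NormedSpace ℝ F] [CompleteSpace F]
    (T : F →L[ℝ] F) (x : F) : ∃ u : ℝ → F, u 0 = x ∧ ∀ t, HasDerivAt u (T (u t)) t := by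
  refine ⟨fun t => NormedSpace.exp (t • T) x, ?_, fun t => ?_⟩
  · simp [NormedSpace.exp_zero]
  · have h1 := hasDerivAt_exp_smul_const' (𝕂 := ℝ) T t
    have h2 := ((ContinuousLinearMap.apply ℝ F x).hasFDerivAt).comp_hasDerivAt t h1
    exact h2

/-- The exponential is taken in the closed invariant subspace, itself a Banach space, so the
evolution cannot leave it. Applied to families, this propagates the moments and derivatives. -/
lemma exists_linear_evolution {E : Type*} [NormedAddCommGroup E] [NormedSpace ℂ E] [CompleteSpace E]
    (S : Submodule ℂ E) (hS : IsClosed (S : Set E)) (L : E →L[ℂ] E) (hL : ∀ x ∈ S, L x ∈ S)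
    {x : E} (hx : x ∈ S) :
    ∃ u : ℝ → E, u 0 = x ∧ (∀ t, u t ∈ S) ∧ ∀ t, HasDerivAt u (L (u t)) t := by
  have : CompleteSpace S := hS.completeSpace_coe
  obtain ⟨u, u0, hu⟩ := exists_hasDerivAt_clm
    (((L.comp S.subtypeL).codRestrict S fun y => hL y y.2).restrictScalars ℝ) ⟨x, hx⟩
  refine ⟨fun t => u t, by simp only [u0], fun t => Subtype.mem _, fun t => ?_⟩
  exact (S.subtypeL.restrictScalars ℝ).hasFDerivAt.comp_hasDerivAt t (hu t)

/-- The sum of the squared norms of a family. -/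
noncomputable def jetEnergy (h : ℕ → ℕ → PlaneL2) : ℝ := ∑ i ∈ jetIndex, ‖h i.1 i.2‖ ^ 2

lemma jetEnergy_nonneg (h : ℕ → ℕ → PlaneL2) : 0 ≤ jetEnergy h :=
  Finset.sum_nonneg fun _ _ => by positivity

lemma norm_le_sqrt_jetEnergy (h : ℕ → ℕ → PlaneL2) {b α : ℕ} (hb : b + α ≤ 3) :
    ‖h b α‖ ≤ √(jetEnergy h) := by
  refine Real.le_sqrt_of_sq_le ?_
  have h1 : ∀ i ∈ jetIndex, 0 ≤ ‖h i.1 i.2‖ ^ 2 := fun _ _ => by positivity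
  have h2 := Finset.single_le_sum h1 (mem_jetIndex.2 hb)
  exact h2

/-- In the derivative of each squared norm the diagonal action of the generator disappears by
skew-adjointness, and only the commutator remainders stay. The resulting exponential rate does not
involve δ. -/
theorem DampedForce.exists_jet_evolution (D : DampedForce δ A) {h₀ : ℕ → ℕ → PlaneL2}
    (H₀ : IsJet h₀) :
    ∃ h : ℝ → ℕ → ℕ → PlaneL2, (∀ b α, b + α ≤ 3 → h 0 b α = h₀ b α) ∧ (∀ t, IsJet (h t)) ∧
      (∀ t, HasDerivAt (fun s => h s 0 0) (D.gen (h t 0 0)) t) ∧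
      ∀ t, 0 ≤ t → jetEnergy (h t) ≤ Real.exp (160 * (1 + A) * t) * jetEnergy h₀ := by
  set x : JetSpace := fun i => h₀ i.1.1 i.1.2 with hx
  have hx0 : ∀ b α, b + α ≤ 3 → jetEntry b α x = h₀ b α := fun b α hb =>
    jetEntry_apply x ⟨(b, α), mem_jetIndex.2 hb⟩
  have hxS : x ∈ jetSubmodule := H₀.congr fun b α hb => (hx0 b α hb).symm
  obtain ⟨u, u0, uS, uder⟩ := exists_linear_evolution jetSubmodule isClosed_jetSubmodule D.jetGen
    (fun _ H => D.jetGen_mem H) hxS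
  have hder : ∀ t b α, b + α ≤ 3 → HasDerivAt (fun s => jetEntry b α (u s))
      (D.entry (fun b α => jetEntry b α (u t)) b α) t := fun t b α hb => by
    rw [← D.jetEntry_jetGen _ hb]
    exact ((jetEntry b α).restrictScalars ℝ).hasFDerivAt.comp_hasDerivAt t (uder t)
  refine ⟨fun t b α => jetEntry b α (u t), fun b α hb => by simp only [u0]; exact hx0 b α hb, uS,
    fun t => ?_, fun t ht => ?_⟩
  · refine (hder t 0 0 (by norm_num)).congr_deriv ?_
    simp [DampedForce.entry, D.gen_apply]
  · set n : ℝ → ℝ := fun s => jetEnergy fun b α => jetEntry b α (u s) with hn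
    set R : ℝ → ℕ × ℕ → PlaneL2 := fun s i =>
      D.entry (fun b α => jetEntry b α (u s)) i.1 i.2 - D.gen (jetEntry i.1 i.2 (u s)) with hR
    have hnder : ∀ s, HasDerivAt n
        (∑ i ∈ jetIndex, 2 * (inner ℂ (jetEntry i.1 i.2 (u s)) (R s i)).re) s := by
      intro s
      refine HasDerivAt.fun_sum fun i hi => ?_
      have h1 := (hder s i.1 i.2 (mem_jetIndex.1 hi))
      have h2 := h1.inner ℂ h1
      have h3 := Complex.reCLM.hasFDerivAt.comp_hasDerivAt s h2
      refine (h3.congr_deriv ?_).congr_of_eventuallyEq (Eventually.of_forall fun r => ?_)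
      · have e : (D.entry (fun b α => jetEntry b α (u s)) i.1 i.2) =
            R s i + D.gen (jetEntry i.1 i.2 (u s)) := by simp [hR]
        have hsymm := inner_re_symm (𝕜 := ℂ) (R s i) (jetEntry i.1 i.2 (u s))
        have hsymm2 := inner_re_symm (𝕜 := ℂ) (D.gen (jetEntry i.1 i.2 (u s)))
          (jetEntry i.1 i.2 (u s))
        simp only [RCLike.re_to_complex] at hsymm hsymm2
        rw [e]
        simp only [Complex.reCLM_apply, inner_add_left, inner_add_right, Complex.add_re, hsymm,
          hsymm2, D.re_inner_gen]
        ring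
      · simp only [Function.comp, Complex.reCLM_apply]
        have := inner_self_eq_norm_sq (𝕜 := ℂ) (jetEntry i.1 i.2 (u r))
        exact this.symm
    have hbound : ∀ s, |∑ i ∈ jetIndex, 2 * (inner ℂ (jetEntry i.1 i.2 (u s)) (R s i)).re| ≤
        160 * (1 + A) * n s := by
      intro s
      have hA := D.nonneg
      have hc : ∀ b α, b + α ≤ 3 → ‖jetEntry b α (u s)‖ ≤ √(n s) := fun b α hb =>
        norm_le_sqrt_jetEnergy (fun b α => jetEntry b α (u s)) hb
      refine (Finset.abs_sum_le_sum_abs _ _).trans ?_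
      have hone : ∀ i ∈ jetIndex, |2 * (inner ℂ (jetEntry i.1 i.2 (u s)) (R s i)).re| ≤
          16 * (1 + A) * n s := by
        intro i hi
        have hi' := mem_jetIndex.1 hi
        have h1 := IsJet.norm_entry_sub_gen_le (uS s) D hc hi'
        have h2 := hc _ _ hi'
        rw [abs_mul, abs_two]
        have h3 := (Complex.abs_re_le_norm _).trans
          (norm_inner_le_norm (𝕜 := ℂ) (jetEntry i.1 i.2 (u s)) (R s i))
        have h4 : ‖jetEntry i.1 i.2 (u s)‖ * ‖R s i‖ ≤ √(n s) * (8 * (1 + A) * √(n s)) :=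
          mul_le_mul h2 h1 (norm_nonneg _) (Real.sqrt_nonneg _)
        have h5 := Real.mul_self_sqrt (jetEnergy_nonneg fun b α => jetEntry b α (u s))
        have h6 : √(n s) * (8 * (1 + A) * √(n s)) = 8 * (1 + A) * n s := by
          rw [hn]; linear_combination 8 * (1 + A) * h5
        linarith
      refine (Finset.sum_le_sum hone).trans_eq ?_
      -- Ten index pairs, each with twice the constant 8 (1 + A), give the rate 160 (1 + A).
      rw [Finset.sum_const, show jetIndex.card = 10 by decide, nsmul_eq_mul]
      push_cast
      ring
    have hg := norm_le_gronwallBound_of_norm_deriv_right_le (f := n)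
      (f' := fun s => ∑ i ∈ jetIndex, 2 * (inner ℂ (jetEntry i.1 i.2 (u s)) (R s i)).re)
      (δ := n 0) (K := 160 * (1 + A)) (ε := 0) (a := 0) (b := t)
      (fun s _ => (hnder s).continuousAt.continuousWithinAt)
      (fun s _ => (hnder s).hasDerivWithinAt)
      (by rw [Real.norm_of_nonneg (jetEnergy_nonneg _)])
      (fun s _ => by
        rw [Real.norm_eq_abs, Real.norm_of_nonneg (jetEnergy_nonneg _), add_zero]
        exact hbound s) t ⟨ht, le_rfl⟩
    rw [gronwallBound_ε0, sub_zero, Real.norm_of_nonneg (jetEnergy_nonneg _)] at hg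
    refine hg.trans_eq ?_
    rw [mul_comm]
    congr 1
    refine Finset.sum_congr rfl fun i hi => ?_
    simp only [u0]
    rw [hx0 _ _ (mem_jetIndex.1 hi)]

end Evolution

/-! ### The force damped by the sine -/

section Force

/-- `sin(δ V') / δ` and its first three derivatives. -/
noncomputable def dampedDeriv (V : ℝ → ℝ) (δ : ℝ) : ℕ → ℝ → ℝ
  | 0 => fun x => Real.sin (δ * deriv V x) / δ
  | 1 => fun x => Real.cos (δ * deriv V x) * iteratedDeriv 2 V x
  | 2 => fun x => Real.cos (δ * deriv V x) * iteratedDeriv 3 V x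
      - δ * Real.sin (δ * deriv V x) * iteratedDeriv 2 V x ^ 2
  | 3 => fun x => Real.cos (δ * deriv V x) * iteratedDeriv 4 V x
      - 3 * δ * Real.sin (δ * deriv V x) * iteratedDeriv 2 V x * iteratedDeriv 3 V x
      - δ ^ 2 * Real.cos (δ * deriv V x) * iteratedDeriv 2 V x ^ 3
  -- A filler value: orders above three never enter the estimates.
  | _ => fun _ => 0

variable {V : ℝ → ℝ} {C : ℝ}

lemma ContDiff.hasDerivAt_iteratedDeriv (hV : ContDiff ℝ 4 V) {n : ℕ} (hn : n < 4) (x : ℝ) :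
    HasDerivAt (iteratedDeriv n V) (iteratedDeriv (n + 1) V x) x := by
  rw [iteratedDeriv_succ]
  exact ((hV.differentiable_iteratedDeriv n (by exact_mod_cast hn)) x).hasDerivAt

lemma ContDiff.hasDerivAt_deriv (hV : ContDiff ℝ 4 V) (x : ℝ) :
    HasDerivAt (deriv V) (iteratedDeriv 2 V x) x := by
  have h := hV.hasDerivAt_iteratedDeriv (n := 1) (by norm_num) x
  rwa [iteratedDeriv_one] at h

lemma ContDiff.continuous_iteratedDeriv_four (hV : ContDiff ℝ 4 V) {n : ℕ} (hn : n ≤ 4) :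
    Continuous (iteratedDeriv n V) :=
  hV.continuous_iteratedDeriv n (by exact_mod_cast hn)

/-- The force `V'` cut off at size `1 / δ`. -/
noncomputable def dampedForce {δ : ℝ} (hV : ContDiff ℝ 4 V)
    (hb : ∀ n : ℕ, 2 ≤ n → n ≤ 4 → ∀ x, |iteratedDeriv n V x| ≤ C) (h0 : 0 < δ) (h1 : δ ≤ 1) :
    DampedForce δ ((1 + C) ^ 3) where
  a := dampedDeriv V δ
  pos := h0
  le_one := h1
  nonneg := by
    have : 0 ≤ C := (abs_nonneg _).trans (hb 2 le_rfl (by norm_num) 0)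
    positivity
  cont j := by
    have c1 : Continuous (deriv V) := by
      simpa using hV.continuous_iteratedDeriv_four (n := 1) (by norm_num)
    have c2 := hV.continuous_iteratedDeriv_four (n := 2) (by norm_num)
    have c3 := hV.continuous_iteratedDeriv_four (n := 3) (by norm_num)
    have c4 := hV.continuous_iteratedDeriv_four (n := 4) (by norm_num)
    match j with
    | 0 => simp only [dampedDeriv]; fun_prop
    | 1 => simp only [dampedDeriv]; fun_prop
    | 2 => simp only [dampedDeriv]; fun_prop
    | 3 => simp only [dampedDeriv]; fun_prop
    | _ + 4 => simp only [dampedDeriv]; fun_prop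
  deriv j hj x := by
    have d1 := (hV.hasDerivAt_deriv x).const_mul δ
    have d2 := hV.hasDerivAt_iteratedDeriv (n := 2) (by norm_num) x
    have d3 := hV.hasDerivAt_iteratedDeriv (n := 3) (by norm_num) x
    match j with
    | 0 =>
      refine (d1.sin.div_const δ).congr_deriv ?_
      simp only [dampedDeriv]
      field_simp
    | 1 =>
      refine (d1.cos.mul d2).congr_deriv ?_
      simp only [dampedDeriv]
      ring
    | 2 =>
      refine ((d1.cos.mul d3).sub ((d1.sin.const_mul δ).mul (d2.pow 2))).congr_deriv ?_
      simp only [dampedDeriv, Pi.pow_apply]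
      push_cast
      ring
    | n + 3 => omega
  bound_zero x := by
    simp only [dampedDeriv]
    rw [abs_div, abs_of_pos h0]
    exact div_le_div_of_nonneg_right (Real.abs_sin_le_one _) h0.le
  -- As δ ≤ 1, the three expressions are at most C, C + C² and C + 3C² + C³, all below (1 + C)³.
  bound j hj x := by
    have b2 := hb 2 le_rfl (by norm_num) x
    have b3 := hb 3 (by norm_num) (by norm_num) x
    have b4 := hb 4 (by norm_num) le_rfl x
    have hC : 0 ≤ C := (abs_nonneg _).trans b2
    have hc := Real.abs_cos_le_one (δ * deriv V x)
    have hs := Real.abs_sin_le_one (δ * deriv V x)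
    have hd : |δ| ≤ 1 := by rwa [abs_of_pos h0]
    have k1 : |iteratedDeriv 2 V x| ^ 2 ≤ C ^ 2 := pow_le_pow_left₀ (abs_nonneg _) b2 2
    have k2 : |iteratedDeriv 2 V x| ^ 3 ≤ C ^ 3 := pow_le_pow_left₀ (abs_nonneg _) b2 3
    have k3 : |δ| ^ 2 ≤ 1 := pow_le_one₀ (abs_nonneg _) hd
    match j with
    | 0 => omega
    | 1 =>
      simp only [dampedDeriv]
      rw [abs_mul]
      have := mul_le_mul hc b2 (abs_nonneg _) zero_le_one
      nlinarith [pow_nonneg hC 2, pow_nonneg hC 3]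
    | 2 =>
      simp only [dampedDeriv]
      have e1 := mul_le_mul hc b3 (abs_nonneg _) zero_le_one
      have e2 := mul_le_mul (mul_le_mul hd hs (abs_nonneg _) zero_le_one) k1 (by positivity)
        (by norm_num)
      refine (abs_sub _ _).trans ?_
      simp only [abs_mul, abs_pow] at *
      nlinarith [pow_nonneg hC 2, pow_nonneg hC 3]
    | 3 =>
      simp only [dampedDeriv]
      have e1 := mul_le_mul hc b4 (abs_nonneg _) zero_le_one
      have e2 := mul_le_mul (mul_le_mul (mul_le_mul hd hs (abs_nonneg _) zero_le_one) b2
        (abs_nonneg _) (by norm_num)) b3 (abs_nonneg _) (by positivity)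
      have e3 := mul_le_mul (mul_le_mul k3 hc (abs_nonneg _) zero_le_one) k2 (by positivity)
        (by norm_num)
      refine (abs_sub _ _).trans ((add_le_add_left (abs_sub _ _) _).trans ?_)
      simp only [abs_mul, abs_pow] at *
      rw [abs_of_nonneg (by norm_num : (0 : ℝ) ≤ 3)]
      nlinarith [pow_nonneg hC 2, pow_nonneg hC 3]
    | _ + 4 =>
      simp only [dampedDeriv, abs_zero]
      positivity

end Force

/-! ### Consistent families from the regularity of the initial datum -/

section InitialJet

lemma mollify_comm (ρ f : ℝ × ℝ → ℂ) : mollify ρ f = mollify f ρ := by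
  funext p
  rw [mollify, mollify, ← integral_sub_left_eq_self _ volume p]
  simp only [sub_sub_cancel, mul_comm]

lemma norm_mollify_mollifier_sub_le {ε η : ℝ} (hε : 0 < ε) {g : ℝ × ℝ → ℂ} (hg : Continuous g)
    (p : ℝ × ℝ) (h : ∀ q, ‖q - p‖ < 2 * ε → ‖g q - g p‖ ≤ η) :
    ‖mollify g (mollifier ε) p - g p‖ ≤ η := by
  have e : mollify g (mollifier ε) p =
      convolution ((planeBump ε hε).normed volume) g (ContinuousLinearMap.lsmul ℝ ℝ) volume p := by
    refine integral_congr_ae (Eventually.of_forall fun q => ?_)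
    simp [mollifier_eq_normed ε hε]
  rw [e, ← dist_eq_norm]
  refine ContDiffBump.dist_normed_convolution_le hg.aestronglyMeasurable fun q hq => ?_
  rw [dist_eq_norm]
  exact h q (by rwa [Metric.mem_ball, dist_eq_norm] at hq)

/-- The points at distance at most `2` from the support. -/
def fatSupport (g : ℝ × ℝ → ℂ) : Set (ℝ × ℝ) :=
  (fun z : (ℝ × ℝ) × (ℝ × ℝ) => z.1 + z.2) '' (tsupport g ×ˢ Metric.closedBall 0 2)

lemma isCompact_fatSupport {g : ℝ × ℝ → ℂ} (hc : HasCompactSupport g) :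
    IsCompact (fatSupport g) :=
  (hc.isCompact.prod (isCompact_closedBall 0 2)).image (by fun_prop)

lemma add_notMem_tsupport {g : ℝ × ℝ → ℂ} {p a : ℝ × ℝ} (hp : p ∉ fatSupport g) (ha : ‖a‖ ≤ 2) :
    p + a ∉ tsupport g := fun h =>
  hp ⟨(p + a, -a), ⟨h, by simpa using ha⟩, by simp⟩

lemma notMem_tsupport_of_notMem_fatSupport {g : ℝ × ℝ → ℂ} {p : ℝ × ℝ} (hp : p ∉ fatSupport g) :
    p ∉ tsupport g := by
  simpa using add_notMem_tsupport (a := 0) hp (by simp)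

lemma eventually_norm_mollify_sub_le {g : ℝ × ℝ → ℂ} (hg : Continuous g) (hc : HasCompactSupport g)
    (hm : ∀ ε : ℝ, 0 < ε → MemLp (fun p => mollify g (mollifier ε) p - g p) 2 volume)
    {η : ℝ} (hη : 0 < η) :
    ∃ r > 0, ∀ ε : ℝ, ∀ hε : 0 < ε, ε < r → ‖(hm ε hε).toLp‖ ≤ η := by
  set c : ℝ := (volume (fatSupport g)).toReal ^ (1 / 2 : ℝ) with hcdef
  have hc0 : 0 ≤ c := by positivity
  obtain ⟨r, hr, hu⟩ := Metric.uniformContinuous_iff.1 (hc.uniformContinuous_of_continuous hg)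
    (η / (c + 1)) (by positivity)
  -- The mollifier at scale ε has radius 2ε: below r for uniform continuity, below 2 to stay in
  -- `fatSupport`.
  refine ⟨min (r / 2) 1, by positivity, fun ε hε hεr => ?_⟩
  have h1 : ε < r / 2 := hεr.trans_le (min_le_left _ _)
  have h2 : ε < 1 := hεr.trans_le (min_le_right _ _)
  refine (norm_toLp_le_of_bounded_on (hm ε hε) (isCompact_fatSupport hc)
    (c := η / (c + 1)) (by positivity) (fun p => ?_) fun p hp => ?_).trans ?_
  · refine norm_mollify_mollifier_sub_le hε hg p fun q hq => ?_
    rw [← dist_eq_norm]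
    refine (hu ?_).le
    rw [dist_eq_norm]
    linarith
  · refine norm_le_zero_iff.1 (norm_mollify_mollifier_sub_le hε hg p fun q hq => ?_)
    have h3 := add_notMem_tsupport (a := q - p) hp (by linarith)
    rw [add_sub_cancel] at h3
    rw [image_eq_zero_of_notMem_tsupport h3,
      image_eq_zero_of_notMem_tsupport (notMem_tsupport_of_notMem_fatSupport hp)]
    simp
  · rw [← hcdef, div_mul_eq_mul_div, div_le_iff₀ (by positivity)]
    nlinarith

lemma isTestFun_mollify {ε : ℝ} (hε : 0 < ε) {g : ℝ × ℝ → ℂ} (hg : Continuous g)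
    (hc : HasCompactSupport g) : IsTestFun (mollify g (mollifier ε)) := by
  have hρ := isTestFun_mollifier hε
  refine ⟨?_, ?_⟩
  · rw [mollify_comm]
    exact contDiff_mollify (n := ⊤) hρ.1 hρ.2 hg.locallyIntegrable
  · exact HasCompactSupport.convolution (ContinuousLinearMap.mul ℝ ℂ) hρ.2 hc

/-- Mollifying a C¹ test function gives smooth ones which converge in L² together with their
x-derivatives, so smooth testing suffices. -/
lemma isWeakPartialX_of_testFun {u v : PlaneL2}
    (h : ∀ φ : ℝ × ℝ → ℂ, IsTestFun φ → ∫ p, v p * φ p = -∫ p, u p * partialX φ p) :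
    IsWeakPartialX u v := by
  intro φ hφ hc
  have hd : Continuous (partialX φ) := (contDiff_partialX (m := 0) hφ (by norm_num)).continuous
  have hdc := hasCompactSupport_partialX (hφ.differentiable one_ne_zero) hc
  have hm1 : ∀ ε : ℝ, 0 < ε → MemLp (fun p => mollify φ (mollifier ε) p - φ p) 2 volume :=
    fun ε hε => (isTestFun_mollify hε hφ.continuous hc).memLp.sub (memLp_of_cc hφ.continuous hc)
  have hm2 : ∀ ε : ℝ, 0 < ε →
      MemLp (fun p => mollify (partialX φ) (mollifier ε) p - partialX φ p) 2 volume :=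
    fun ε hε => (isTestFun_mollify hε hd hdc).memLp.sub (memLp_of_cc hd hdc)
  have e : ∀ (w : PlaneL2) {a b : ℝ × ℝ → ℂ} (_ : MemLp a 2 volume) (_ : MemLp b 2 volume)
      (hab : MemLp (fun p => a p - b p) 2 volume),
      (∫ p, w p * a p) - ∫ p, w p * b p = pairL hab.toLp w := by
    intro w a b ha hb hab
    rw [← integral_mul_eq_pairL hab, ← integral_sub (integrable_mul_of_memLp ha w)
      (integrable_mul_of_memLp hb w)]
    simp only [mul_sub]
  rw [← sub_eq_zero, sub_neg_eq_add, ← norm_le_zero_iff]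
  refine le_of_forall_pos_le_add fun η hη => ?_
  have hη' : 0 < η / (‖u‖ + ‖v‖ + 1) := by positivity
  obtain ⟨r₁, hr₁, H₁⟩ := eventually_norm_mollify_sub_le hφ.continuous hc hm1 hη'
  obtain ⟨r₂, hr₂, H₂⟩ := eventually_norm_mollify_sub_le hd hdc hm2 hη'
  set ε := min r₁ r₂ / 2 with hεdef
  have hmin : 0 < min r₁ r₂ := lt_min hr₁ hr₂
  have hε : 0 < ε := by positivity
  have hε1 : ε < r₁ := (half_lt_self hmin).trans_le (min_le_left _ _)
  have hε2 : ε < r₂ := (half_lt_self hmin).trans_le (min_le_right _ _)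
  have ht := h _ (isTestFun_mollify hε hφ.continuous hc)
  rw [partialX_mollify hφ hc (isTestFun_mollifier hε).continuous.locallyIntegrable] at ht
  have e1 := e v (isTestFun_mollify hε hφ.continuous hc).memLp (memLp_of_cc hφ.continuous hc)
    (hm1 ε hε)
  have e2 := e u (isTestFun_mollify hε hd hdc).memLp (memLp_of_cc hd hdc) (hm2 ε hε)
  have key : (∫ p, v p * φ p) + ∫ p, u p * partialX φ p =
      -pairL (hm1 ε hε).toLp v - pairL (hm2 ε hε).toLp u := by
    rw [← e1, ← e2, ht]; ring
  have hfin : η / (‖u‖ + ‖v‖ + 1) * (‖u‖ + ‖v‖ + 1) = η := by field_simp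
  rw [key, zero_add]
  refine (norm_sub_le _ _).trans ?_
  rw [norm_neg]
  have b1 := (norm_pairL_le (hm1 ε hε).toLp v).trans
    (mul_le_mul_of_nonneg_right (H₁ ε hε hε1) (norm_nonneg v))
  have b2 := (norm_pairL_le (hm2 ε hε).toLp u).trans
    (mul_le_mul_of_nonneg_right (H₂ ε hε hε2) (norm_nonneg u))
  nlinarith

lemma iterate_partialX_snd_mul {φ : ℝ × ℝ → ℂ} (hφ : IsTestFun φ) (b : ℕ) :
    partialX^[b] (fun p : ℝ × ℝ => (p.2 : ℂ) * φ p) = fun p => (p.2 : ℂ) * partialX^[b] φ p := by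
  induction b generalizing φ with
  | zero => rfl
  | succ b ih =>
    rw [Function.iterate_succ_apply, Function.iterate_succ_apply, ← ih hφ.partialX]
    congr 1
    funext p
    exact ((hasDerivAt_partialX hφ.differentiable p.1 p.2).const_mul (p.2 : ℂ)).deriv

/-- Each y^α ∂_x^b f is given separately as a distribution. Testing against y φ or ∂_x φ links
neighbouring orders. -/
lemma exists_isJet {f : PlaneL2} {c : ℝ}
    (h : ∀ a b α β : ℕ, a + b + α + β ≤ 3 → WeightedDerivNormLT a b α β f c) :
    ∃ h₀ : ℕ → ℕ → PlaneL2, IsJet h₀ ∧ h₀ 0 0 = f ∧ ∀ b α, b + α ≤ 3 → ‖h₀ b α‖ < c := by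
  have h' : ∀ b α : ℕ, ∃ g : PlaneL2, b + α ≤ 3 → ‖g‖ < c ∧ ∀ φ : ℝ × ℝ → ℂ, IsTestFun φ →
      ∫ p, g p * φ p = (-1 : ℂ) ^ b * ∫ p, f p * ((p.2 : ℂ) ^ α * partialX^[b] φ p) := by
    intro b α
    by_cases hb : b + α ≤ 3
    · obtain ⟨g, hg, hgc⟩ := h 0 b α 0 (by omega)
      refine ⟨g, fun _ => ⟨hgc, fun φ hφ => ?_⟩⟩
      have := hg φ hφ
      simpa only [pow_zero, one_mul, add_zero, Function.iterate_zero, id_eq] using this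
    · exact ⟨0, fun h => absurd h hb⟩
  choose h₀ hh using h'
  refine ⟨h₀, ⟨fun b α hb => isMulY_of_pairing fun φ hφ => ?_,
    fun b α hb => isWeakPartialX_of_testFun fun φ hφ => ?_⟩, eq_of_pairing_eq fun φ hφ => ?_,
    fun b α hb => (hh b α hb).1⟩
  · have hψ : IsTestFun fun p : ℝ × ℝ => (p.2 : ℂ) * φ p :=
      hφ.smooth_mul (Complex.ofRealCLM.contDiff.comp contDiff_snd)
    rw [(hh b (α + 1) (by omega)).2 φ hφ, (hh b α (by omega)).2 _ hψ,
      iterate_partialX_snd_mul hφ]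
    simp only [pow_succ, mul_assoc]
  · rw [(hh (b + 1) α (by omega)).2 φ hφ, (hh b α (by omega)).2 _ hφ.partialX,
      pow_succ, mul_neg_one, neg_mul]
    rfl
  · rw [(hh 0 0 (by omega)).2 φ hφ]
    simp

end InitialJet

/-! ### Transposition for the bilinear pairing -/

section Transpose

variable {δ A : ℝ}

lemma pairL_shiftOp (a : ℝ × ℝ) (ψ f : PlaneL2) :
    pairL ψ (shiftOp a f) = pairL (shiftOp (-a) ψ) f := by
  rw [pairL_apply, integral_shiftOp_mul, pairL_apply]
  refine integral_congr_ae ?_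
  filter_upwards [coeFn_shiftOp (-a) ψ] with p h
  rw [h]

lemma pairL_mulOp (m : BoundedContinuousFunction (ℝ × ℝ) ℝ) (ψ f : PlaneL2) :
    pairL ψ (mulOp m f) = pairL (mulOp m ψ) f := by
  rw [pairL_apply, integral_mulOp_mul, pairL_apply]
  refine integral_congr_ae ?_
  filter_upwards [coeFn_mulOp m ψ] with p h
  rw [h]

lemma pairL_smul_left (c : ℂ) (ψ f : PlaneL2) : pairL (c • ψ) f = c * pairL ψ f := by
  rw [pairL_comm, map_smul, pairL_comm, smul_eq_mul]

lemma pairL_diffX (ψ f : PlaneL2) : pairL ψ (diffX δ f) = -pairL (diffX δ ψ) f := by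
  rw [diffX_apply, diffX_apply, map_smul, map_sub, pairL_shiftOp, pairL_shiftOp, pairL_smul_left,
    pairL_sub_left, smul_eq_mul, Prod.neg_mk, Prod.neg_mk, neg_neg, neg_zero]
  ring

lemma pairL_diffY (ψ f : PlaneL2) : pairL ψ (diffY δ 0 f) = -pairL (diffY δ 0 ψ) f := by
  simp only [diffY_apply, pow_zero, one_smul]
  rw [map_smul, map_sub, pairL_shiftOp, pairL_shiftOp, pairL_smul_left,
    pairL_sub_left, smul_eq_mul, Prod.neg_mk, Prod.neg_mk, neg_neg, neg_zero]
  ring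

/-- Each of the two differences changes sign under transposition and the multiplication does not, so
the generator is its own transpose. -/
lemma DampedForce.pairL_gen (D : DampedForce δ A) (ψ f : PlaneL2) :
    pairL ψ (D.gen f) = pairL (D.gen ψ) f := by
  rw [D.gen_apply, D.gen_apply, map_smul, map_sub, pairL_smul_left, pairL_sub_left, pairL_mulOp,
    pairL_diffY, pairL_diffX, neg_neg, diffX_diffY, smul_eq_mul]

end Transpose

/-! ### Convergence of the approximate generators on test functions -/

section Consistency

/-- Uniform continuity of the derivative makes the quotient converge uniformly, by the mean value
inequality for φ(p + s e) - s φ'(p), and all supports lie in one compact set. -/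
lemma tendsto_centralDiff {φ φ' : ℝ × ℝ → ℂ} (hφ : Continuous φ) (hc : HasCompactSupport φ)
    (hφ' : Continuous φ') (hc' : HasCompactSupport φ') (h0 : ∀ p ∉ tsupport φ, φ' p = 0)
    {e : ℝ × ℝ} (he : ‖e‖ ≤ 1)
    (hd : ∀ (p : ℝ × ℝ) (s : ℝ), HasDerivAt (fun s : ℝ => φ (p + s • e)) (φ' (p + s • e)) s)
    {δ : ℕ → ℝ} (hδ : ∀ n, 0 < δ n) (hδ0 : Tendsto δ atTop (𝓝 0)) :
    Tendsto (fun n => (1 / (2 * δ n) : ℂ) • (shiftOp (δ n • e) (memLp_of_cc hφ hc).toLp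
      - shiftOp (-(δ n • e)) (memLp_of_cc hφ hc).toLp)) atTop
      (𝓝 (memLp_of_cc hφ' hc').toLp) := by
  set c : ℝ := (volume (fatSupport φ)).toReal ^ (1 / 2 : ℝ) with hcdef
  have hc0 : 0 ≤ c := by positivity
  rw [Metric.tendsto_atTop]
  intro η hη
  obtain ⟨r, hr, hu⟩ := Metric.uniformContinuous_iff.1 (hc'.uniformContinuous_of_continuous hφ')
    (η / (c + 1)) (by positivity)
  obtain ⟨N, hN⟩ := Metric.tendsto_atTop.1 hδ0 (min r 2) (by positivity)
  refine ⟨N, fun n hn => ?_⟩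
  have hd0 := hδ n
  have hdn := hN n hn
  rw [Real.dist_0_eq_abs, abs_of_pos hd0] at hdn
  have hdr : δ n < r := hdn.trans_le (min_le_left _ _)
  have hd2 : δ n < 2 := hdn.trans_le (min_le_right _ _)
  generalize δ n = d at *
  have hne : ‖d • e‖ ≤ d := by
    rw [norm_smul, Real.norm_of_nonneg hd0.le]
    exact mul_le_of_le_one_right hd0.le he
  set g : ℝ × ℝ → ℂ := fun p =>
    (1 / (2 * d) : ℂ) * (φ (p + d • e) - φ (p + -(d • e))) - φ' p with hg
  have hgm : MemLp g 2 volume := by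
    have m1 : MemLp (fun p => φ (p + d • e)) 2 volume := memLp_of_cc (hφ.comp (by fun_prop))
      (hc.comp_homeomorph (Homeomorph.addRight (d • e)))
    have m2 : MemLp (fun p => φ (p + -(d • e))) 2 volume := memLp_of_cc (hφ.comp (by fun_prop))
      (hc.comp_homeomorph (Homeomorph.addRight (-(d • e))))
    exact ((m1.sub m2).const_mul _).sub (memLp_of_cc hφ' hc')
  have e1 : (1 / (2 * d) : ℂ) • (shiftOp (d • e) (memLp_of_cc hφ hc).toLp
      - shiftOp (-(d • e)) (memLp_of_cc hφ hc).toLp) - (memLp_of_cc hφ' hc').toLp = hgm.toLp := by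
    set Φ := (memLp_of_cc hφ hc).toLp
    refine Lp.ext ?_
    filter_upwards [hgm.coeFn_toLp, (memLp_of_cc hφ' hc').coeFn_toLp,
      ae_comp_add (memLp_of_cc hφ hc).coeFn_toLp (d • e),
      ae_comp_add (memLp_of_cc hφ hc).coeFn_toLp (-(d • e)),
      coeFn_shiftOp (d • e) Φ, coeFn_shiftOp (-(d • e)) Φ,
      Lp.coeFn_sub ((1 / (2 * d) : ℂ) • (shiftOp (d • e) Φ - shiftOp (-(d • e)) Φ))
        (memLp_of_cc hφ' hc').toLp,
      Lp.coeFn_smul (1 / (2 * d) : ℂ) (shiftOp (d • e) Φ - shiftOp (-(d • e)) Φ),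
      Lp.coeFn_sub (shiftOp (d • e) Φ) (shiftOp (-(d • e)) Φ)]
      with p h1 h2 h3 h4 h5 h6 h7 h8 h9
    rw [h1, h7, Pi.sub_apply, h8, Pi.smul_apply, h9, Pi.sub_apply, h5, h6, h3, h4, h2, smul_eq_mul]
  rw [dist_eq_norm, e1]
  have hbd : ∀ p, ‖g p‖ ≤ η / (c + 1) := by
    intro p
    have hder : ∀ s ∈ Icc (-d) d, HasDerivWithinAt (fun s : ℝ => φ (p + s • e) - s • φ' p)
        (φ' (p + s • e) - φ' p) (Icc (-d) d) s := fun s _ => by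
      have := (hd p s).sub ((hasDerivAt_id s).smul_const (φ' p))
      rw [one_smul] at this
      exact this.hasDerivWithinAt
    have hb : ∀ s ∈ Icc (-d) d, ‖φ' (p + s • e) - φ' p‖ ≤ η / (c + 1) := by
      intro s hs
      rw [← dist_eq_norm]
      refine (hu ?_).le
      rw [dist_eq_norm, add_sub_cancel_left, norm_smul]
      have : ‖s‖ ≤ d := abs_le.2 hs
      nlinarith [norm_nonneg e, norm_nonneg s]
    have hm := (convex_Icc (-d) d).norm_image_sub_le_of_norm_hasDerivWithin_le hder hb
      (left_mem_Icc.2 (by linarith)) (right_mem_Icc.2 (by linarith))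
    have e2 : g p = (1 / (2 * d) : ℂ) *
        (φ (p + d • e) - d • φ' p - (φ (p + (-d) • e) - (-d) • φ' p)) := by
      have : (d : ℂ) ≠ 0 := by exact_mod_cast hd0.ne'
      simp only [hg, neg_smul, Complex.real_smul]
      field_simp
      ring
    rw [e2, norm_mul, norm_div, norm_mul, Complex.norm_real, Real.norm_of_nonneg hd0.le, norm_one,
      Complex.norm_ofNat, div_mul_eq_mul_div, one_mul, div_le_iff₀ (by positivity)]
    refine hm.trans_eq ?_
    rw [sub_neg_eq_add, Real.norm_of_nonneg (by positivity)]
    ring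
  refine (norm_toLp_le_of_bounded_on hgm (isCompact_fatSupport hc) (by positivity) hbd
    fun p hp => ?_).trans_lt ?_
  · simp only [hg]
    rw [image_eq_zero_of_notMem_tsupport (add_notMem_tsupport hp (hne.trans hd2.le)),
      image_eq_zero_of_notMem_tsupport (add_notMem_tsupport (a := -(d • e)) hp
        (by rw [norm_neg]; exact hne.trans hd2.le)),
      h0 p (notMem_tsupport_of_notMem_fatSupport hp)]
    simp
  · rw [← hcdef, div_mul_eq_mul_div, div_lt_iff₀ (by positivity)]
    nlinarith

variable {φ : ℝ × ℝ → ℂ} {δ : ℕ → ℝ}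

lemma tendsto_diffX (hφ : IsTestFun φ) (hδ : ∀ n, 0 < δ n) (hδ0 : Tendsto δ atTop (𝓝 0)) :
    Tendsto (fun n => diffX (δ n) hφ.memLp.toLp) atTop (𝓝 hφ.partialX.memLp.toLp) := by
  have := tendsto_centralDiff hφ.continuous hφ.2 hφ.partialX.continuous hφ.partialX.2
    (fun p hp => partialX_eq_zero_of_notMem_tsupport hφ.differentiable hp) (e := (1, 0))
    (by simp [Prod.norm_def]) (fun p s => by
      have h := (hasDerivAt_partialX hφ.differentiable (p.1 + s) p.2).comp_const_add p.1 s
      have e : ∀ s : ℝ, p + s • ((1 : ℝ), (0 : ℝ)) = (p.1 + s, p.2) := fun s => by ext <;> simp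
      simpa only [e] using h) hδ hδ0
  simpa [diffX_apply] using this

lemma tendsto_diffY (hφ : IsTestFun φ) (hδ : ∀ n, 0 < δ n) (hδ0 : Tendsto δ atTop (𝓝 0)) :
    Tendsto (fun n => diffY (δ n) 0 hφ.memLp.toLp) atTop (𝓝 hφ.partialY.memLp.toLp) := by
  have := tendsto_centralDiff hφ.continuous hφ.2 hφ.partialY.continuous hφ.partialY.2
    (fun p hp => partialY_eq_zero_of_notMem_tsupport hφ.differentiable hp) (e := (0, 1))
    (by simp [Prod.norm_def]) (fun p s => by
      have h := (hasDerivAt_partialY hφ.differentiable p.1 (p.2 + s)).comp_const_add p.2 s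
      have e : ∀ s : ℝ, p + s • ((0 : ℝ), (1 : ℝ)) = (p.1, p.2 + s) := fun s => by ext <;> simp
      simpa only [e] using h) hδ hδ0
  simpa [diffY_apply] using this

lemma IsTestFun.isWeakPartialX (hφ : IsTestFun φ) :
    IsWeakPartialX hφ.memLp.toLp hφ.partialX.memLp.toLp := by
  intro ψ hψ hc
  have e1 : ∫ p, (hφ.partialX.memLp.toLp : ℝ × ℝ → ℂ) p * ψ p = ∫ p, _root_.partialX φ p * ψ p := by
    refine integral_congr_ae ?_
    filter_upwards [hφ.partialX.memLp.coeFn_toLp] with p h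
    rw [h]
  have e2 : ∫ p, (hφ.memLp.toLp : ℝ × ℝ → ℂ) p * _root_.partialX ψ p = ∫ p, φ p * _root_.partialX ψ p := by
    refine integral_congr_ae ?_
    filter_upwards [hφ.memLp.coeFn_toLp] with p h
    rw [h]
  rw [e1, e2, integral_mul_partialX (hφ.contDiff_nat 1) hψ hc, neg_neg]

/-- The x-difference is not uniformly bounded on L², but it is dominated by ∂_x. Hence the error of
the y-difference is measured on ∂_x φ, where it tends to zero. -/
lemma tendsto_diffY_diffX (hφ : IsTestFun φ) (hδ : ∀ n, 0 < δ n) (hδ0 : Tendsto δ atTop (𝓝 0)) :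
    Tendsto (fun n => diffY (δ n) 0 (diffX (δ n) hφ.memLp.toLp)) atTop
      (𝓝 hφ.partialY.partialX.memLp.toLp) := by
  have hcomm : hφ.partialY.partialX.memLp.toLp = hφ.partialX.partialY.memLp.toLp := by
    congr 1
    funext p
    exact partialX_partialY_comm (hφ.contDiff_nat 2) p
  have e : ∀ n, diffY (δ n) 0 (diffX (δ n) hφ.memLp.toLp) =
      diffX (δ n) (diffY (δ n) 0 hφ.memLp.toLp - hφ.partialY.memLp.toLp)
        + diffX (δ n) hφ.partialY.memLp.toLp := fun n => by
    rw [map_sub, sub_add_cancel, diffX_diffY]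
  simp only [e]
  rw [← zero_add hφ.partialY.partialX.memLp.toLp]
  refine Tendsto.add ?_ (tendsto_diffX hφ.partialY hδ hδ0)
  have h1 := tendsto_diffY hφ.partialX hδ hδ0
  rw [← hcomm, tendsto_iff_norm_sub_tendsto_zero] at h1
  refine squeeze_zero_norm (fun n => ?_) h1
  exact ((hφ.isWeakPartialX.diffY 0).sub hφ.partialY.isWeakPartialX).norm_diffX_le (hδ n)

lemma abs_sin_sub_self_le (x : ℝ) : |Real.sin x - x| ≤ 2 * x ^ 2 := by
  rcases le_or_gt |x| 1 with h | h
  · have h1 := Real.sin_bound h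
    have h2 : |Real.sin x - x| ≤ |Real.sin x - (x - x ^ 3 / 6)| + |x ^ 3 / 6| := by
      have := abs_sub (Real.sin x - (x - x ^ 3 / 6)) (x ^ 3 / 6)
      have e : Real.sin x - (x - x ^ 3 / 6) - x ^ 3 / 6 = Real.sin x - x := by ring
      rwa [e] at this
    have h3 : |x ^ 3 / 6| = |x| ^ 3 / 6 := by rw [abs_div, abs_pow]; norm_num
    have h4 : |x| ^ 3 ≤ |x| ^ 2 := pow_le_pow_of_le_one (abs_nonneg _) h (by norm_num)
    have h5 : |x| ^ 5 ≤ |x| ^ 2 := pow_le_pow_of_le_one (abs_nonneg _) h (by norm_num)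
    rw [sq_abs] at h4 h5
    nlinarith [sq_nonneg x]
  · have h1 := abs_sub (Real.sin x) x
    have h2 := Real.abs_sin_le_one x
    have h3 : |x| * 1 ≤ |x| * |x| := mul_le_mul_of_nonneg_left h.le (abs_nonneg x)
    rw [abs_mul_abs_self] at h3
    nlinarith

lemma abs_sin_div_sub_le {d : ℝ} (hd : 0 < d) (x : ℝ) :
    |Real.sin (d * x) / d - x| ≤ d * (2 * x ^ 2) := by
  have e : Real.sin (d * x) / d - x = (Real.sin (d * x) - d * x) / d := by field_simp
  rw [e, abs_div, abs_of_pos hd, div_le_iff₀ hd]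
  refine (abs_sin_sub_self_le _).trans_eq ?_
  ring

/-- From |sin(δ x)/δ - x| ≤ 2 δ x² in each factor, the symbol differs from V' y by δ times a
continuous function, which is bounded on the support of φ. -/
lemma tendsto_mulOp_symbol {V : ℝ → ℝ} {A : ℝ} {D : ∀ n, DampedForce (δ n) A} (hφ : IsTestFun φ)
    (hV : Continuous (deriv V)) (hD : ∀ n x, (D n).a 0 x = Real.sin (δ n * deriv V x) / δ n)
    (hδ0 : Tendsto δ atTop (𝓝 0))
    (hm : MemLp (fun p => (limitPotential V p : ℂ) * φ p) 2 volume) :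
    Tendsto (fun n => mulOp ((D n).symbol 0) hφ.memLp.toLp) atTop (𝓝 hm.toLp) := by
  have hδ n := (D n).pos
  set B : ℝ × ℝ → ℂ := fun p =>
    ((2 * (|deriv V p.1| * p.2 ^ 2 + deriv V p.1 ^ 2 * |p.2|) : ℝ) : ℂ) * φ p with hB
  have hBc : Continuous B := by
    have := hφ.continuous
    refine Continuous.mul (Complex.continuous_ofReal.comp ?_) hφ.continuous
    fun_prop
  obtain ⟨b, hb⟩ := hBc.bounded_above_of_compact_support (hφ.2.mul_left)
  have hb0 : 0 ≤ b := (norm_nonneg _).trans (hb 0)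
  set c : ℝ := (volume (tsupport φ)).toReal ^ (1 / 2 : ℝ)
  rw [tendsto_iff_norm_sub_tendsto_zero]
  refine squeeze_zero (g := fun n => δ n * b * c) (fun _ => norm_nonneg _) (fun n => ?_)
    (by simpa using (hδ0.mul_const b).mul_const c)
  set g : ℝ × ℝ → ℂ := fun p => ((D n).symbol 0 p : ℂ) * φ p - limitPotential V p * φ p with hg
  have hgm : MemLp g 2 volume :=
    (memLp_of_cc ((Complex.continuous_ofReal.comp ((D n).symbol 0).continuous).mul hφ.continuous)
      hφ.2.mul_left).sub hm
  have e1 : mulOp ((D n).symbol 0) hφ.memLp.toLp - hm.toLp = hgm.toLp := by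
    refine Lp.ext ?_
    filter_upwards [hgm.coeFn_toLp, hm.coeFn_toLp, hφ.memLp.coeFn_toLp,
      coeFn_mulOp ((D n).symbol 0) hφ.memLp.toLp,
      Lp.coeFn_sub (mulOp ((D n).symbol 0) hφ.memLp.toLp) hm.toLp] with p h1 h2 h3 h4 h5
    rw [h1, h5, Pi.sub_apply, h2, h4, h3]
  rw [e1]
  refine norm_toLp_le_of_bounded_on hgm hφ.2.isCompact (by have := (hδ n).le; positivity)
    (fun p => ?_) fun p hp => ?_
  · have hBp := hb p
    have e2 : g p = (((D n).symbol 0 p - limitPotential V p : ℝ) : ℂ) * φ p := by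
      simp only [hg]; push_cast; ring
    rw [e2, norm_mul, Complex.norm_real, Real.norm_eq_abs]
    simp only [hB] at hBp
    rw [norm_mul, Complex.norm_real, Real.norm_of_nonneg (by positivity)] at hBp
    refine le_trans ?_ (mul_le_mul_of_nonneg_left hBp (hδ n).le)
    rw [← mul_assoc]
    refine mul_le_mul_of_nonneg_right ?_ (norm_nonneg _)
    rw [(D n).symbol_apply, hD, limitPotential]
    have e3 : Real.sin (δ n * deriv V p.1) / δ n * (Real.sin (δ n * p.2) / δ n) - deriv V p.1 * p.2
        = Real.sin (δ n * deriv V p.1) / δ n * (Real.sin (δ n * p.2) / δ n - p.2)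
          + (Real.sin (δ n * deriv V p.1) / δ n - deriv V p.1) * p.2 := by ring
    rw [e3]
    refine (abs_add_le _ _).trans ?_
    rw [abs_mul, abs_mul]
    have k1 := mul_le_mul (abs_sin_div_le (hδ n) (deriv V p.1)) (abs_sin_div_sub_le (hδ n) p.2)
      (abs_nonneg _) (abs_nonneg _)
    have k2 := mul_le_mul_of_nonneg_right (abs_sin_div_sub_le (hδ n) (deriv V p.1))
      (abs_nonneg p.2)
    linarith
  · simp [hg, image_eq_zero_of_notMem_tsupport hp]

lemma memLp_generator {W : ℝ × ℝ → ℝ} (hW : Continuous W) (hφ : IsTestFun φ) :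
    MemLp (fun p => Complex.I * partialX (partialY φ) p - Complex.I * (W p : ℂ) * φ p) 2 volume := by
  have h1 := hφ.partialY.partialX.continuous
  have h2 := hφ.continuous
  exact (memLp_of_cc (continuous_const.mul h1) hφ.partialY.partialX.2.mul_left).sub
    (memLp_of_cc (by fun_prop) hφ.2.mul_left)

lemma continuous_limitPotential {V : ℝ → ℝ} (hV : Continuous (deriv V)) :
    Continuous (limitPotential V) := by
  unfold limitPotential; fun_prop

lemma tendsto_gen {V : ℝ → ℝ} {A : ℝ} {D : ∀ n, DampedForce (δ n) A} (hφ : IsTestFun φ)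
    (hV : Continuous (deriv V)) (hD : ∀ n x, (D n).a 0 x = Real.sin (δ n * deriv V x) / δ n)
    (hδ0 : Tendsto δ atTop (𝓝 0)) :
    Tendsto (fun n => (D n).gen hφ.memLp.toLp) atTop
      (𝓝 (memLp_generator (continuous_limitPotential hV) hφ).toLp) := by
  have hW := continuous_limitPotential hV
  have hm : MemLp (fun p => (limitPotential V p : ℂ) * φ p) 2 volume :=
    memLp_of_cc (by have := hφ.continuous; fun_prop) hφ.2.mul_left
  have e : (memLp_generator hW hφ).toLp =
      Complex.I • (hφ.partialY.partialX.memLp.toLp - hm.toLp) := by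
    refine Lp.ext ?_
    filter_upwards [(memLp_generator hW hφ).coeFn_toLp, hm.coeFn_toLp,
      hφ.partialY.partialX.memLp.coeFn_toLp,
      Lp.coeFn_smul Complex.I (hφ.partialY.partialX.memLp.toLp - hm.toLp),
      Lp.coeFn_sub hφ.partialY.partialX.memLp.toLp hm.toLp] with p h1 h2 h3 h4 h5
    rw [h1, h4, Pi.smul_apply, h5, Pi.sub_apply, h2, h3, smul_eq_mul]
    ring
  rw [e]
  simp only [DampedForce.gen_apply]
  exact ((tendsto_diffY_diffX hφ (fun n => (D n).pos) hδ0).sub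
    (tendsto_mulOp_symbol hφ hV hD hδ0 hm)).const_smul _

end Consistency

/-! ### Weak limits of the approximate evolutions -/

section WeakLimit

/-- Every bounded scalar sequence converges along an ultrafilter. The limits of the pairings form a
bounded linear functional, represented by Riesz; the conjugation adapts the inner product to the
bilinear pairing. -/
lemma exists_weakLimit {u : ℕ → PlaneL2} {M : ℝ} (hu : ∀ n, ‖u n‖ ≤ M) :
    ∃ v : PlaneL2, ‖v‖ ≤ M ∧
      ∀ ψ, Tendsto (fun n => pairL ψ (u n)) (hyperfilter ℕ : Filter ℕ) (𝓝 (pairL ψ v)) := by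
  have hM : 0 ≤ M := (norm_nonneg _).trans (hu 0)
  have hb : ∀ ψ n, ‖pairL ψ (u n)‖ ≤ M * ‖ψ‖ := fun ψ n =>
    (norm_pairL_le _ _).trans <| (mul_comm _ _).trans_le <|
      mul_le_mul_of_nonneg_right (hu n) (norm_nonneg _)
  have hex : ∀ ψ, ∃ z : ℂ, ‖z‖ ≤ M * ‖ψ‖ ∧
      Tendsto (fun n => pairL ψ (u n)) (hyperfilter ℕ : Filter ℕ) (𝓝 z) := by
    intro ψ
    obtain ⟨z, hz, hl⟩ := (isCompact_closedBall (0 : ℂ) (M * ‖ψ‖)).ultrafilter_le_nhds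
      ((hyperfilter ℕ).map fun n => pairL ψ (u n)) (by
        rw [le_principal_iff]
        exact Filter.mem_map.2 (Eventually.of_forall fun n => by simpa using hb ψ n))
    exact ⟨z, by simpa using hz, hl⟩
  choose ℓ hℓ hlim using hex
  have hadd : ∀ ψ ψ', ℓ (ψ + ψ') = ℓ ψ + ℓ ψ' := fun ψ ψ' => by
    refine tendsto_nhds_unique (hlim (ψ + ψ')) (((hlim ψ).add (hlim ψ')).congr fun n => ?_)
    rw [pairL_comm (ψ + ψ'), map_add, pairL_comm _ ψ, pairL_comm _ ψ']
  have hsmul : ∀ (c : ℂ) ψ, ℓ (c • ψ) = c • ℓ ψ := fun c ψ => by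
    refine tendsto_nhds_unique (hlim (c • ψ)) (((hlim ψ).const_smul c).congr fun n => ?_)
    rw [pairL_comm (c • ψ), map_smul, pairL_comm]
  let ℓL : PlaneL2 →L[ℂ] ℂ := LinearMap.mkContinuous ⟨⟨ℓ, hadd⟩, hsmul⟩ M hℓ
  obtain ⟨w, hw⟩ := (InnerProductSpace.toDual ℂ PlaneL2).surjective ℓL
  have key : ∀ ψ, pairL ψ (star w) = ℓ ψ := fun ψ => by
    rw [pairL_comm, pairL, star_star, innerSL_apply_apply, ← InnerProductSpace.toDual_apply_apply, hw]
    rfl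
  refine ⟨star w, ?_, fun ψ => by rw [key]; exact hlim ψ⟩
  refine norm_le_of_pairing_le _ hM fun φ hφ => ?_
  rw [integral_mul_eq_pairL hφ.memLp, key]
  exact hℓ _

lemma IsMulY.of_weakLimit {ι : Type*} {l : Filter ι} [l.NeBot] {u v : ι → PlaneL2} {u₀ v₀ : PlaneL2}
    (h : ∀ n, IsMulY (u n) (v n)) (hu : ∀ ψ, Tendsto (fun n => pairL ψ (u n)) l (𝓝 (pairL ψ u₀)))
    (hv : ∀ ψ, Tendsto (fun n => pairL ψ (v n)) l (𝓝 (pairL ψ v₀))) : IsMulY u₀ v₀ := by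
  refine isMulY_of_pairing fun φ hφ => ?_
  have hψ : IsTestFun fun p : ℝ × ℝ => (p.2 : ℂ) * φ p :=
    hφ.smooth_mul (Complex.ofRealCLM.contDiff.comp contDiff_snd)
  rw [integral_mul_eq_pairL hφ.memLp, integral_mul_eq_pairL hψ.memLp]
  refine tendsto_nhds_unique (hv _) ((hu _).congr fun n => ?_)
  rw [← integral_mul_eq_pairL, ← integral_mul_eq_pairL, (h n).integral_eq]

/-- A first-order expansion in time with an error depending only on the stated bounds, hence uniform
along the approximation. The auxiliary Ψ stands in for χ when a second application of L has to be
bounded; it costs η at each of the two times, besides the η from L Φ - χ. -/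
lemma norm_pairL_sub_sub_le {L : PlaneL2 →L[ℂ] PlaneL2} (hL : ∀ ψ f, pairL ψ (L f) = pairL (L ψ) f)
    {u : ℝ → PlaneL2} (hu : ∀ t, HasDerivAt u (L (u t)) t) {M η K : ℝ} (hK : 0 ≤ K) {I : Set ℝ}
    (hI : Convex ℝ I)
    (hM : ∀ t ∈ I, ‖u t‖ ≤ M) {Φ Ψ χ : PlaneL2} (h1 : ‖L Φ - χ‖ ≤ η) (h2 : ‖χ - Ψ‖ ≤ η)
    (h3 : ‖L Ψ‖ ≤ K) {s t : ℝ} (hs : s ∈ I) (ht : t ∈ I) :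
    ‖pairL Φ (u s) - pairL Φ (u t) - (s - t) • pairL χ (u t)‖ ≤
      (3 * M * η + |s - t| * (K * M)) * |s - t| := by
  have hM0 : 0 ≤ M := (norm_nonneg _).trans (hM t ht)
  have hη : 0 ≤ η := (norm_nonneg _).trans h1
  have hder : ∀ ψ r, HasDerivAt (fun r => pairL ψ (u r)) (pairL (L ψ) (u r)) r := fun ψ r => by
    rw [← hL]
    exact ((pairL ψ).restrictScalars ℝ).hasFDerivAt.comp_hasDerivAt r (hu r)
  have hJ : uIcc t s ⊆ I := by
    rw [← segment_eq_uIcc]; exact hI.segment_subset ht hs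
  have hlip : ∀ r ∈ uIcc t s, ‖pairL Ψ (u r) - pairL Ψ (u t)‖ ≤ K * M * |s - t| := fun r hr => by
    have := (convex_uIcc t s).norm_image_sub_le_of_norm_hasDerivWithin_le
      (fun r' _ => (hder Ψ r').hasDerivWithinAt)
      (fun r' hr' => (norm_pairL_le _ _).trans (mul_le_mul h3 (hM r' (hJ hr')) (norm_nonneg _) hK))
      left_mem_uIcc hr
    refine this.trans (mul_le_mul_of_nonneg_left ?_ (by positivity))
    rw [Real.norm_eq_abs]
    exact abs_sub_left_of_mem_uIcc hr
  have hmain := (convex_uIcc t s).norm_image_sub_le_of_norm_hasDerivWithin_le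
    (f := fun r => pairL Φ (u r) - r • pairL χ (u t))
    (f' := fun r => pairL (L Φ) (u r) - pairL χ (u t)) (C := 3 * M * η + |s - t| * (K * M))
    (fun r _ => by
      have := (hder Φ r).sub ((hasDerivAt_id r).smul_const (pairL χ (u t)))
      rw [one_smul] at this
      exact this.hasDerivWithinAt) (fun r hr => by
        have e : pairL (L Φ) (u r) - pairL χ (u t) = pairL (L Φ - χ) (u r)
            + (pairL (χ - Ψ) (u r) - pairL (χ - Ψ) (u t)) + (pairL Ψ (u r) - pairL Ψ (u t)) := by
          simp only [pairL_sub_left]; ring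
        have hr' := hM r (hJ hr)
        have ht' := hM t ht
        have a1 := (norm_pairL_le (L Φ - χ) (u r)).trans (mul_le_mul h1 hr' (norm_nonneg _) hη)
        have a2 := (norm_pairL_le (χ - Ψ) (u r)).trans (mul_le_mul h2 hr' (norm_nonneg _) hη)
        have a3 := (norm_pairL_le (χ - Ψ) (u t)).trans (mul_le_mul h2 ht' (norm_nonneg _) hη)
        have a4 := hlip r hr
        have a5 := norm_sub_le (pairL (χ - Ψ) (u r)) (pairL (χ - Ψ) (u t))
        rw [e]
        refine (norm_add₃_le).trans ?_
        linarith) left_mem_uIcc right_mem_uIcc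
  refine (le_of_eq ?_).trans hmain
  congr 1
  simp only [sub_smul]
  ring

/-- Weak limits do not commute with time derivatives in general, but the uniform first-order
expansion passes to the limit at each pair of times. The limit of the generators on φ need not be
smooth, so it is approximated by a test function ψ on which the generators stay bounded. -/
lemma hasDerivWithinAt_weakLimit {δ : ℕ → ℝ} {A : ℝ} {D : ∀ n, DampedForce (δ n) A} {V : ℝ → ℝ}
    (hV : Continuous (deriv V)) (hD : ∀ n x, (D n).a 0 x = Real.sin (δ n * deriv V x) / δ n)
    (hδ0 : Tendsto δ atTop (𝓝 0)) {u : ℕ → ℝ → PlaneL2}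
    (hu : ∀ n t, HasDerivAt (u n) ((D n).gen (u n t)) t) {M T : ℝ}
    (hM : ∀ n, ∀ t ∈ Icc 0 T, ‖u n t‖ ≤ M) {v : ℝ → PlaneL2}
    (hv : ∀ t ∈ Icc 0 T, ∀ ψ, Tendsto (fun n => pairL ψ (u n t)) (hyperfilter ℕ : Filter ℕ)
      (𝓝 (pairL ψ (v t)))) {φ : ℝ × ℝ → ℂ} (hφ : IsTestFun φ) {t : ℝ} (ht : t ∈ Ico 0 T) :
    HasDerivWithinAt (fun s => ∫ p, v s p * φ p) (∫ p, v t p *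
      (Complex.I * partialX (partialY φ) p - Complex.I * (limitPotential V p : ℂ) * φ p))
      (Ici 0) t := by
  have hχ := memLp_generator (continuous_limitPotential hV) hφ
  have ht' : t ∈ Icc 0 T := Ico_subset_Icc_self ht
  have hM0 : 0 ≤ M := (norm_nonneg _).trans (hM 0 t ht')
  have hle : (hyperfilter ℕ : Filter ℕ) ≤ atTop := by
    rw [← Nat.cofinite_eq_atTop]; exact hyperfilter_le_cofinite
  simp only [integral_mul_eq_pairL hφ.memLp, integral_mul_eq_pairL hχ]
  rw [hasDerivWithinAt_iff_isLittleO, Asymptotics.isLittleO_iff]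
  intro c hc
  -- The relative error is 3Mη + |s - t| K M. This choice keeps the first term below c/2, and the
  -- radius below does so for the second.
  set η := c / (2 * (3 * M + 1)) with hη
  have hη0 : 0 < η := by positivity
  obtain ⟨ψ, hψ, hd⟩ := exists_testFun_near hχ.toLp hη0
  set K := ‖(memLp_generator (continuous_limitPotential hV) hψ).toLp‖ + 1 with hK
  have ev1 : ∀ᶠ n in (hyperfilter ℕ : Filter ℕ), ‖(D n).gen hφ.memLp.toLp - hχ.toLp‖ ≤ η :=
    hle (((tendsto_iff_norm_sub_tendsto_zero.1 (tendsto_gen hφ hV hD hδ0)).eventually_le_const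
      hη0))
  have ev2 : ∀ᶠ n in (hyperfilter ℕ : Filter ℕ), ‖(D n).gen hψ.memLp.toLp‖ ≤ K :=
    hle ((tendsto_gen hψ hV hD hδ0).norm.eventually_le_const (lt_add_one _))
  have hK0 : 0 < K := by positivity
  have hr : 0 < min (T - t) (c / (2 * (K * M + 1))) :=
    lt_min (sub_pos.2 ht.2) (by positivity)
  filter_upwards [self_mem_nhdsWithin, mem_nhdsWithin_of_mem_nhds (Metric.ball_mem_nhds t hr)]
    with s hs0 hs
  rw [Metric.mem_ball, Real.dist_eq] at hs
  have hs1 := hs.trans_le (min_le_left _ _)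
  have hs2 := hs.trans_le (min_le_right _ _)
  have hsT : s ∈ Icc 0 T := ⟨hs0, by linarith [le_abs_self (s - t)]⟩
  have hlim := (((hv s hsT hφ.memLp.toLp).sub (hv t ht' hφ.memLp.toLp)).sub
    ((hv t ht' hχ.toLp).const_smul (s - t))).norm
  refine le_of_tendsto hlim ?_
  filter_upwards [ev1, ev2] with n h1 h2
  refine (norm_pairL_sub_sub_le (D n).pairL_gen (hu n) hK0.le (convex_Icc 0 T) (hM n) h1 hd h2
    hsT ht').trans ?_
  rw [Real.norm_eq_abs]
  refine mul_le_mul_of_nonneg_right ?_ (abs_nonneg _)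
  have q1 : 3 * M * η ≤ c / 2 := by
    rw [hη, mul_div_assoc', div_le_iff₀ (by positivity)]
    nlinarith
  have q2 : |s - t| * (K * M) ≤ c / 2 := by
    rw [lt_div_iff₀ (by positivity)] at hs2
    nlinarith [abs_nonneg (s - t)]
  linarith

end WeakLimit

/-! ### Growth of the two potentials and their difference -/

section Potentials

variable {V : ℝ → ℝ} {C : ℝ}

lemma abs_sub_le_of_iteratedDeriv_two (hV : ContDiff ℝ 4 V) (hb : ∀ x, |iteratedDeriv 2 V x| ≤ C)
    (a b : ℝ) : |deriv V a - deriv V b| ≤ C * |a - b| :=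
  convex_univ.norm_image_sub_le_of_norm_hasDerivWithin_le
    (fun x _ => (hV.hasDerivAt_deriv x).hasDerivWithinAt) (fun x _ => hb x) (mem_univ b) (mem_univ a)

lemma abs_potential_sub_le (hV : ContDiff ℝ 4 V) (hb : ∀ x, |iteratedDeriv 2 V x| ≤ C) (a b : ℝ) :
    |V a - V b| ≤ (|deriv V 0| + C * (|a| + |b|)) * |a - b| := by
  have hC : 0 ≤ C := (abs_nonneg _).trans (hb 0)
  refine (convex_Icc (-(|a| + |b|)) (|a| + |b|)).norm_image_sub_le_of_norm_hasDerivWithin_le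
    (fun x _ => (hV.differentiable (by norm_num) x).hasDerivAt.hasDerivWithinAt) (fun x hx => ?_)
    (abs_le.1 (by linarith [abs_nonneg a])) (abs_le.1 (by linarith [abs_nonneg b]))
  have h1 := abs_sub_le_of_iteratedDeriv_two hV hb x 0
  rw [sub_zero] at h1
  have h2 : |x| ≤ |a| + |b| := abs_le.2 hx
  have h3 := abs_sub_abs_le_abs_sub (deriv V x) (deriv V 0)
  rw [Real.norm_eq_abs]
  nlinarith

lemma abs_limitPotential_sub_le (hV : ContDiff ℝ 4 V) (hb : ∀ x, |iteratedDeriv 2 V x| ≤ C)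
    (p q : ℝ × ℝ) : |limitPotential V p - limitPotential V q| ≤
      (|deriv V 0| + C) * (1 + ‖p‖ + ‖q‖) * ‖p - q‖ := by
  have hC : 0 ≤ C := (abs_nonneg _).trans (hb 0)
  have h1 := abs_sub_le_of_iteratedDeriv_two hV hb p.1 0
  have h2 := abs_sub_le_of_iteratedDeriv_two hV hb p.1 q.1
  have h3 := abs_sub_abs_le_abs_sub (deriv V p.1) (deriv V 0)
  have n1 : |p.1| ≤ ‖p‖ := norm_fst_le p
  have n2 : |q.2| ≤ ‖q‖ := norm_snd_le q
  have n3 : |p.1 - q.1| ≤ ‖p - q‖ := norm_fst_le (p - q)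
  have n4 : |p.2 - q.2| ≤ ‖p - q‖ := norm_snd_le (p - q)
  rw [sub_zero] at h1
  have e : limitPotential V p - limitPotential V q =
      deriv V p.1 * (p.2 - q.2) + (deriv V p.1 - deriv V q.1) * q.2 := by
    simp only [limitPotential]; ring
  rw [e]
  refine (abs_add_le _ _).trans ?_
  rw [abs_mul, abs_mul]
  have k1 : |deriv V p.1| * |p.2 - q.2| ≤ (|deriv V 0| + C * ‖p‖) * ‖p - q‖ :=
    mul_le_mul (by nlinarith) n4 (abs_nonneg _) (by positivity)
  have k2 : |deriv V p.1 - deriv V q.1| * |q.2| ≤ (C * ‖p - q‖) * ‖q‖ :=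
    mul_le_mul (h2.trans (by gcongr)) n2 (abs_nonneg _) (by positivity)
  have k3 : 0 ≤ (C + |deriv V 0| * (‖p‖ + ‖q‖)) * ‖p - q‖ := by positivity
  nlinarith

lemma continuous_weylPotential {ħ : ℝ} (hV : Continuous V) : Continuous (weylPotential ħ V) := by
  unfold weylPotential; fun_prop

/-- The constant degenerates as ħ → 0 and involves V'(0), on which there is no uniform control. This
is harmless: the energy inequality needs such a constant to exist, but its conclusion does not
contain it. -/
lemma abs_weylPotential_sub_le {ħ : ℝ} (hħ : 0 < ħ) (hV : ContDiff ℝ 4 V)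
    (hb : ∀ x, |iteratedDeriv 2 V x| ≤ C) (p q : ℝ × ℝ) :
    |weylPotential ħ V p - weylPotential ħ V q| ≤
      (2 * (|deriv V 0| + C) * (1 + ħ) ^ 2 / ħ) * (1 + ‖p‖ + ‖q‖) * ‖p - q‖ := by
  have hC : 0 ≤ C := (abs_nonneg _).trans (hb 0)
  have hlin : ∀ (σ : ℝ), |σ| ≤ ħ → ∀ r : ℝ × ℝ, |r.1 + σ * r.2| ≤ (1 + ħ) * ‖r‖ := by
    intro σ hσ r
    have n1 : |r.1| ≤ ‖r‖ := norm_fst_le r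
    have n2 : |r.2| ≤ ‖r‖ := norm_snd_le r
    refine (abs_add_le _ _).trans ?_
    rw [abs_mul]
    have := mul_le_mul hσ n2 (abs_nonneg _) hħ.le
    linarith
  have hone : ∀ (σ : ℝ), |σ| ≤ ħ → |V (p.1 + σ * p.2) - V (q.1 + σ * q.2)| ≤
      (|deriv V 0| + C) * (1 + ħ) ^ 2 * (1 + ‖p‖ + ‖q‖) * ‖p - q‖ := by
    intro σ hσ
    refine (abs_potential_sub_le hV hb _ _).trans ?_
    have h1 := hlin σ hσ p
    have h2 := hlin σ hσ q
    have h3 := hlin σ hσ (p - q)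
    have e : (p - q).1 + σ * (p - q).2 = p.1 + σ * p.2 - (q.1 + σ * q.2) := by
      simp only [Prod.fst_sub, Prod.snd_sub]; ring
    rw [e] at h3
    have h4 : |deriv V 0| + C * (|p.1 + σ * p.2| + |q.1 + σ * q.2|) ≤
        (|deriv V 0| + C) * (1 + ħ) * (1 + ‖p‖ + ‖q‖) := by
      have k1 : C * (|p.1 + σ * p.2| + |q.1 + σ * q.2|) ≤ C * ((1 + ħ) * ‖p‖ + (1 + ħ) * ‖q‖) :=
        mul_le_mul_of_nonneg_left (add_le_add h1 h2) hC
      have k2 : 0 ≤ |deriv V 0| * (‖p‖ + ‖q‖ + ħ * (1 + ‖p‖ + ‖q‖)) + C * (1 + ħ) := by positivity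
      nlinarith
    refine (mul_le_mul h4 h3 (abs_nonneg _) (by positivity)).trans_eq ?_
    ring
  have hp := hone (ħ / 2) (by rw [abs_of_pos (by positivity)]; linarith)
  have hm := hone (-(ħ / 2)) (by rw [abs_neg, abs_of_pos (by positivity)]; linarith)
  have e : weylPotential ħ V p - weylPotential ħ V q =
      ((V (p.1 + ħ / 2 * p.2) - V (q.1 + ħ / 2 * q.2))
        - (V (p.1 + -(ħ / 2) * p.2) - V (q.1 + -(ħ / 2) * q.2))) / ħ := by
    simp only [weylPotential, neg_mul, ← sub_eq_add_neg]; ring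
  rw [e, abs_div, abs_of_pos hħ, div_le_iff₀ hħ]
  refine (abs_sub _ _).trans ((add_le_add hp hm).trans_eq ?_)
  field_simp
  ring

/-- The second-order terms cancel by symmetry. Three nested mean value inequalities give the cubic
bound, with a constant that is not optimal. -/
lemma abs_symmetric_taylor_le (hV : ContDiff ℝ 4 V) (hb : ∀ x, |iteratedDeriv 3 V x| ≤ C)
    (x s : ℝ) : |V (x + s) - V (x - s) - 2 * s * deriv V x| ≤ 2 * C * |s| ^ 3 := by
  have hC : 0 ≤ C := (abs_nonneg _).trans (hb 0)
  have hs : s ∈ Icc (-|s|) |s| := abs_le.1 le_rfl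
  have hz : (0 : ℝ) ∈ Icc (-|s|) |s| := by constructor <;> linarith [abs_nonneg s]
  have d0 : ∀ r, HasDerivAt V (deriv V r) r := fun r =>
    (hV.differentiable (by norm_num) r).hasDerivAt
  have h2 : ∀ r ∈ Icc (-|s|) |s|,
      ‖iteratedDeriv 2 V (x + r) - iteratedDeriv 2 V (x - r)‖ ≤ 2 * C * |s| := by
    intro r hr
    have := convex_univ.norm_image_sub_le_of_norm_hasDerivWithin_le
      (fun y _ => (hV.hasDerivAt_iteratedDeriv (n := 2) (by norm_num) y).hasDerivWithinAt)
      (fun y _ => hb y) (mem_univ (x - r)) (mem_univ (x + r))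
    refine this.trans ?_
    rw [show x + r - (x - r) = 2 * r by ring, norm_mul, Real.norm_ofNat]
    have : ‖r‖ ≤ |s| := abs_le.2 hr
    nlinarith
  have h1 : ∀ r ∈ Icc (-|s|) |s|,
      ‖deriv V (x + r) + deriv V (x - r) - 2 * deriv V x‖ ≤ 2 * C * |s| ^ 2 := by
    intro r hr
    have := (convex_Icc (-|s|) |s|).norm_image_sub_le_of_norm_hasDerivWithin_le
      (f := fun r => deriv V (x + r) + deriv V (x - r))
      (f' := fun r => iteratedDeriv 2 V (x + r) - iteratedDeriv 2 V (x - r))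
      (fun r _ => by
        have a1 := (hV.hasDerivAt_deriv (x + r)).comp_const_add x r
        have a2 := (hV.hasDerivAt_deriv (x - r)).comp_const_sub x r
        exact (a1.add a2).hasDerivWithinAt) h2 hz hr
    simp only [add_zero, sub_zero, ← two_mul] at this
    refine this.trans ?_
    have : ‖r‖ ≤ |s| := abs_le.2 hr
    have := mul_le_mul_of_nonneg_left this (by positivity : 0 ≤ 2 * C * |s|)
    nlinarith
  have h0 := (convex_Icc (-|s|) |s|).norm_image_sub_le_of_norm_hasDerivWithin_le
    (f := fun r => V (x + r) - V (x - r) - 2 * r * deriv V x)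
    (f' := fun r => deriv V (x + r) + deriv V (x - r) - 2 * deriv V x)
    (fun r _ => by
      have a1 := (d0 (x + r)).comp_const_add x r
      have a2 := (d0 (x - r)).comp_const_sub x r
      have a3 := (((hasDerivAt_id r).const_mul 2).mul_const (deriv V x))
      refine (((a1.sub a2).sub a3).congr_deriv ?_).hasDerivWithinAt
      ring) h1 hz hs
  simp only [add_zero, sub_zero, sub_self, mul_zero, zero_mul] at h0
  refine h0.trans_eq ?_
  rw [Real.norm_eq_abs]
  ring

lemma abs_weylPotential_sub_limitPotential_le {ħ : ℝ} (hħ : 0 < ħ) (hV : ContDiff ℝ 4 V)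
    (hb : ∀ x, |iteratedDeriv 3 V x| ≤ C) (p : ℝ × ℝ) :
    |weylPotential ħ V p - limitPotential V p| ≤ C / 4 * ħ ^ 2 * |p.2| ^ 3 := by
  have h := abs_symmetric_taylor_le hV hb p.1 (ħ / 2 * p.2)
  have e : weylPotential ħ V p - limitPotential V p =
      (V (p.1 + ħ / 2 * p.2) - V (p.1 - ħ / 2 * p.2) - 2 * (ħ / 2 * p.2) * deriv V p.1) / ħ := by
    simp only [weylPotential, limitPotential]; field_simp
  rw [e, abs_div, abs_of_pos hħ, div_le_iff₀ hħ]
  refine h.trans_eq ?_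
  rw [abs_mul, abs_of_pos (by positivity : 0 < ħ / 2)]
  ring

end Potentials

/-! ### Uniqueness for the weak equation -/

section Comparison

/-- The competitor v is only bounded in norm, not strongly continuous in time, since it will come
from a weak limit. The energy inequality with zero source still applies to the difference. -/
lemma IsWeakSolution.eq_of_bounded {W : ℝ × ℝ → ℝ} {K : ℝ} (hWc : Continuous W) (hK : 0 ≤ K)
    (hW : ∀ p q, |W p - W q| ≤ K * (1 + ‖p‖ + ‖q‖) * ‖p - q‖) {u₀ : PlaneL2} {u v : ℝ → PlaneL2}
    (hu : IsWeakSolution W u₀ u) (hv0 : v 0 = u₀) {M T : ℝ} (hT : 0 ≤ T)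
    (hvb : ∀ t ∈ Icc 0 T, ‖v t‖ ≤ M)
    (hv : ∀ φ : ℝ × ℝ → ℂ, IsTestFun φ → ∀ t ∈ Icc 0 T,
      HasDerivWithinAt (fun s => ∫ p, v s p * φ p) (∫ p, v t p *
        (Complex.I * partialX (partialY φ) p - Complex.I * (W p : ℂ) * φ p)) (Ici 0) t) :
    u T = v T := by
  obtain ⟨M', hM'⟩ := isCompact_Icc.exists_bound_of_continuousOn
    (hu.continuous.mono (Icc_subset_Ici_self : Icc 0 T ⊆ Ici 0))
  have h : IsForcedWeakSolution W T (M' + M) 0 0 (fun t => u t - v t) := by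
    refine ⟨fun t ht => (norm_sub_le _ _).trans (add_le_add (hM' t ht) (hvb t ht)),
      fun t _ => by simp, fun φ hφ t ht => ?_⟩
    have h1 := (hu.equation φ hφ t ht.1).sub (hv φ hφ t ht)
    have hg := memLp_generator hWc hφ
    have e0 : ∫ p, (0 : ℝ → PlaneL2) t p * φ p = 0 := by
      rw [integral_mul_eq_pairL hφ.memLp, Pi.zero_apply, map_zero]
    rw [e0, add_zero]
    simp only [integral_mul_eq_pairL hφ.memLp, integral_mul_eq_pairL hg, map_sub] at h1 ⊢
    exact h1
  have := h.norm_le hT hWc hK hW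
  simp only [hu.initial, hv0, sub_self, norm_zero, zero_mul, add_zero] at this
  exact sub_eq_zero.1 (norm_le_zero_iff.1 this)

end Comparison

/-! ### The third moment and the comparison of the two flows -/

section Comparison

/-- The bound at time `t` on `y³ R̂(t)` propagated from the initial datum. -/
noncomputable def momentBound (C C₀ t : ℝ) : ℝ :=
  √(Real.exp (160 * (1 + (1 + C) ^ 3) * t) * (10 * C₀ ^ 2))

lemma momentBound_mono {C C₀ s t : ℝ} (hC : 0 ≤ C) (hst : s ≤ t) :
    momentBound C C₀ s ≤ momentBound C C₀ t := by
  unfold momentBound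
  gcongr

lemma jetEnergy_le {h : ℕ → ℕ → PlaneL2} {c : ℝ} (hh : ∀ b α, b + α ≤ 3 → ‖h b α‖ ≤ c) :
    jetEnergy h ≤ 10 * c ^ 2 := by
  refine (Finset.sum_le_card_nsmul jetIndex _ (c ^ 2) fun i hi =>
    pow_le_pow_left₀ (norm_nonneg _) (hh _ _ (mem_jetIndex.1 hi)) 2).trans_eq ?_
  rw [show jetIndex.card = 10 by decide, nsmul_eq_mul]
  norm_num

/-- The solution of the semiclassical limit equation has a third moment in `y`. -/
theorem IsLimitSolution.exists_third_moment {V : ℝ → ℝ} {C C₀ : ℝ} (hV : ContDiff ℝ 4 V)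
    (hb : ∀ n : ℕ, 2 ≤ n → n ≤ 4 → ∀ x, |iteratedDeriv n V x| ≤ C) {f : PlaneL2}
    (hf : ∀ a b α β : ℕ, a + b + α + β ≤ 3 → WeightedDerivNormLT a b α β f C₀) {u : ℝ → PlaneL2}
    (hu : IsLimitSolution V f u) {T : ℝ} (hT : 0 ≤ T) :
    ∃ g₁ g₂ g₃ : PlaneL2, IsMulY (u T) g₁ ∧ IsMulY g₁ g₂ ∧ IsMulY g₂ g₃ ∧
      ‖g₃‖ ≤ momentBound C C₀ T := by
  have hC : 0 ≤ C := (abs_nonneg _).trans (hb 2 le_rfl (by norm_num) 0)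
  have hVc : Continuous (deriv V) := by
    simpa using hV.continuous_iteratedDeriv_four (n := 1) (by norm_num)
  obtain ⟨h₀, H₀, h00, h₀c⟩ := exists_isJet hf
  have hE := jetEnergy_le fun b α hbα => (h₀c b α hbα).le
  set δ : ℕ → ℝ := fun n => 1 / ((n : ℝ) + 1) with hδ
  have hδ0 : Tendsto δ atTop (𝓝 0) := tendsto_one_div_add_atTop_nhds_zero_nat
  let D : ∀ n, DampedForce (δ n) ((1 + C) ^ 3) := fun n => dampedForce hV hb (by positivity)
    ((div_le_one (by positivity)).2 (by linarith [(Nat.cast_nonneg n : (0 : ℝ) ≤ n)]))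
  choose h hinit hjet hder henergy using fun n => (D n).exists_jet_evolution H₀
  have hbd : ∀ t, 0 ≤ t → ∀ b α, b + α ≤ 3 → ∀ n, ‖h n t b α‖ ≤ momentBound C C₀ t := by
    intro t ht b α hbα n
    refine (norm_le_sqrt_jetEnergy _ hbα).trans (Real.sqrt_le_sqrt ((henergy n t ht).trans ?_))
    exact mul_le_mul_of_nonneg_left hE (Real.exp_pos _).le
  -- One ultrafilter serves all times and all orders, so no subsequence or equicontinuity argument
  -- is needed.
  have hlim : ∀ (α : ℕ) (t : ℝ), ∃ v : PlaneL2, 0 ≤ t → α ≤ 3 → ‖v‖ ≤ momentBound C C₀ t ∧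
      ∀ ψ, Tendsto (fun n => pairL ψ (h n t 0 α)) (hyperfilter ℕ : Filter ℕ)
        (𝓝 (pairL ψ v)) := by
    intro α t
    by_cases H : 0 ≤ t ∧ α ≤ 3
    · obtain ⟨v, hv⟩ := exists_weakLimit (hbd t H.1 0 α (by omega))
      exact ⟨v, fun _ _ => hv⟩
    · exact ⟨0, fun h1 h2 => absurd ⟨h1, h2⟩ H⟩
  choose v hv using hlim
  have hmul : ∀ α < 3, IsMulY (v α T) (v (α + 1) T) := fun α hα =>
    IsMulY.of_weakLimit (fun n => (hjet n T).mulY 0 α (by omega)) (hv α T hT (by omega)).2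
      (hv (α + 1) T hT (by omega)).2
  have hv0 : v 0 0 = f := by
    refine eq_of_pairing_eq fun φ hφ => ?_
    rw [integral_mul_eq_pairL hφ.memLp, integral_mul_eq_pairL hφ.memLp]
    refine tendsto_nhds_unique ((hv 0 0 le_rfl (by norm_num)).2 _) (tendsto_const_nhds.congr ?_)
    intro n
    rw [hinit n 0 0 (by norm_num), h00]
  have huv : u T = v 0 T := by
    refine IsWeakSolution.eq_of_bounded (K := |deriv V 0| + C) (continuous_limitPotential hVc)
      (by positivity) (abs_limitPotential_sub_le hV (hb 2 le_rfl (by norm_num))) hu hv0 hT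
      (M := momentBound C C₀ T) (fun t ht => ?_) fun φ hφ t ht => ?_
    · exact (hv 0 t ht.1 (by norm_num)).1.trans (momentBound_mono hC ht.2)
    -- The horizon T + 1 leaves room to the right of the endpoint t = T.
    · exact hasDerivWithinAt_weakLimit hVc (fun _ _ => rfl) hδ0 (D := D)
        (u := fun n t => h n t 0 0) (T := T + 1) (M := momentBound C C₀ (T + 1)) hder
        (fun n s hs => (hbd s hs.1 0 0 (by norm_num) n).trans (momentBound_mono hC hs.2))
        (fun s hs => (hv 0 s hs.1 (by norm_num)).2) hφ ⟨ht.1, by linarith [ht.2]⟩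
  rw [huv]
  exact ⟨v 1 T, v 2 T, v 3 T, hmul 0 (by norm_num), hmul 1 (by norm_num), hmul 2 (by norm_num),
    (hv 3 T hT le_rfl).1⟩

/-- The source of the difference equation: the cubic Taylor bound is paid for by the third moment g₃
= y³ r. -/
lemma exists_defect {V : ℝ → ℝ} {C ħ : ℝ} (hħ : 0 < ħ) (hV : ContDiff ℝ 4 V)
    (hb : ∀ x, |iteratedDeriv 3 V x| ≤ C) {r g₁ g₂ g₃ : PlaneL2}
    (h1 : IsMulY r g₁) (h2 : IsMulY g₁ g₂) (h3 : IsMulY g₂ g₃) :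
    ∃ F : PlaneL2, ‖F‖ ≤ C / 4 * ħ ^ 2 * ‖g₃‖ ∧ F =ᵐ[volume] fun p =>
      -Complex.I * ((weylPotential ħ V p - limitPotential V p : ℝ) : ℂ) * r p := by
  have hVc : Continuous (deriv V) := by
    simpa using hV.continuous_iteratedDeriv_four (n := 1) (by norm_num)
  have hW : Continuous fun p => weylPotential ħ V p - limitPotential V p :=
    (continuous_weylPotential hV.continuous).sub (continuous_limitPotential hVc)
  have hbd : ∀ᵐ p, ‖-Complex.I * ((weylPotential ħ V p - limitPotential V p : ℝ) : ℂ) * r p‖ ≤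
      C / 4 * ħ ^ 2 * ‖g₃ p‖ := by
    filter_upwards [h1, h2, h3] with p e1 e2 e3
    rw [e3, e2, e1, norm_mul, norm_mul, norm_neg, Complex.norm_I, one_mul, Complex.norm_real,
      norm_mul, norm_mul, norm_mul, Complex.norm_real]
    refine (mul_le_mul_of_nonneg_right (abs_weylPotential_sub_limitPotential_le hħ hV hb p)
      (norm_nonneg _)).trans_eq ?_
    rw [Real.norm_eq_abs]
    ring
  have hm : MemLp (fun p => -Complex.I *
      ((weylPotential ħ V p - limitPotential V p : ℝ) : ℂ) * r p) 2 volume :=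
    (Lp.memLp g₃).of_le_mul ((continuous_const.mul
      (Complex.continuous_ofReal.comp hW)).aestronglyMeasurable.mul (Lp.aestronglyMeasurable r)) hbd
  refine ⟨hm.toLp, Lp.norm_le_mul_norm_of_ae_le_mul ?_, hm.coeFn_toLp⟩
  filter_upwards [hm.coeFn_toLp, hbd] with p e1 e2
  rw [e1]; exact e2

/-- The solutions of the von Neumann equation and of the semiclassical limit equation stay close
at order `ħ²`. -/
theorem IsVonNeumannSolution.norm_sub_le {V : ℝ → ℝ} {C C₀ ħ : ℝ} (hħ : 0 < ħ)
    (hV : ContDiff ℝ 4 V) (hb : ∀ n : ℕ, 2 ≤ n → n ≤ 4 → ∀ x, |iteratedDeriv n V x| ≤ C)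
    {f f' : PlaneL2}
    (hf : ∀ a b α β : ℕ, a + b + α + β ≤ 3 → WeightedDerivNormLT a b α β f C₀)
    {R r : ℝ → PlaneL2} (hR : IsVonNeumannSolution ħ V f' R) (hr : IsLimitSolution V f r)
    {T : ℝ} (hT : 0 ≤ T) :
    ‖R T - r T‖ ≤ ‖f' - f‖ + C / 4 * ħ ^ 2 * momentBound C C₀ T * T := by
  have hC : 0 ≤ C := (abs_nonneg _).trans (hb 2 le_rfl (by norm_num) 0)
  have hVc : Continuous (deriv V) := by
    simpa using hV.continuous_iteratedDeriv_four (n := 1) (by norm_num)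
  have hWc := continuous_weylPotential (ħ := ħ) hV.continuous
  have hF : ∀ t, ∃ F : PlaneL2, 0 ≤ t → ‖F‖ ≤ C / 4 * ħ ^ 2 * momentBound C C₀ t ∧
      F =ᵐ[volume] fun p =>
        -Complex.I * ((weylPotential ħ V p - limitPotential V p : ℝ) : ℂ) * r t p := by
    intro t
    by_cases ht : 0 ≤ t
    · obtain ⟨g₁, g₂, g₃, h1, h2, h3, hg⟩ := IsLimitSolution.exists_third_moment hV hb hf hr ht
      obtain ⟨F, hF1, hF2⟩ := exists_defect hħ hV (hb 3 (by norm_num) (by norm_num)) h1 h2 h3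
      exact ⟨F, fun _ => ⟨hF1.trans (mul_le_mul_of_nonneg_left hg (by positivity)), hF2⟩⟩
    · exact ⟨0, fun h => absurd h ht⟩
  -- The source is chosen separately at each time; the energy inequality asks for no measurability
  -- in time.
  choose F hF using hF
  obtain ⟨M, hM⟩ := isCompact_Icc.exists_bound_of_continuousOn
    ((hR.continuous.sub hr.continuous).mono (Icc_subset_Ici_self : Icc 0 T ⊆ Ici 0))
  have h : IsForcedWeakSolution (weylPotential ħ V) T M
      (C / 4 * ħ ^ 2 * momentBound C C₀ T) F (fun t => R t - r t) := by
    refine ⟨hM, fun t ht => (hF t ht.1).1.trans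
      (mul_le_mul_of_nonneg_left (momentBound_mono hC ht.2) (by positivity)), fun φ hφ t ht => ?_⟩
    have h1 := (hR.equation φ hφ t ht.1).sub (hr.equation φ hφ t ht.1)
    have hg := memLp_generator hWc hφ
    have hg' := memLp_generator (continuous_limitPotential hVc) hφ
    have e0 : ∫ p, F t p * φ p = (∫ p, r t p * (Complex.I * partialX (partialY φ) p
        - Complex.I * (weylPotential ħ V p : ℂ) * φ p)) - ∫ p, r t p *
          (Complex.I * partialX (partialY φ) p - Complex.I * (limitPotential V p : ℂ) * φ p) := by
      rw [← integral_sub (integrable_mul_of_memLp hg _) (integrable_mul_of_memLp hg' _)]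
      refine integral_congr_ae ?_
      filter_upwards [(hF t ht.1).2] with p hp
      rw [hp]
      push_cast
      ring
    rw [e0]
    simp only [integral_mul_eq_pairL hφ.memLp, integral_mul_eq_pairL hg,
      integral_mul_eq_pairL hg', map_sub] at h1 ⊢
    refine h1.congr_deriv ?_
    ring
  have := h.norm_le hT hWc (by positivity)
    (abs_weylPotential_sub_le hħ hV (hb 2 le_rfl (by norm_num)))
  rwa [hR.initial, hr.initial] at this

end Comparison

theorem theorem1p1
    (V : ℝ → ℝ → ℝ) (Rin Rhatin : ℝ → PlaneL2) (C C₀ : ℝ)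
    (hV : ∀ ħ : ℝ, 0 < ħ → ContDiff ℝ 4 (V ħ))
    (hVbound : ∀ ħ : ℝ, 0 < ħ → ∀ n : ℕ, 2 ≤ n → n ≤ 4 →
      ∀ x : ℝ, |iteratedDeriv n (V ħ) x| ≤ C)
    (hRhatin : ∀ ħ : ℝ, 0 < ħ → ∀ a b α β : ℕ, a + b + α + β ≤ 3 →
      WeightedDerivNormLT a b α β (Rhatin ħ) C₀)
    (hRin : ∀ ħ : ℝ, 0 < ħ → ‖Rin ħ‖ < C₀) :
    ∃ Ct : ℝ → ℝ, ∀ ħ : ℝ, 0 < ħ → ∀ R Rhat : ℝ → PlaneL2,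
      IsVonNeumannSolution ħ (V ħ) (Rin ħ) R →
      IsLimitSolution (V ħ) (Rhatin ħ) Rhat →
      ∀ t : ℝ, 0 ≤ t →
        ‖R t - Rhat t‖ ≤ ‖Rin ħ - Rhatin ħ‖ + Ct t * ħ ^ 2 := by
  -- Only C, C₀ and t enter, so the constant is uniform in ħ.
  refine ⟨fun t => C / 4 * momentBound C C₀ t * t, fun ħ hħ R Rhat hR hRhat t ht => ?_⟩
  refine (IsVonNeumannSolution.norm_sub_le hħ (hV ħ hħ) (hVbound ħ hħ) (hRhatin ħ hħ) hR hRhat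
    ht).trans_eq ?_
  ring
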